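/- Let $k$ be an algebraically closed field of characteristic $0$ and $n\ge 1$. Let $C$ be the irreducible nodal curve of arithmetic genus $1$ over $k$, with normalization $\pi:\mathbb{P}^1\to C$ such that $\pi(0)=\pi(\infty)$ is the node, where $t=x_1/x_0$ is the coordinate on $\mathbb{P}^1$; let $\omega_C$ be its dualizing sheaf (rational differentials on $\mathbb{P}^1$ that are regular away from $0,\infty$, with at most simple poles and opposite residues at $0$ and $\infty$). Let $(\sigma,\Gamma_1,\Gamma_2)$ be associative Belavin–Drinfeld data: with $\sigma_0=(1\,2\,\dots\,n)$, $\sigma\in S_n$ is an $n$-cycle and $\Gamma_1,\Gamma_2$ are proper subsets of $\{(i,\sigma_0(i)) : 1\le i\le n\}$ with $(\sigma\times\sigma)(\Gamma_1)=\Gamma_2$. Assume $(n,1)\notin\Gamma_1$ and choose $m\in\{1,\dots,n\}$ with $(\sigma_0^{-1}(m),m)\notin\Gamma_2$. For $a=1,2$ let $\Pi_a$ be the set of pairs $(i,\sigma_0^r(i))$, $r\ge 1$, such that $(\sigma_0^{s}(i),\sigma_0^{s+1}(i))\in\Gamma_a$ for $0\le s<r$. Let $S_m$ be the set of pairs $(i,j)$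 with $i<j<m$, or $m\le i<j$, or $i\ge m>j$. Let $I\subset \mathrm{Mat}_n(k)\oplus\mathrm{Mat}_n(k)$ be the subalgebra of pairs $(a,b)$ such that - $a_{ij}=0$ whenever $j<i$ and $(j,i)\notin\Pi_1$; - $b_{ij}=0$ whenever $(i,j)\in S_m$ and $(i,j)\notin\Pi_2$; - $a_{ij}=b_{\sigma(i)\sigma(j)}$ and $a_{ji}=b_{\sigma(j)\sigma(i)}$ whenever $i=j$ or $(i,j)\in\Pi_1$. Put $\epsilon_i=0$ for $i<m$, $\epsilon_i=1$ for $i\ge m$, and $\mathcal{V}=\bigoplus_{i=1}^n\mathcal{O}_{\mathbb{P}^1}(\epsilon_i)$, with the fibers $\mathcal{V}|_0$ and $\mathcal{V}|_\infty$ identified with $k^n$ by means of the trivializations $x_0$ and $x_1$ of $\mathcal{O}(1)$ at $0$ and at $\infty$. Let $\mathcal{A}\subset\pi_*\underline{\mathrm{End}}(\mathcal{V})$ be the sheaf of $\mathcal{O}_C$-algebras consisting of the sections $a$ with $(a(0),a(\infty))\in I$. Then $h^0(C,\mathcal{A})=1$, and $\mathcal{A}$ is a symmetric spherical order over $C$ with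 center $\mathcal{O}_C$. That is: $\mathcal{A}$ is a torsion free coherent sheaf of $\mathcal{O}_C$-algebras whose stalk at the generic point is a matrix algebra over the field of rational functions of $C$; $H^0(C,\mathcal{O}_C)=k$; there is a nonzero morphism of $\mathcal{O}_C$-modules $\tau:\mathcal{A}\to\omega_C$, unique up to rescaling by elements of $k$, it satisfies $\tau(xy)=\tau(yx)$, and the induced morphism $\mathcal{A}\to\underline{\mathrm{Hom}}(\mathcal{A},\omega_C)$, $y\mapsto(x\mapsto\tau(xy))$, is an isomorphism; and the center of $\mathcal{A}$ is $\mathcal{O}_C$. -/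

import Mathlib

open CategoryTheory Opposite TopologicalSpace AlgebraicGeometry

universe u

noncomputable section

/-! ### Sheaves of modules and algebras on a ringed space -/

namespace SphericalOrder

/-- The structure sheaf of a ringed space, as a sheaf of (not necessarily commutative) rings. -/
def ringSheaf (C : RingedSpace.{u}) : TopCat.Sheaf RingCat.{u} C.carrier :=
  ⟨C.presheaf ⋙ forget₂ CommRingCat RingCat,
    (CategoryTheory.GrothendieckTopology.HasSheafCompose.isSheaf
      (J := Opens.grothendieckTopology C.carrier) (F := forget₂ CommRingCat RingCat) C.presheaf C.IsSheaf)⟩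

/-- Sheaves of `𝒪_C`-modules. -/
abbrev Modules (C : RingedSpace.{u}) := SheafOfModules.{u} (ringSheaf C)

/-- Sections of the structure sheaf over `U`. -/
abbrev Fn (C : RingedSpace.{u}) (U : Opens C) : Type u := C.presheaf.obj (op U)

/-- Restriction of functions. -/
abbrev Fn.res {C : RingedSpace.{u}} {U V : Opens C} (h : V ≤ U) : Fn C U →+* Fn C V :=
  (C.presheaf.map (homOfLE h).op).hom

/-- Sections of a sheaf of modules over `U`. -/
def Sec {C : RingedSpace.{u}} (M : Modules C) (U : Opens C) : Type u := M.val.obj (op U)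

instance {C : RingedSpace.{u}} (M : Modules C) (U : Opens C) : AddCommGroup (Sec M U) :=
  inferInstanceAs (AddCommGroup (M.val.obj (op U)))

instance {C : RingedSpace.{u}} (M : Modules C) (U : Opens C) : Module (Fn C U) (Sec M U) :=
  (M.val.obj (op U)).isModule

/-- Restriction of sections. -/
def Sec.res {C : RingedSpace.{u}} {M : Modules C} {U V : Opens C} (h : V ≤ U) :
    Sec M U →+ Sec M V :=
  (M.val.presheaf.map (homOfLE h).op).hom

/-- A morphism of sheaves of modules, on sections over `U`. -/
def Sec.map {C : RingedSpace.{u}} {M N : Modules C} (f : SheafOfModules.Hom M N) (U : Opens C) :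
    Sec M U →ₗ[Fn C U] Sec N U :=
  (f.val.app (op U)).hom

/-- A sheaf of `𝒪_C`-algebras: a sheaf of rings with a central morphism from `𝒪_C`. -/
structure AlgebraSheaf (C : RingedSpace.{u}) where
  sheaf : TopCat.Sheaf RingCat.{u} C.carrier
  unit : ringSheaf C ⟶ sheaf
  central : ∀ (U : Opens C) (f : (ringSheaf C).obj.obj (op U)) (a : sheaf.obj.obj (op U)),
    Commute ((unit.hom.app (op U)).hom f) a


namespace AlgebraSheaf

variable {C : RingedSpace.{u}} (A : AlgebraSheaf C)

/-- Sections of a sheaf of algebras over `U`. -/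
abbrev Sections (U : Opens C) : Type u := A.sheaf.obj.obj (op U)

/-- Restriction of sections. -/
abbrev res {U V : Opens C} (h : V ≤ U) : A.Sections U →+* A.Sections V :=
  (A.sheaf.obj.map (homOfLE h).op).hom

/-- The structure map `𝒪_C(U) → 𝒜(U)`. -/
def unitMap (U : Opens C) : Fn C U →+* A.Sections U :=
  (A.unit.hom.app (op U)).hom

/-- The sheaf of `𝒪_C`-modules underlying a sheaf of algebras. -/
def toModules : Modules C :=
  letI (U : (Opens C)ᵒᵖ) : Module ((ringSheaf C).obj.obj U)
      ((A.sheaf.obj ⋙ forget₂ RingCat AddCommGrpCat).obj U) :=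
    Module.compHom (A.sheaf.obj.obj U) (A.unit.hom.app U).hom
  ⟨.ofPresheaf (A.sheaf.obj ⋙ forget₂ RingCat AddCommGrpCat) (by
      intro U V f r m
      have h := congrArg (fun g => g.hom r) (A.unit.hom.naturality f)
      refine (map_mul (A.sheaf.obj.map f).hom _ _).trans ?_
      exact congrArg (· * (A.sheaf.obj.map f).hom m) h.symm),
    CategoryTheory.GrothendieckTopology.HasSheafCompose.isSheaf
      (J := Opens.grothendieckTopology C.carrier)
      (F := forget₂ RingCat AddCommGrpCat) A.sheaf.obj A.sheaf.property⟩

/-- A section of the algebra, viewed as a section of the underlying sheaf of modules. -/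
def toSec {U : Opens C} (a : A.Sections U) : Sec A.toModules U := a


/-- `h⁰(𝒜)`: the dimension of the space of global sections over `k`, where `C` is a ringed
space over `k` through `s : k → 𝒪_C(C)`. -/
def h0 {k : Type u} [Field k] (s : k →+* Fn C ⊤) : ℕ :=
  letI : Module k (A.Sections ⊤) := Module.compHom _ ((A.unitMap ⊤).comp s)
  Module.finrank k (A.Sections ⊤)

end AlgebraSheaf

section

variable {C : RingedSpace.{u}}

/-- The finite family `s` of sections over `U` generates the sheaf `M|_U`. -/
def Generates (M : Modules C) {U : Opens C} {n : ℕ} (s : Fin n → Sec M U) : Prop :=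
  ∀ (V : Opens C) (hV : V ≤ U) (x : Sec M V), ∀ y ∈ V, ∃ (W : Opens C) (hW : W ≤ V), y ∈ W ∧
    Sec.res hW x ∈ Submodule.span (Fn C W) (Set.range fun i => Sec.res (hW.trans hV) (s i))

/-- `M` is of finite type. -/
def IsFiniteType (M : Modules C) : Prop :=
  ∀ y : C, ∃ (U : Opens C) (n : ℕ) (s : Fin n → Sec M U), y ∈ U ∧ Generates M s

/-- `r` is a family of relations over `U` between the sections `s i`, and generates the sheaf
of all relations between them, i.e. the kernel of `𝒪_U ^ n → M|_U`. -/
def GeneratesRelations (M : Modules C) {U : Opens C} {n m : ℕ} (s : Fin n → Sec M U)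
    (r : Fin m → Fin n → Fn C U) : Prop :=
  (∀ j, ∑ i, r j i • s i = 0) ∧
  ∀ (V : Opens C) (hV : V ≤ U) (c : Fin n → Fn C V), ∑ i, c i • Sec.res hV (s i) = 0 →
    ∀ y ∈ V, ∃ (W : Opens C) (hW : W ≤ V), y ∈ W ∧
      (fun i => Fn.res hW (c i)) ∈
        Submodule.span (Fn C W) (Set.range fun j i => Fn.res (hW.trans hV) (r j i))

/-- `M` is coherent: it is of finite type, and for every open `U` the kernel of every morphism
`𝒪_U ^ n → M|_U` is of finite type. -/
def IsCoherent (M : Modules C) : Prop :=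
  IsFiniteType M ∧
  ∀ (U : Opens C) (n : ℕ) (s : Fin n → Sec M U), ∀ y ∈ U, ∃ (V : Opens C) (hV : V ≤ U) (m : ℕ)
    (r : Fin m → Fin n → Fn C V), y ∈ V ∧ GeneratesRelations M (fun i => Sec.res hV (s i)) r

/-- `M` is torsion free (for an integral `C`). -/
def IsTorsionFree (M : Modules C) : Prop :=
  ∀ (U : Opens C) (f : Fn C U) (x : Sec M U), f • x = 0 → f = 0 ∨ x = 0

/-- A section over `U` of the sheaf `ℋom(M, N)`, i.e. a morphism `M|_U → N|_U`. -/
structure LocalHom (M N : Modules C) (U : Opens C) where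
  app : ∀ V : Opens C, V ≤ U → (Sec M V →ₗ[Fn C V] Sec N V)
  naturality : ∀ (V W : Opens C) (hV : V ≤ U) (hW : W ≤ V) (x : Sec M V),
    app W (hW.trans hV) (Sec.res hW x) = Sec.res hW (app V hV x)

/-- An order over an integral curve `C`: a torsion free coherent sheaf of `𝒪_C`-algebras whose
stalk at the generic point `η` is a matrix algebra over the field of rational functions
`𝒪_{C,η}`. -/
structure IsOrder (A : AlgebraSheaf C) : Prop where
  coherent : IsCoherent A.toModules
  torsionFree : IsTorsionFree A.toModules
  generic : ∃ η : C, IsGenericPoint η Set.univ ∧ IsField (C.presheaf.stalk η) ∧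
    ∃ (N : ℕ) (e : (TopCat.Presheaf.stalk A.sheaf.obj η : RingCat.{u}) ≃+*
        Matrix (Fin N) (Fin N) (C.presheaf.stalk η)), 0 < N ∧
      ∀ (U : Opens C) (hU : η ∈ U) (f : Fn C U),
        e ((TopCat.Presheaf.germ A.sheaf.obj U η hU).hom (A.unitMap U f)) =
          Matrix.scalar (Fin N) ((C.presheaf.germ U η hU).hom f)

/-- The morphism `ν : 𝒜 → ℋom(𝒜, ω)`, `y ↦ (x ↦ τ(xy))`, is an isomorphism of sheaves. -/
def NuIsIso (A : AlgebraSheaf C) {ω : Modules C} (τ : SheafOfModules.Hom A.toModules ω) : Prop :=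
  ∀ (U : Opens C) (φ : LocalHom A.toModules ω U), ∃! y : A.Sections U,
    ∀ (V : Opens C) (hV : V ≤ U) (x : A.Sections V),
      φ.app V hV (A.toSec x) = Sec.map τ V (A.toSec (x * A.res hV y))

/-- `𝒜` is a symmetric spherical order over the curve `C` over `k` with dualizing sheaf `ω`:
it is an order over `C`, where `H⁰(C, 𝒪_C) = k`; there is a nonzero morphism of `𝒪_C`-modules
`τ : 𝒜 → ω`, unique up to rescaling; the induced morphism `ν` is an isomorphism; and
`τ(xy) = τ(yx)`. -/
structure IsSymmetricSphericalOrder {k : Type u} [Field k] (s : k →+* Fn C ⊤) (ω : Modules C)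
    (A : AlgebraSheaf C) : Prop where
  isOrder : IsOrder A
  constants : Function.Bijective s
  spherical : ∃ τ : SheafOfModules.Hom A.toModules ω,
    (∃ (U : Opens C) (x : Sec A.toModules U), Sec.map τ U x ≠ 0) ∧
    (∀ τ' : SheafOfModules.Hom A.toModules ω, ∃ c : k, ∀ (U : Opens C) (x : Sec A.toModules U),
      Sec.map τ' U x = Fn.res (le_top : U ≤ ⊤) (s c) • Sec.map τ U x) ∧
    NuIsIso A τ ∧
    ∀ (U : Opens C) (x y : A.Sections U),
      Sec.map τ U (A.toSec (x * y)) = Sec.map τ U (A.toSec (y * x))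

/-- The center of `𝒜` is `𝒪_C`: the structure morphism is an isomorphism of `𝒪_C` onto the
subsheaf of those sections which commute with all sections over all smaller open sets. -/
def CenterIsStructureSheaf (A : AlgebraSheaf C) : Prop :=
  ∀ (U : Opens C), Function.Injective (A.unitMap U) ∧ Set.range (A.unitMap U) =
    {z | ∀ (V : Opens C) (hV : V ≤ U) (a : A.Sections V), A.res hV z * a = a * A.res hV z}

end

end SphericalOrder

/-! ### The nodal curve -/

namespace NodalCurve

theorem transcendental_X_inv (k : Type u) [Field k] :
    Function.Injective (Polynomial.aeval (R := k) (RatFunc.X : RatFunc k)⁻¹) := by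
  rw [← transcendental_iff_injective, Transcendental, IsAlgebraic.inv_iff]
  exact RatFunc.transcendental_X

/-- The substitution `t ↦ 1/t` on rational functions `k(t)`. -/
def swap (k : Type u) [Field k] : RatFunc k →ₐ[k] RatFunc k :=
  RatFunc.liftAlgHom (Polynomial.aeval (RatFunc.X : RatFunc k)⁻¹)
    (nonZeroDivisors_le_comap_nonZeroDivisors_of_injective _ (transcendental_X_inv k))

variable {k : Type u} [Field k]

theorem swap_X : swap k RatFunc.X = RatFunc.X⁻¹ := by
  have := RatFunc.liftAlgHom_apply (L := RatFunc k) (S := k)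
    (Polynomial.aeval (RatFunc.X : RatFunc k)⁻¹)
    (nonZeroDivisors_le_comap_nonZeroDivisors_of_injective _ (transcendental_X_inv k)) RatFunc.X
  simpa [swap] using this

/-- The rational function `f` is regular at the point `a` of the affine line. -/
def RegularAt (a : k) (f : RatFunc k) : Prop := f.denom.eval a ≠ 0

/-- The value of `f` at `0` (meaningful if `f` is regular at `0`). -/
def val0 (f : RatFunc k) : k := f.eval (RingHom.id k) 0

theorem RegularAt.add {a : k} {f g : RatFunc k} (hf : RegularAt a f) (hg : RegularAt a g) :
    RegularAt a (f + g) := fun h =>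
  (mul_ne_zero hf hg) (by
    rw [← Polynomial.eval_mul]
    exact Polynomial.eval_eq_zero_of_dvd_of_eval_eq_zero (RatFunc.denom_add_dvd f g) h)

theorem RegularAt.mul {a : k} {f g : RatFunc k} (hf : RegularAt a f) (hg : RegularAt a g) :
    RegularAt a (f * g) := fun h =>
  (mul_ne_zero hf hg) (by
    rw [← Polynomial.eval_mul]
    exact Polynomial.eval_eq_zero_of_dvd_of_eval_eq_zero (RatFunc.denom_mul_dvd f g) h)

theorem RegularAt.C (a c : k) : RegularAt a (RatFunc.C c) := by simp [RegularAt]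

theorem RegularAt.zero (a : k) : RegularAt a 0 := by simp [RegularAt]

theorem RegularAt.one (a : k) : RegularAt a 1 := by simp [RegularAt]

theorem RegularAt.neg {a : k} {f : RatFunc k} (hf : RegularAt a f) : RegularAt a (-f) := by
  have : -f = RatFunc.C (-1) * f := by simp
  rw [this]; exact (RegularAt.C a _).mul hf

theorem RegularAt.sum {ι : Type*} {s : Finset ι} {a : k} {f : ι → RatFunc k}
    (hf : ∀ i ∈ s, RegularAt a (f i)) : RegularAt a (∑ i ∈ s, f i) :=
  Finset.sum_induction _ _ (fun _ _ => RegularAt.add) (RegularAt.zero a) hf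

theorem val0_add {f g : RatFunc k} (hf : RegularAt 0 f) (hg : RegularAt 0 g) :
    val0 (f + g) = val0 f + val0 g := RatFunc.eval_add (RingHom.id k) 0 hf hg

theorem val0_mul {f g : RatFunc k} (hf : RegularAt 0 f) (hg : RegularAt 0 g) :
    val0 (f * g) = val0 f * val0 g := RatFunc.eval_mul (RingHom.id k) 0 hf hg

theorem val0_C (c : k) : val0 (RatFunc.C c) = c := by simp [val0]

theorem val0_zero : val0 (0 : RatFunc k) = 0 := by simp [val0]

theorem val0_one : val0 (1 : RatFunc k) = 1 := by simp [val0]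

theorem val0_neg {f : RatFunc k} (hf : RegularAt 0 f) : val0 (-f) = -val0 f := by
  have : -f = RatFunc.C (-1) * f := by simp
  rw [this, val0_mul (RegularAt.C 0 _) hf, val0_C]; ring

theorem val0_sum {ι : Type*} (s : Finset ι) {f : ι → RatFunc k}
    (hf : ∀ i, RegularAt 0 (f i)) : val0 (∑ i ∈ s, f i) = ∑ i ∈ s, val0 (f i) := by
  classical
  induction s using Finset.induction_on with
  | empty => simp [val0_zero]
  | insert a s ha ih =>
    rw [Finset.sum_insert ha, Finset.sum_insert ha,
      val0_add (hf a) (RegularAt.sum fun i _ => hf i), ih]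

/-- The points of the projective line over an algebraically closed field: the generic point,
the points `t = a` with `a ∈ k`, and `t = ∞`. -/
inductive P1 (k : Type u) : Type u
  | generic : P1 k
  | finite (a : k) : P1 k
  | infty : P1 k

/-- The points of the nodal curve: the generic point, the node, and the smooth points `t = a`
with `a ≠ 0`. -/
inductive Point (k : Type u) [Field k] : Type u
  | generic : Point k
  | node : Point k
  | smooth (a : kˣ) : Point k

open Classical in
/-- The normalization map `π : ℙ¹ → C`, which glues `0` and `∞` to the node. -/
def proj : P1 k → Point k
  | .generic => .generic
  | .finite a => if h : a = 0 then .node else .smooth (Units.mk0 a h)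
  | .infty => .node

/-- The Zariski topology: a nonempty set is open if it contains the generic point and its
complement is finite. -/
instance : TopologicalSpace (Point k) where
  IsOpen U := U.Nonempty → Point.generic ∈ U ∧ Uᶜ.Finite
  isOpen_univ := fun _ => by simp
  isOpen_inter U V hU hV := by
    rintro ⟨x, hxU, hxV⟩
    obtain ⟨h1, h2⟩ := hU ⟨x, hxU⟩
    obtain ⟨h3, h4⟩ := hV ⟨x, hxV⟩
    exact ⟨⟨h1, h3⟩, by rw [Set.compl_inter]; exact h2.union h4⟩
  isOpen_sUnion S hS := by
    rintro ⟨x, U, hU, hx⟩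
    obtain ⟨h1, h2⟩ := hS U hU ⟨x, hx⟩
    exact ⟨⟨U, hU, h1⟩, h2.subset (Set.compl_subset_compl.2 (Set.subset_sUnion_of_mem hU))⟩

/-- Rational sections of `𝒪(d)` on `ℙ¹` are identified with rational functions of
`t = x₁ / x₀` by means of the trivialization `x₀ ^ d` away from `∞`. This is the condition that
the rational section given by `f` is regular at `p`; near `∞` the trivialization is `x₁ ^ d`. -/
def IsSectionAt (d : ℤ) : P1 k → RatFunc k → Prop
  | .generic, _ => True
  | .finite a, f => RegularAt a f
  | .infty, f => RegularAt 0 (swap k (RatFunc.X ^ (-d) * f))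

/-- The value at `∞` of the section of `𝒪(d)` given by `f`, with respect to the trivialization
of `𝒪(d)|_∞` by `x₁ ^ d`. -/
def valInfty (d : ℤ) (f : RatFunc k) : k := val0 (swap k (RatFunc.X ^ (-d) * f))

theorem IsSectionAt.add {d : ℤ} {p : P1 k} {f g : RatFunc k} (hf : IsSectionAt d p f)
    (hg : IsSectionAt d p g) : IsSectionAt d p (f + g) := by
  cases p with
  | generic => trivial
  | finite a => exact RegularAt.add hf hg
  | infty =>
    simp only [IsSectionAt, mul_add, map_add] at *
    exact RegularAt.add hf hg

theorem twist_mul (d e : ℤ) (f g : RatFunc k) : swap k (RatFunc.X ^ (-(d + e)) * (f * g)) =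
    swap k (RatFunc.X ^ (-d) * f) * swap k (RatFunc.X ^ (-e) * g) := by
  rw [← map_mul, neg_add, zpow_add₀ RatFunc.X_ne_zero]
  congr 1; ring

theorem IsSectionAt.mul {d e : ℤ} {p : P1 k} {f g : RatFunc k} (hf : IsSectionAt d p f)
    (hg : IsSectionAt e p g) : IsSectionAt (d + e) p (f * g) := by
  cases p with
  | generic => trivial
  | finite a => exact RegularAt.mul hf hg
  | infty =>
    simp only [IsSectionAt] at *
    rw [twist_mul]
    exact RegularAt.mul hf hg

theorem IsSectionAt.neg {d : ℤ} {p : P1 k} {f : RatFunc k} (hf : IsSectionAt d p f) :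
    IsSectionAt d p (-f) := by
  cases p with
  | generic => trivial
  | finite a => exact RegularAt.neg hf
  | infty =>
    simp only [IsSectionAt, mul_neg, map_neg] at *
    exact RegularAt.neg hf

theorem IsSectionAt.zero (d : ℤ) (p : P1 k) : IsSectionAt d p 0 := by
  cases p <;> simp [IsSectionAt, RegularAt.zero]

theorem IsSectionAt.C (p : P1 k) (c : k) : IsSectionAt 0 p (RatFunc.C c) := by
  cases p with
  | generic => trivial
  | finite a => exact RegularAt.C a c
  | infty =>
    have : swap k (RatFunc.C c) = RatFunc.C c := (swap k).commutes c
    simpa [IsSectionAt, this] using RegularAt.C 0 c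

theorem IsSectionAt.sum {ι : Type*} {s : Finset ι} {d : ℤ} {p : P1 k} {f : ι → RatFunc k}
    (hf : ∀ i ∈ s, IsSectionAt d p (f i)) : IsSectionAt d p (∑ i ∈ s, f i) :=
  Finset.sum_induction _ _ (fun _ _ => IsSectionAt.add) (IsSectionAt.zero d p) hf

theorem valInfty_add {d : ℤ} {f g : RatFunc k} (hf : IsSectionAt d .infty f)
    (hg : IsSectionAt d .infty g) : valInfty d (f + g) = valInfty d f + valInfty d g := by
  simp only [valInfty, mul_add, map_add]
  exact val0_add hf hg

theorem valInfty_mul {d e : ℤ} {f g : RatFunc k} (hf : IsSectionAt d .infty f)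
    (hg : IsSectionAt e .infty g) :
    valInfty (d + e) (f * g) = valInfty d f * valInfty e g := by
  simp only [valInfty]
  rw [twist_mul]
  exact val0_mul hf hg

theorem valInfty_neg {d : ℤ} {f : RatFunc k} (hf : IsSectionAt d .infty f) :
    valInfty d (-f) = -valInfty d f := by
  simp only [valInfty, mul_neg, map_neg]
  exact val0_neg hf

theorem valInfty_zero (d : ℤ) : valInfty d (0 : RatFunc k) = 0 := by
  simp [valInfty, val0_zero]

theorem valInfty_C (c : k) : valInfty 0 (RatFunc.C c) = c := by
  have : swap k (RatFunc.C c) = RatFunc.C c := (swap k).commutes c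
  simp [valInfty, this, val0_C]

theorem valInfty_sum {ι : Type*} (s : Finset ι) {d : ℤ} {f : ι → RatFunc k}
    (hf : ∀ i, IsSectionAt d .infty (f i)) :
    valInfty d (∑ i ∈ s, f i) = ∑ i ∈ s, valInfty d (f i) := by
  simp only [valInfty, Finset.mul_sum, map_sum]
  exact val0_sum s hf

theorem proj_zero : proj (P1.finite (0 : k)) = Point.node := by simp [proj]

/-- The local ring `𝒪_{C,x}`, as a subring of the field of rational functions: the functions
regular at all points of `π⁻¹(x)`, and with equal values at `0` and `∞` if `x` is the node. -/
def localRing (x : Point k) : Subring (RatFunc k) where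
  carrier := {f | (∀ p, proj p = x → IsSectionAt 0 p f) ∧ (x = .node → val0 f = valInfty 0 f)}
  zero_mem' := ⟨fun p _ => .zero 0 p, fun _ => by rw [val0_zero, valInfty_zero]⟩
  one_mem' := by
    rw [← map_one RatFunc.C]
    exact ⟨fun p _ => .C p 1, fun _ => by rw [val0_C, valInfty_C]⟩
  add_mem' := by
    rintro f g ⟨hf, hf'⟩ ⟨hg, hg'⟩
    refine ⟨fun p hp => (hf p hp).add (hg p hp), fun hx => ?_⟩
    subst hx
    rw [val0_add (hf _ proj_zero) (hg _ proj_zero), valInfty_add (hf _ rfl) (hg _ rfl),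
      hf' rfl, hg' rfl]
  mul_mem' := by
    rintro f g ⟨hf, hf'⟩ ⟨hg, hg'⟩
    refine ⟨fun p hp => (hf p hp).mul (hg p hp), fun hx => ?_⟩
    subst hx
    have := valInfty_mul (hf _ rfl) (hg _ rfl)
    rw [add_zero] at this
    rw [val0_mul (hf _ proj_zero) (hg _ proj_zero), this, hf' rfl, hg' rfl]
  neg_mem' := by
    rintro f ⟨hf, hf'⟩
    refine ⟨fun p hp => (hf p hp).neg, fun hx => ?_⟩
    subst hx
    rw [val0_neg (hf _ proj_zero), valInfty_neg (hf _ rfl), hf' rfl]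

end NodalCurve

/-! ### Subsheaves of constant sheaves -/

namespace StalkwiseSheaf

variable {X : TopCat.{u}}

/-- Given a subset `S x` of `R` for each point `x`, the condition on a function on an open set to
be a section of the constant sheaf `R` (i.e. to be locally constant) with germ at `x` in `S x`. -/
def pred {R : Type u} (S : X → Set R) : TopCat.LocalPredicate (fun _ : X => R) where
  pred {U} f := IsLocallyConstant f ∧ ∀ x : U, f x ∈ S x.1
  res {_ _} i _ h := ⟨h.1.comp_continuous (Opens.isOpenEmbedding_of_le i.le).continuous,
    fun x => h.2 (i x)⟩
  locality {U} f w := by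
    refine ⟨?_, fun x => ?_⟩
    · rw [IsLocallyConstant.iff_exists_open]
      intro x
      obtain ⟨V, hx, i, h, -⟩ := w x
      obtain ⟨W, hW, hxW, hc⟩ := h.exists_open ⟨x.1, hx⟩
      refine ⟨Set.inclusion (leOfHom i) '' W,
        (Opens.isOpenEmbedding_of_le (leOfHom i)).isOpenMap W hW, ⟨⟨x.1, hx⟩, hxW, rfl⟩, ?_⟩
      rintro _ ⟨y, hy, rfl⟩
      exact hc y hy
    · obtain ⟨V, hx, i, -, h⟩ := w x
      exact h ⟨x.1, hx⟩

/-- The sections over `U` with germs in the additive subgroups `S x`. -/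
def addSections {M : Type u} [AddCommGroup M] (S : X → AddSubgroup M) (U : Opens X) :
    AddSubgroup (U → M) where
  carrier := {f | (pred fun x => (S x : Set M)).pred f}
  zero_mem' := ⟨IsLocallyConstant.const 0, fun x => (S x).zero_mem⟩
  add_mem' hf hg := ⟨hf.1.add hg.1, fun x => (S x).add_mem (hf.2 x) (hg.2 x)⟩
  neg_mem' hf := ⟨hf.1.neg, fun x => (S x).neg_mem (hf.2 x)⟩

/-- The sections over `U` with germs in the subrings `S x`. -/
def ringSections {R : Type u} [Ring R] (S : X → Subring R) (U : Opens X) : Subring (U → R) where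
  carrier := {f | (pred fun x => (S x : Set R)).pred f}
  zero_mem' := ⟨IsLocallyConstant.const 0, fun x => (S x).zero_mem⟩
  one_mem' := ⟨IsLocallyConstant.const 1, fun x => (S x).one_mem⟩
  add_mem' hf hg := ⟨hf.1.add hg.1, fun x => (S x).add_mem (hf.2 x) (hg.2 x)⟩
  mul_mem' hf hg := ⟨hf.1.mul hg.1, fun x => (S x).mul_mem (hf.2 x) (hg.2 x)⟩
  neg_mem' hf := ⟨hf.1.neg, fun x => (S x).neg_mem (hf.2 x)⟩

/-- Restriction of sections. -/
def ringRes {R : Type u} [Ring R] (S : X → Subring R) {U V : Opens X} (i : V ⟶ U) :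
    ringSections S U →+* ringSections S V where
  toFun f := ⟨fun x => f.1 (i x), (pred fun x => (S x : Set R)).res i f.1 f.2⟩
  map_zero' := rfl
  map_one' := rfl
  map_add' _ _ := rfl
  map_mul' _ _ := rfl

/-- Restriction of sections. -/
def addRes {M : Type u} [AddCommGroup M] (S : X → AddSubgroup M) {U V : Opens X} (i : V ⟶ U) :
    addSections S U →+ addSections S V where
  toFun f := ⟨fun x => f.1 (i x), (pred fun x => (S x : Set M)).res i f.1 f.2⟩
  map_zero' := rfl
  map_add' _ _ := rfl

/-- The subsheaf of the constant sheaf `R` with stalks `S x`, for a commutative ring `R`. -/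
def commRingPresheaf {R : Type u} [CommRing R] (S : X → Subring R) :
    TopCat.Presheaf CommRingCat.{u} X where
  obj U := CommRingCat.of (ringSections S U.unop)
  map i := CommRingCat.ofHom (ringRes S i.unop)

/-- The subsheaf of the constant sheaf `R` with stalks `S x`, for a ring `R`. -/
def ringPresheaf {R : Type u} [Ring R] (S : X → Subring R) :
    TopCat.Presheaf RingCat.{u} X where
  obj U := RingCat.of (ringSections S U.unop)
  map i := RingCat.ofHom (ringRes S i.unop)

/-- The subsheaf of the constant sheaf `M` with stalks `S x`, for an abelian group `M`. -/
def addPresheaf {M : Type u} [AddCommGroup M] (S : X → AddSubgroup M) :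
    TopCat.Presheaf AddCommGrpCat.{u} X where
  obj U := AddCommGrpCat.of (addSections S U.unop)
  map i := AddCommGrpCat.ofHom (addRes S i.unop)

theorem commRingPresheaf_isSheaf {R : Type u} [CommRing R] (S : X → Subring R) :
    (commRingPresheaf S).IsSheaf :=
  (TopCat.Presheaf.isSheaf_iff_isSheaf_comp (forget CommRingCat) _).2
    (TopCat.Presheaf.isSheaf_of_iso
      (NatIso.ofComponents (fun _ => Iso.refl _) : _ ≅ commRingPresheaf S ⋙ forget CommRingCat)
      (TopCat.subsheafToTypes (pred fun x => (S x : Set R))).property)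

theorem ringPresheaf_isSheaf {R : Type u} [Ring R] (S : X → Subring R) :
    (ringPresheaf S).IsSheaf :=
  (TopCat.Presheaf.isSheaf_iff_isSheaf_comp (forget RingCat) _).2
    (TopCat.Presheaf.isSheaf_of_iso
      (NatIso.ofComponents (fun _ => Iso.refl _) : _ ≅ ringPresheaf S ⋙ forget RingCat)
      (TopCat.subsheafToTypes (pred fun x => (S x : Set R))).property)

theorem addPresheaf_isSheaf {M : Type u} [AddCommGroup M] (S : X → AddSubgroup M) :
    (addPresheaf S).IsSheaf :=
  (TopCat.Presheaf.isSheaf_iff_isSheaf_comp (forget AddCommGrpCat) _).2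
    (TopCat.Presheaf.isSheaf_of_iso
      (NatIso.ofComponents (fun _ => Iso.refl _) : _ ≅ addPresheaf S ⋙ forget AddCommGrpCat)
      (TopCat.subsheafToTypes (pred fun x => (S x : Set M))).property)

end StalkwiseSheaf

namespace NodalCurve

open SphericalOrder StalkwiseSheaf

/-- The irreducible nodal curve `C` of arithmetic genus `1` over an algebraically closed field
`k`, as a ringed space: `ℙ¹` with the points `0` and `∞` glued to a node. A section of `𝒪_C` over a
nonempty open `U` is a rational function in `𝒪_{C,x}` for all `x ∈ U` (since `C` is irreducible,
a locally constant function on `U` is constant). -/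
def nodalCurve (k : Type u) [Field k] : RingedSpace.{u} where
  carrier := TopCat.of (Point k)
  presheaf := commRingPresheaf (X := TopCat.of (Point k)) localRing
  IsSheaf := commRingPresheaf_isSheaf (X := TopCat.of (Point k)) localRing

variable {k : Type u} [Field k]

theorem C_mem_localRing (c : k) (x : Point k) : RatFunc.C c ∈ localRing x :=
  ⟨fun p _ => .C p c, fun _ => by rw [val0_C, valInfty_C]⟩

/-- The structure of a `k`-space: scalars are constant functions. -/
def scalars (k : Type u) [Field k] : k →+* Fn (nodalCurve k) ⊤ :=
  RingHom.codRestrict ((Pi.constRingHom _ (RatFunc k)).comp RatFunc.C)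
    (ringSections (X := TopCat.of (Point k)) localRing ⊤)
    (fun c => ⟨IsLocallyConstant.const _, fun x => C_mem_localRing c x.1⟩)

/-- The coefficient with respect to `ds`, `s = 1/t`, of the differential `f dt`. -/
def coeffInfty (f : RatFunc k) : RatFunc k := -(swap k f * RatFunc.X ^ (-2 : ℤ))

/-- The stalk of the dualizing sheaf `ω_C`; the rational differential `f dt` is represented by `f`.
At a smooth point `f dt` has to be regular. At the node it has to have at most simple poles at the
two preimages `0` and `∞`, and opposite residues at them. -/
def IsDualizingAt : Point k → RatFunc k → Prop
  | .generic, _ => True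
  | .smooth a, f => RegularAt (a : k) f
  | .node, f => RegularAt 0 (RatFunc.X * f) ∧ RegularAt 0 (RatFunc.X * coeffInfty f) ∧
      val0 (RatFunc.X * f) + val0 (RatFunc.X * coeffInfty f) = 0

theorem IsDualizingAt.add {x : Point k} {f g : RatFunc k} (hf : IsDualizingAt x f)
    (hg : IsDualizingAt x g) : IsDualizingAt x (f + g) := by
  cases x with
  | generic => trivial
  | smooth a => exact RegularAt.add hf hg
  | node =>
    obtain ⟨h1, h2, h3⟩ := hf
    obtain ⟨h1', h2', h3'⟩ := hg
    have e : coeffInfty (f + g) = coeffInfty f + coeffInfty g := by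
      simp only [coeffInfty, map_add]; ring
    refine ⟨?_, ?_, ?_⟩
    · rw [mul_add]; exact h1.add h1'
    · rw [e, mul_add]; exact h2.add h2'
    · rw [e, mul_add, mul_add, val0_add h1 h1', val0_add h2 h2']
      linear_combination h3 + h3'

theorem IsDualizingAt.smul {x : Point k} {f g : RatFunc k} (hf : f ∈ localRing x)
    (hg : IsDualizingAt x g) : IsDualizingAt x (f * g) := by
  cases x with
  | generic => trivial
  | smooth a =>
    refine RegularAt.mul ?_ hg
    exact hf.1 (.finite a) (by simp [proj])
  | node =>
    obtain ⟨h1, h2, h3⟩ := hg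
    have h0 : RegularAt 0 f := hf.1 (.finite 0) proj_zero
    have hi : RegularAt 0 (swap k f) := by
      have := hf.1 .infty rfl
      simpa [IsSectionAt] using this
    have hv : val0 f = val0 (swap k f) := by
      have := hf.2 rfl
      simpa [valInfty] using this
    have e1 : RatFunc.X * (f * g) = f * (RatFunc.X * g) := by ring
    have e2 : RatFunc.X * coeffInfty (f * g) = swap k f * (RatFunc.X * coeffInfty g) := by
      simp only [coeffInfty, map_mul]; ring
    refine ⟨?_, ?_, ?_⟩
    · rw [e1]; exact h0.mul h1
    · rw [e2]; exact hi.mul h2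
    · rw [e1, e2, val0_mul h0 h1, val0_mul hi h2, hv, ← mul_add, h3, mul_zero]

/-- The stalk of the dualizing sheaf as a subgroup of the space of rational differentials. -/
def dualizingStalk (x : Point k) : AddSubgroup (RatFunc k) where
  carrier := {f | IsDualizingAt x f}
  zero_mem' := by
    cases x <;> simp [IsDualizingAt, RegularAt.zero, coeffInfty, val0_zero]
  add_mem' := IsDualizingAt.add
  neg_mem' {f} hf := by
    have : -f = RatFunc.C (-1) * f := by simp
    change IsDualizingAt x (-f)
    rw [this]
    exact .smul (C_mem_localRing _ x) hf

/-- `ω_C(U)` is an `𝒪_C(U)`-module. -/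
instance dualizingModule (U : Opens (TopCat.of (Point k))) :
    Module (ringSections (X := TopCat.of (Point k)) localRing U)
      (addSections (X := TopCat.of (Point k)) dualizingStalk U) where
  smul f g := ⟨f.1 * g.1, f.2.1.mul g.2.1, fun x => .smul (f.2.2 x) (g.2.2 x)⟩
  one_smul g := Subtype.ext (one_mul g.1)
  mul_smul f f' g := Subtype.ext (mul_assoc f.1 f'.1 g.1)
  smul_zero f := Subtype.ext (mul_zero f.1)
  smul_add f g g' := Subtype.ext (mul_add f.1 g.1 g'.1)
  add_smul f f' g := Subtype.ext (add_mul f.1 f'.1 g.1)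
  zero_smul g := Subtype.ext (zero_mul g.1)

/-- The dualizing sheaf `ω_C` of the nodal curve: rational differentials on `ℙ¹`, regular away
from the node, with at most simple poles and opposite residues at the preimages of the node. -/
def dualizingSheaf (k : Type u) [Field k] : Modules (nodalCurve k) :=
  letI (U : (Opens (nodalCurve k))ᵒᵖ) : Module ((ringSheaf (nodalCurve k)).obj.obj U)
      ((addPresheaf (X := TopCat.of (Point k)) dualizingStalk).obj U) :=
    dualizingModule (k := k) U.unop
  ⟨.ofPresheaf (addPresheaf (X := TopCat.of (Point k)) dualizingStalk) (fun _ _ _ _ _ => rfl),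
    addPresheaf_isSheaf (X := TopCat.of (Point k)) dualizingStalk⟩

/-! ### The sheaf of algebras attached to a bundle and a subalgebra of its fibers -/

variable {n : ℕ}

/-- The value at `0` of a matrix of rational functions. -/
def matVal0 (M : Matrix (Fin n) (Fin n) (RatFunc k)) : Matrix (Fin n) (Fin n) k :=
  .of fun i j => val0 (M i j)

/-- The value at `∞` of a section of `ℰnd(𝒱)`, where `𝒱 = ⨁ 𝒪(d i)`. -/
def matValInfty (d : Fin n → ℤ) (M : Matrix (Fin n) (Fin n) (RatFunc k)) :
    Matrix (Fin n) (Fin n) k :=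
  .of fun i j => valInfty (d i - d j) (M i j)

/-- The matrix `M` of rational functions is a section at `p` of `ℰnd(𝒱)`, `𝒱 = ⨁ 𝒪(d i)`: its
entry at `(i, j)` is a section of `ℋom(𝒪(d j), 𝒪(d i)) = 𝒪(d i - d j)`. -/
def IsEndSectionAt (d : Fin n → ℤ) (p : P1 k) (M : Matrix (Fin n) (Fin n) (RatFunc k)) : Prop :=
  ∀ i j, IsSectionAt (d i - d j) p (M i j)

/-- The stalk at `x` of the sheaf `𝒜(𝒱, I)`, where `𝒱 = ⨁ 𝒪(d i)` and `I` is a subalgebra of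
`End(𝒱|_0) ⊕ End(𝒱|_∞)`: sections of `ℰnd(𝒱)` near `π⁻¹(x)`, whose pair of values at `0` and `∞`
lies in `I` if `x` is the node. -/
def orderStalk (d : Fin n → ℤ)
    (I : Subalgebra k (Matrix (Fin n) (Fin n) k × Matrix (Fin n) (Fin n) k)) (x : Point k) :
    Subring (Matrix (Fin n) (Fin n) (RatFunc k)) where
  carrier := {M | (∀ p, proj p = x → IsEndSectionAt d p M) ∧
    (x = .node → (matVal0 M, matValInfty d M) ∈ I)}
  zero_mem' := by
    refine ⟨fun p _ i j => .zero _ p, fun _ => ?_⟩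
    have e1 : matVal0 (0 : Matrix (Fin n) (Fin n) (RatFunc k)) = 0 := by
      ext i j; simp [matVal0, val0_zero]
    have e2 : matValInfty d (0 : Matrix (Fin n) (Fin n) (RatFunc k)) = 0 := by
      ext i j; simp [matValInfty, valInfty_zero]
    rw [e1, e2]; exact I.zero_mem
  one_mem' := by
    refine ⟨fun p _ i j => ?_, fun _ => ?_⟩
    · by_cases h : i = j
      · subst h; simpa using IsSectionAt.C p 1
      · simpa [h] using IsSectionAt.zero _ p
    · have e1 : matVal0 (1 : Matrix (Fin n) (Fin n) (RatFunc k)) = 1 := by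
        ext i j
        by_cases h : i = j
        · subst h; simp [matVal0, val0_one]
        · simp [matVal0, h, val0_zero]
      have e2 : matValInfty d (1 : Matrix (Fin n) (Fin n) (RatFunc k)) = 1 := by
        ext i j
        by_cases h : i = j
        · subst h; simpa [matValInfty] using valInfty_C (1 : k)
        · simp [matValInfty, h, valInfty_zero]
      rw [e1, e2]; exact I.one_mem
  add_mem' := by
    rintro M N ⟨hM, hM'⟩ ⟨hN, hN'⟩
    refine ⟨fun p hp i j => (hM p hp i j).add (hN p hp i j), fun hx => ?_⟩
    subst hx
    have e1 : matVal0 (M + N) = matVal0 M + matVal0 N := by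
      ext i j
      exact val0_add (hM _ proj_zero i j) (hN _ proj_zero i j)
    have e2 : matValInfty d (M + N) = matValInfty d M + matValInfty d N := by
      ext i j
      exact valInfty_add (hM _ rfl i j) (hN _ rfl i j)
    rw [e1, e2]; exact I.add_mem (hM' rfl) (hN' rfl)
  mul_mem' := by
    rintro M N ⟨hM, hM'⟩ ⟨hN, hN'⟩
    have key : ∀ p, IsEndSectionAt d p M → IsEndSectionAt d p N → ∀ i j l,
        IsSectionAt (d i - d j) p (M i l * N l j) := by
      intro p h h' i j l
      have := (h i l).mul (h' l j)
      rwa [sub_add_sub_cancel] at this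
    refine ⟨fun p hp i j => ?_, fun hx => ?_⟩
    · rw [Matrix.mul_apply]
      exact .sum fun l _ => key p (hM p hp) (hN p hp) i j l
    · subst hx
      have e1 : matVal0 (M * N) = matVal0 M * matVal0 N := by
        ext i j
        have h0 := proj_zero (k := k)
        simp only [matVal0, Matrix.mul_apply, Matrix.of_apply]
        rw [val0_sum _ fun l => key _ (hM _ h0) (hN _ h0) i j l]
        exact Finset.sum_congr rfl fun l _ => val0_mul (hM _ h0 i l) (hN _ h0 l j)
      have e2 : matValInfty d (M * N) = matValInfty d M * matValInfty d N := by
        ext i j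
        simp only [matValInfty, Matrix.mul_apply, Matrix.of_apply]
        rw [valInfty_sum _ fun l => key _ (hM _ rfl) (hN _ rfl) i j l]
        refine Finset.sum_congr rfl fun l _ => ?_
        rw [← valInfty_mul (hM _ rfl i l) (hN _ rfl l j), sub_add_sub_cancel]
      rw [e1, e2]; exact I.mul_mem (hM' rfl) (hN' rfl)
  neg_mem' := by
    rintro M ⟨hM, hM'⟩
    refine ⟨fun p hp i j => (hM p hp i j).neg, fun hx => ?_⟩
    subst hx
    have e1 : matVal0 (-M) = -matVal0 M := by
      ext i j
      exact val0_neg (hM _ proj_zero i j)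
    have e2 : matValInfty d (-M) = -matValInfty d M := by
      ext i j
      exact valInfty_neg (hM _ rfl i j)
    rw [e1, e2]; exact I.neg_mem (hM' rfl)

theorem scalar_mem_orderStalk (d : Fin n → ℤ)
    (I : Subalgebra k (Matrix (Fin n) (Fin n) k × Matrix (Fin n) (Fin n) k)) (x : Point k)
    {f : RatFunc k} (hf : f ∈ localRing x) : Matrix.scalar (Fin n) f ∈ orderStalk d I x := by
  refine ⟨fun p hp i j => ?_, fun hx => ?_⟩
  · by_cases h : i = j
    · subst h; simpa using hf.1 p hp
    · simpa [h] using IsSectionAt.zero _ p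
  · have e1 : matVal0 (Matrix.scalar (Fin n) f) = algebraMap k _ (val0 f) := by
      ext i j
      by_cases h : i = j
      · subst h; simp [matVal0, Matrix.algebraMap_matrix_apply]
      · simp [matVal0, h, val0_zero, Matrix.algebraMap_matrix_apply]
    have e2 : matValInfty d (Matrix.scalar (Fin n) f) = algebraMap k _ (val0 f) := by
      ext i j
      by_cases h : i = j
      · subst h; simp [matValInfty, hf.2 hx, Matrix.algebraMap_matrix_apply]
      · simp [matValInfty, h, valInfty_zero, Matrix.algebraMap_matrix_apply]
    rw [e1, e2]
    exact I.algebraMap_mem (val0 f)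

/-- The structure morphism of `𝒜(𝒱, I)`: functions are scalar matrices. -/
def orderUnit (d : Fin n → ℤ)
    (I : Subalgebra k (Matrix (Fin n) (Fin n) k × Matrix (Fin n) (Fin n) k))
    (U : Opens (TopCat.of (Point k))) :
    ringSections (X := TopCat.of (Point k)) localRing U →+*
      ringSections (X := TopCat.of (Point k)) (orderStalk d I) U where
  toFun f := ⟨fun x => Matrix.scalar (Fin n) (f.1 x), f.2.1.comp (Matrix.scalar (Fin n)),
    fun x => scalar_mem_orderStalk d I x.1 (f.2.2 x)⟩
  map_zero' := Subtype.ext (funext fun _ => map_zero (Matrix.scalar (Fin n)))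
  map_one' := Subtype.ext (funext fun _ => map_one (Matrix.scalar (Fin n)))
  map_add' _ _ := Subtype.ext (funext fun _ => map_add (Matrix.scalar (Fin n)) _ _)
  map_mul' _ _ := Subtype.ext (funext fun _ => map_mul (Matrix.scalar (Fin n)) _ _)

/-- The sheaf of `𝒪_C`-algebras `𝒜(𝒱, I) ⊂ π_* ℰnd(𝒱)`, where `𝒱 = ⨁ 𝒪(d i)`, consisting of the
sections `a` with `(a(0), a(∞)) ∈ I`. -/
def orderSheaf (d : Fin n → ℤ)
    (I : Subalgebra k (Matrix (Fin n) (Fin n) k × Matrix (Fin n) (Fin n) k)) :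
    AlgebraSheaf (nodalCurve k) where
  sheaf := ⟨ringPresheaf (X := TopCat.of (Point k)) (orderStalk d I),
    ringPresheaf_isSheaf (X := TopCat.of (Point k)) (orderStalk d I)⟩
  unit := ⟨{ app := fun U => RingCat.ofHom (orderUnit d I U.unop)
             naturality := fun _ _ _ => rfl }⟩
  central _ f a := Subtype.ext (funext fun x =>
    (Matrix.scalar_commute (f.1 x) (fun _ => Commute.all _ _) (a.1 x)).eq)

end NodalCurve

/-! ### Associative Belavin-Drinfeld data -/

/-- Associative Belavin-Drinfeld data `(σ, Γ₁, Γ₂)` of size `n`, with the standard cyclic permutation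
`σ₀ : i ↦ i + 1` of the index set `Fin n = {0, …, n - 1}` (`finRotate n`): a cyclic permutation `σ`
of the whole index set, and proper subsets `Γ₁`, `Γ₂` of the graph of `σ₀` with `σ(Γ₁) = Γ₂`. -/
structure AssociativeBDData (n : ℕ) where
  σ : Equiv.Perm (Fin n)
  Γ₁ : Set (Fin n × Fin n)
  Γ₂ : Set (Fin n × Fin n)
  cyclic : σ.IsCycleOn Set.univ
  proper₁ : Γ₁ ⊂ {p | p.2 = finRotate n p.1}
  proper₂ : Γ₂ ⊂ {p | p.2 = finRotate n p.1}
  image_eq : Prod.map σ σ '' Γ₁ = Γ₂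

namespace AssociativeBDData

variable {n : ℕ}

/-- The extension `Π` of `Γ`: the pairs `(i, σ₀^r(i))`, `r ≥ 1`, such that
`(i, σ₀(i)), (σ₀(i), σ₀²(i)), …, (σ₀^{r-1}(i), σ₀^r(i))` are all in `Γ`. -/
def extend (Γ : Set (Fin n × Fin n)) : Set (Fin n × Fin n) :=
  {p | ∃ r : ℕ, 1 ≤ r ∧ p.2 = (finRotate n ^ r) p.1 ∧
    ∀ s < r, ((finRotate n ^ s) p.1, (finRotate n ^ (s + 1)) p.1) ∈ Γ}

/-- The set `S_m` of pairs `(i, j)` with `i < j < m` or `m ≤ i < j` or `i ≥ m > j`. -/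
def cyclicOrder (m : Fin n) : Set (Fin n × Fin n) :=
  {p | (p.1 < p.2 ∧ p.2 < m) ∨ (m ≤ p.1 ∧ p.1 < p.2) ∨ (m ≤ p.1 ∧ p.2 < m)}

/-- The degrees `ε_i`: `0` for `i < m` and `1` for `i ≥ m`. -/
def degrees (m : Fin n) (i : Fin n) : ℤ := if i < m then 0 else 1

/-- A rank function for the order `S_m`. -/
def rank (m i : Fin n) : ℕ := if i < m then i + n else i

theorem rank_injective (m : Fin n) : Function.Injective (rank m) := by
  intro i j h
  simp only [rank, Fin.lt_def] at h
  ext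
  split_ifs at h <;> omega

theorem mem_cyclicOrder_iff (m i j : Fin n) : (i, j) ∈ cyclicOrder m ↔ rank m i < rank m j := by
  simp only [cyclicOrder, rank, Set.mem_ofPred_eq, Fin.lt_def, Fin.le_def]
  split_ifs <;> omega

theorem rank_zero_lt [NeZero n] (i j : Fin n) : rank 0 i < rank 0 j ↔ i < j := by
  have h (l : Fin n) : ¬ l < 0 := not_lt.2 (Fin.zero_le l)
  rw [rank, rank, if_neg (h i), if_neg (h j), Fin.lt_def]

theorem extend_iff {Γ : Set (Fin n × Fin n)} (hΓ : Γ ⊆ {p | p.2 = finRotate n p.1})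
    (i j : Fin n) : (i, j) ∈ extend Γ ↔ Relation.TransGen (fun i j => (i, j) ∈ Γ) i j := by
  constructor
  · rintro ⟨r, hr, hj, h⟩
    dsimp only at hj h
    subst hj
    induction r, hr using Nat.le_induction with
    | base => exact .single (by simpa using h 0 one_pos)
    | succ r hr ih =>
      exact (ih fun s hs => h s (hs.trans r.lt_succ_self)).tail (h r r.lt_succ_self)
  · intro h
    induction h with
    | single h => exact ⟨1, le_rfl, by simpa using hΓ h, fun s hs => by
        obtain rfl : s = 0 := by omega
        simpa [← show _ = finRotate n i from hΓ h] using h⟩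
    | tail _ h ih =>
      obtain ⟨r, hr, hj, hs⟩ := ih
      dsimp only at hj hs
      have h' : _ = finRotate n _ := hΓ h
      dsimp only at h'
      have e : (finRotate n ^ (r + 1)) i = finRotate n ((finRotate n ^ r) i) := by
        rw [pow_succ', Equiv.Perm.mul_apply]
      refine ⟨r + 1, by omega, by rw [h', hj, e], fun s hsr => ?_⟩
      rcases Nat.lt_succ_iff_lt_or_eq.1 hsr with hlt | rfl
      · exact hs s hlt
      · dsimp only
        rw [e, ← hj, ← h']; exact h

section Order

variable {Γ : Set (Fin n × Fin n)} {m : Fin n}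

theorem rank_step (hΓ : Γ ⊆ {p | p.2 = finRotate n p.1})
    (hm : ((finRotate n).symm m, m) ∉ Γ) {i j : Fin n} (h : (i, j) ∈ Γ) :
    rank m j = rank m i + 1 := by
  have hj : j = finRotate n i := hΓ h
  have hjm : j ≠ m := by
    rintro rfl
    apply hm
    rwa [hj, Equiv.symm_apply_apply, ← hj]
  obtain _ | n := n
  · exact i.elim0
  have hv : j.val ≠ m.val := fun h => hjm (Fin.ext h)
  rw [finRotate_apply] at hj
  have hval : j.val = if i.val = n then 0 else i.val + 1 := by
    rw [hj, Fin.val_add_one]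
    simp [Fin.ext_iff]
  simp only [rank, Fin.lt_def]
  have := m.2
  have := i.2
  split_ifs at * <;> omega

theorem rank_lt {i j : Fin n} (hΓ : Γ ⊆ {p | p.2 = finRotate n p.1})
    (hm : ((finRotate n).symm m, m) ∉ Γ) (h : (i, j) ∈ extend Γ) : rank m i < rank m j := by
  rw [extend_iff hΓ] at h
  induction h with
  | single h => have := rank_step hΓ hm h; omega
  | tail _ h ih => have := rank_step hΓ hm h; omega

theorem extend_trans (hΓ : Γ ⊆ {p | p.2 = finRotate n p.1}) {i j l : Fin n}
    (h : (i, j) ∈ extend Γ) (h' : (j, l) ∈ extend Γ) : (i, l) ∈ extend Γ := by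
  rw [extend_iff hΓ] at *
  exact h.trans h'

theorem extend_convex {i j l : Fin n} (hΓ : Γ ⊆ {p | p.2 = finRotate n p.1})
    (hm : ((finRotate n).symm m, m) ∉ Γ) (h : (i, j) ∈ extend Γ) (h1 : rank m i < rank m l)
    (h2 : rank m l < rank m j) : (i, l) ∈ extend Γ ∧ (l, j) ∈ extend Γ := by
  rw [extend_iff hΓ] at *
  rw [extend_iff hΓ]
  induction h using Relation.TransGen.head_induction_on with
  | single h => have := rank_step hΓ hm h; omega
  | head h hc ih =>
    rename_i a c
    have hs := rank_step hΓ hm h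
    by_cases e : c = l
    · subst e; exact ⟨.single h, hc⟩
    · have : rank m c ≠ rank m l := fun h => e (rank_injective m h)
      obtain ⟨h3, h4⟩ := ih (by omega)
      exact ⟨.head h h3, h4⟩

/-- The pairs `(i, j)` with `i = j` or `(i, j) ∈ Π` or `(j, i) ∈ Π`, i.e. the positions of the
nonzero entries of the Levi component. -/
def Block (Γ : Set (Fin n × Fin n)) (i j : Fin n) : Prop :=
  i = j ∨ (i, j) ∈ extend Γ ∨ (j, i) ∈ extend Γ

theorem zero_of_zero (hΓ : Γ ⊆ {p | p.2 = finRotate n p.1})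
    (hm : ((finRotate n).symm m, m) ∉ Γ) {i j : Fin n} (h : rank m i < rank m j)
    (h' : (i, j) ∉ extend Γ) (l : Fin n) :
    (rank m i < rank m l ∧ (i, l) ∉ extend Γ) ∨ (rank m l < rank m j ∧ (l, j) ∉ extend Γ) := by
  by_contra! hc
  obtain ⟨h1, h2⟩ := hc
  rcases lt_trichotomy (rank m l) (rank m i) with hl | hl | hl
  · exact h' (extend_convex hΓ hm (h2 (hl.trans h)) hl h).2
  · rw [rank_injective m hl] at h2; exact h' (h2 h)
  · rcases lt_trichotomy (rank m l) (rank m j) with hj | hj | hj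
    · exact h' (extend_trans hΓ (h1 hl) (h2 hj))
    · rw [rank_injective m hj] at h1; exact h' (h1 h)
    · exact h' (extend_convex hΓ hm (h1 hl) h hj).1

theorem Block.symm {i j : Fin n} (h : Block Γ i j) : Block Γ j i := by
  rcases h with h | h | h
  exacts [.inl h.symm, .inr (.inr h), .inr (.inl h)]

theorem Block.trans (hΓ : Γ ⊆ {p | p.2 = finRotate n p.1})
    (hm : ((finRotate n).symm m, m) ∉ Γ) {i j l : Fin n} (h : Block Γ i j) (h' : Block Γ j l) :
    Block Γ i l := by
  rcases h with rfl | h | h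
  · exact h'
  · rcases h' with rfl | h' | h'
    · exact .inr (.inl h)
    · exact .inr (.inl (extend_trans hΓ h h'))
    · have h1 := rank_lt hΓ hm h
      have h2 := rank_lt hΓ hm h'
      rcases lt_trichotomy (rank m i) (rank m l) with hl | hl | hl
      · exact .inr (.inl (extend_convex hΓ hm h hl h2).1)
      · exact .inl (rank_injective m hl)
      · exact .inr (.inr (extend_convex hΓ hm h' hl h1).1)
  · rcases h' with rfl | h' | h'
    · exact .inr (.inr h)
    · have h1 := rank_lt hΓ hm h
      have h2 := rank_lt hΓ hm h'
      rcases lt_trichotomy (rank m i) (rank m l) with hl | hl | hl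
      · exact .inr (.inl (extend_convex hΓ hm h' h1 hl).2)
      · exact .inl (rank_injective m hl)
      · exact .inr (.inr (extend_convex hΓ hm h h2 hl).2)
    · exact .inr (.inr (extend_trans hΓ h' h))

theorem zero_of_block (hΓ : Γ ⊆ {p | p.2 = finRotate n p.1})
    (hm : ((finRotate n).symm m, m) ∉ Γ) {i j l : Fin n} (h : Block Γ i j) (hl : ¬ Block Γ i l) :
    (rank m i < rank m l ∧ (i, l) ∉ extend Γ) ∨ (rank m l < rank m j ∧ (l, j) ∉ extend Γ) := by
  have hl' : ¬ Block Γ l j := fun h' => hl (h.trans hΓ hm h'.symm)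
  rcases lt_trichotomy (rank m l) (rank m i) with h1 | h1 | h1
  · right
    refine ⟨?_, fun h' => hl' (.inr (.inl h'))⟩
    by_contra hc
    rcases h with rfl | h | h
    · exact hc h1
    · have := rank_lt hΓ hm h; omega
    · rcases (not_lt.1 hc).eq_or_lt with e | e
      · exact hl' (.inl (rank_injective m e.symm))
      · exact hl (.inr (.inr (extend_convex hΓ hm h e h1).2))
  · exact absurd (.inl (rank_injective m h1.symm)) hl
  · exact .inl ⟨h1, fun h' => hl (.inr (.inl h'))⟩

end Order

variable (D : AssociativeBDData n)

/-- The set `Π₁`. -/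
def Pi₁ : Set (Fin n × Fin n) := extend D.Γ₁

/-- The set `Π₂`. -/
def Pi₂ : Set (Fin n × Fin n) := extend D.Γ₂

theorem mem_Pi_iff (i j : Fin n) : (D.σ i, D.σ j) ∈ D.Pi₂ ↔ (i, j) ∈ D.Pi₁ := by
  have key : ∀ i j, (D.σ i, D.σ j) ∈ D.Γ₂ ↔ (i, j) ∈ D.Γ₁ := by
    intro i j
    rw [← D.image_eq]
    exact (Function.Injective.prodMap D.σ.injective D.σ.injective).mem_set_image (a := (i, j))
  rw [Pi₁, Pi₂, extend_iff D.proper₁.1, extend_iff D.proper₂.1]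
  constructor
  · intro h
    have := h.lift (p := fun i j => (i, j) ∈ D.Γ₁) D.σ.symm (fun a b hab => by
      change (D.σ.symm a, D.σ.symm b) ∈ D.Γ₁
      rw [← key]; simpa using hab)
    change Relation.TransGen _ (D.σ.symm (D.σ i)) (D.σ.symm (D.σ j)) at this
    rwa [Equiv.symm_apply_apply, Equiv.symm_apply_apply] at this
  · intro h
    exact h.lift D.σ fun a b hab => (key a b).2 hab

theorem block_iff (i j : Fin n) : Block D.Γ₂ (D.σ i) (D.σ j) ↔ Block D.Γ₁ i j := by
  unfold Block
  exact or_congr D.σ.injective.eq_iff (or_congr (D.mem_Pi_iff i j) (D.mem_Pi_iff j i))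

/-- The parabolic subalgebra `P₁ = {a | a_{ij} = 0 for i > j, (j, i) ∉ Π₁}`. -/
def IsInP₁ {k : Type u} [Field k] (a : Matrix (Fin n) (Fin n) k) : Prop :=
  ∀ i j, j < i → (j, i) ∉ D.Pi₁ → a i j = 0

/-- The parabolic subalgebra `P₂ = {b | b_{ij} = 0 for (i, j) ∈ S_m, (i, j) ∉ Π₂}`. -/
def IsInP₂ {k : Type u} [Field k] (m : Fin n) (b : Matrix (Fin n) (Fin n) k) : Prop :=
  ∀ i j, (i, j) ∈ cyclicOrder m → (i, j) ∉ D.Pi₂ → b i j = 0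

/-- The Levi components of `a` and `b` correspond to each other under `σ`. -/
def LeviMatch {k : Type u} [Field k] (a b : Matrix (Fin n) (Fin n) k) : Prop :=
  ∀ i j, (i = j ∨ (i, j) ∈ D.Pi₁) → a i j = b (D.σ i) (D.σ j) ∧ a j i = b (D.σ j) (D.σ i)

theorem leviMatch_iff {k : Type u} [Field k] (a b : Matrix (Fin n) (Fin n) k) :
    D.LeviMatch a b ↔ ∀ i j, Block D.Γ₁ i j → a i j = b (D.σ i) (D.σ j) := by
  constructor
  · rintro h i j (hij | hij | hij)
    exacts [(h i j (.inl hij)).1, (h i j (.inr hij)).1, (h j i (.inr hij)).2]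
  · rintro h i j (hij | hij)
    · exact ⟨h i j (.inl hij), h j i (.inl hij.symm)⟩
    · exact ⟨h i j (.inr (.inl hij)), h j i (.inr (.inr hij))⟩

variable [NeZero n]

/-- The subalgebra `I(P₁, P₂, σ)` of `Mat_n(k) ⊕ Mat_n(k)`: the pairs `(a, b)` with `a ∈ P₁`,
`b ∈ P₂`, whose images in the Levi components `L(P₁)`, `L(P₂)` correspond under the isomorphism
`e_{ij} ↦ e_{σ(i)σ(j)}`. -/
def isotropicSubalgebra (k : Type u) [Field k] (h₁ : ((finRotate n).symm 0, 0) ∉ D.Γ₁) (m : Fin n)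
    (h₂ : ((finRotate n).symm m, m) ∉ D.Γ₂) :
    Subalgebra k (Matrix (Fin n) (Fin n) k × Matrix (Fin n) (Fin n) k) where
  carrier := {p | D.IsInP₁ p.1 ∧ D.IsInP₂ m p.2 ∧ D.LeviMatch p.1 p.2}
  add_mem' := by
    rintro ⟨a, b⟩ ⟨a', b'⟩ ⟨h1, h2, h3⟩ ⟨h1', h2', h3'⟩
    dsimp only at h1 h2 h3 h1' h2' h3'
    refine ⟨fun i j h h' => ?_, fun i j h h' => ?_, fun i j h => ?_⟩
    · change a i j + a' i j = 0
      rw [h1 i j h h', h1' i j h h', add_zero]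
    · change b i j + b' i j = 0
      rw [h2 i j h h', h2' i j h h', add_zero]
    · obtain ⟨e1, e2⟩ := h3 i j h
      obtain ⟨e3, e4⟩ := h3' i j h
      exact ⟨congrArg₂ (· + ·) e1 e3, congrArg₂ (· + ·) e2 e4⟩
  mul_mem' := by
    rintro ⟨a, b⟩ ⟨a', b'⟩ ⟨h1, h2, h3⟩ ⟨h1', h2', h3'⟩
    dsimp only at h1 h2 h3 h1' h2' h3'
    refine ⟨fun i j h h' => ?_, fun i j h h' => ?_, (D.leviMatch_iff _ _).2 fun i j h => ?_⟩
    · refine (Matrix.mul_apply ..).trans (Finset.sum_eq_zero fun l _ => ?_)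
      change a i l * a' l j = 0
      rcases zero_of_zero D.proper₁.1 h₁ ((rank_zero_lt j i).2 h) h' l with ⟨h4, h5⟩ | ⟨h4, h5⟩
      · rw [h1' l j ((rank_zero_lt j l).1 h4) h5, mul_zero]
      · rw [h1 i l ((rank_zero_lt l i).1 h4) h5, zero_mul]
    · refine (Matrix.mul_apply ..).trans (Finset.sum_eq_zero fun l _ => ?_)
      change b i l * b' l j = 0
      rcases zero_of_zero D.proper₂.1 h₂ ((mem_cyclicOrder_iff m i j).1 h) h' l with
        ⟨h4, h5⟩ | ⟨h4, h5⟩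
      · rw [h2 i l ((mem_cyclicOrder_iff m i l).2 h4) h5, zero_mul]
      · rw [h2' l j ((mem_cyclicOrder_iff m l j).2 h4) h5, mul_zero]
    · dsimp only [Prod.mk_mul_mk]
      rw [Matrix.mul_apply, Matrix.mul_apply,
        ← Equiv.sum_comp D.σ fun l => b (D.σ i) l * b' l (D.σ j)]
      rw [leviMatch_iff] at h3 h3'
      refine Finset.sum_congr rfl fun l _ => ?_
      by_cases hl : Block D.Γ₁ i l
      · rw [h3 i l hl, h3' l j (hl.symm.trans D.proper₁.1 h₁ h)]
      · have hl' : ¬ Block D.Γ₁ j l := fun h' => hl (h.trans D.proper₁.1 h₁ h')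
        have e1 : a i l * a' l j = 0 := by
          rcases zero_of_block D.proper₁.1 h₁ h.symm hl' with ⟨h4, h5⟩ | ⟨h4, h5⟩
          · rw [h1' l j ((rank_zero_lt j l).1 h4) h5, mul_zero]
          · rw [h1 i l ((rank_zero_lt l i).1 h4) h5, zero_mul]
        have e2 : b (D.σ i) (D.σ l) * b' (D.σ l) (D.σ j) = 0 := by
          rcases zero_of_block D.proper₂.1 h₂ ((D.block_iff i j).2 h)
            (fun h' => hl ((D.block_iff i l).1 h')) with ⟨h4, h5⟩ | ⟨h4, h5⟩
          · rw [h2 _ _ ((mem_cyclicOrder_iff m _ _).2 h4) h5, zero_mul]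
          · rw [h2' _ _ ((mem_cyclicOrder_iff m _ _).2 h4) h5, mul_zero]
        rw [e1, e2]
  algebraMap_mem' c := by
    refine ⟨fun i j h _ => ?_, fun i j h _ => ?_, fun i j h => ?_⟩
    · simp [Matrix.algebraMap_matrix_apply, h.ne']
    · have : i ≠ j := by
        rintro rfl
        exact lt_irrefl _ ((mem_cyclicOrder_iff m i i).1 h)
      simp [Matrix.algebraMap_matrix_apply, this]
    · simp [Matrix.algebraMap_matrix_apply]

/-- The sheaf of algebras `𝒜 = 𝒜(𝒱, I(P₁, P₂, σ))`, `𝒱 = ⨁ 𝒪(ε_i)`, on the nodal curve attached to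
associative Belavin-Drinfeld data with `(n, 1) ∉ Γ₁` and a choice of `m` with
`(σ₀⁻¹(m), m) ∉ Γ₂`. -/
def order (k : Type u) [Field k] (h₁ : ((finRotate n).symm 0, 0) ∉ D.Γ₁) (m : Fin n)
    (h₂ : ((finRotate n).symm m, m) ∉ D.Γ₂) :
    SphericalOrder.AlgebraSheaf (NodalCurve.nodalCurve k) :=
  NodalCurve.orderSheaf (degrees m) (D.isotropicSubalgebra k h₁ m h₂)

end AssociativeBDData

end

/-!
Near the node, conjugation by the diagonal matrix with entries `(1 + t) ^ ε i` trivialises `𝒱`, so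
the stalk of `𝒜` is the preimage of `I` under `a ↦ (a(0), a(∞))` in matrices over the semilocal
ring of `ℙ¹` at `{0, ∞}`, and `dt / t` generates `ω_C`. The map `τ a = tr a · dt / t` lands in `ω_C`
because `tr a = tr b` for `(a, b) ∈ I`. Generically every morphism `𝒜 → ω_C` is
`a ↦ tr (a Y) dt / t`; it takes values in `ω_C` exactly when `Y` is in `𝒜`, because `I` is its own
orthogonal for `tr (a a') - tr (b b')`. Hence the duality is an isomorphism, and the uniqueness of
`τ` follows from `H⁰(𝒜) = k`.

The `(i, j)` entry of a global section is a polynomial in `t` of degree at most `ε i - ε j`. A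
nonzero value below the diagonal at `0` lies in a position where `I` forces the same value at `∞`,
in the position moved by `σ`, and there the degree bound makes the entry constant, so the value
reappears at `0`. The pair of indices so moves along the `n`-cycle while its order never changes,
which is impossible; values at `∞` are carried along `σ⁻¹` in the same way. So a global section is
diagonal and constant, and the cycle makes its diagonal entries equal.
-/

namespace NodalCurve

variable {k : Type u} [Field k]

/-! ### Rational functions at a point of the line -/

section RegularAt

variable {a : k} {f : RatFunc k}

theorem regularAt_algebraMap_div (p : Polynomial k) {q : Polynomial k} (hq : q.eval a ≠ 0) :
    RegularAt a (algebraMap _ (RatFunc k) p / algebraMap _ _ q) := fun h =>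
  hq (Polynomial.eval_eq_zero_of_dvd_of_eval_eq_zero (RatFunc.denom_div_dvd p q) h)

theorem regularAt_X (a : k) : RegularAt a RatFunc.X := by simp [RegularAt]

theorem val0_X : val0 (RatFunc.X : RatFunc k) = 0 := by simp [val0]

theorem finite_setOf_not_regularAt (f : RatFunc k) : {a : k | ¬ RegularAt a f}.Finite := by
  classical
  refine (f.denom.roots.toFinset.finite_toSet).subset fun a ha => ?_
  simpa [RegularAt, RatFunc.denom_ne_zero] using ha

/-- The local ring of the affine line at `a`, as an algebra of rational functions. -/
def regularRing (a : k) : Subalgebra k (RatFunc k) where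
  carrier := {f | RegularAt a f}
  add_mem' := RegularAt.add
  mul_mem' := RegularAt.mul
  algebraMap_mem' := RegularAt.C a

/-- The uniformizer `t - a` of the affine line at `a`. -/
noncomputable abbrev uniformizer (a : k) : RatFunc k := RatFunc.X - RatFunc.C a

theorem uniformizer_mem (a : k) : uniformizer a ∈ regularRing a :=
  sub_mem (regularAt_X a) (RegularAt.C a a)

theorem uniformizer_ne_zero (a : k) : uniformizer a ≠ 0 := by
  have := Polynomial.X_sub_C_ne_zero a
  unfold uniformizer
  rwa [← RatFunc.algebraMap_X, ← RatFunc.algebraMap_C, ← map_sub, Ne,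
    FaithfulSMul.algebraMap_eq_zero_iff]

theorem uniformizer_zpow_mem (a : k) {e : ℤ} (he : 0 ≤ e) : uniformizer a ^ e ∈ regularRing a := by
  lift e to ℕ using he
  exact zpow_natCast (uniformizer a) e ▸ pow_mem (uniformizer_mem a) e

theorem exists_eq_uniformizer_zpow_mul (a : k) (hf : f ≠ 0) :
    ∃ (e : ℤ) (g : RatFunc k),
      f = uniformizer a ^ e * g ∧ g ∈ regularRing a ∧ g⁻¹ ∈ regularRing a := by
  obtain ⟨p, hp, hpa⟩ := Polynomial.exists_eq_pow_rootMultiplicity_mul_and_not_dvd f.num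
    (RatFunc.num_ne_zero hf) a
  obtain ⟨q, hq, hqa⟩ := Polynomial.exists_eq_pow_rootMultiplicity_mul_and_not_dvd f.denom
    (RatFunc.denom_ne_zero f) a
  rw [Polynomial.dvd_iff_isRoot] at hpa hqa
  refine ⟨(f.num.rootMultiplicity a : ℤ) - f.denom.rootMultiplicity a,
    algebraMap _ _ p / algebraMap _ _ q, ?_, regularAt_algebraMap_div p hqa, ?_⟩
  · have huniformizer : algebraMap (Polynomial k) (RatFunc k) (.X - .C a) = uniformizer a := by
      simp
    conv_lhs => rw [← RatFunc.num_div_denom f, hp, hq]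
    rw [map_mul, map_mul, map_pow, map_pow, huniformizer, zpow_sub₀ (uniformizer_ne_zero a),
      zpow_natCast, zpow_natCast, mul_div_mul_comm]
  · rw [inv_div]
    exact regularAt_algebraMap_div q hpa

theorem div_uniformizer_mem_or_inv_mem (a : k) (f : RatFunc k) :
    f / uniformizer a ∈ regularRing a ∨ f⁻¹ ∈ regularRing a := by
  rcases eq_or_ne f 0 with rfl | hf
  · exact .inl (by simp)
  obtain ⟨e, g, rfl, hg, hg'⟩ := exists_eq_uniformizer_zpow_mul a hf
  rcases le_or_gt e 0 with he | he
  · right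
    rw [mul_inv, ← zpow_neg]
    exact mul_mem (uniformizer_zpow_mem a (by lia)) hg'
  · left
    rw [mul_div_right_comm, div_eq_mul_inv (_ ^ _), ← zpow_sub_one₀ (uniformizer_ne_zero a)]
    exact mul_mem (uniformizer_zpow_mem a (by lia)) hg

theorem exists_uniformizer_pow_mul_mem (a : k) (f : RatFunc k) :
    ∃ N₀ : ℕ, ∀ N ≥ N₀, uniformizer a ^ N * f ∈ regularRing a := by
  rcases eq_or_ne f 0 with rfl | hf
  · exact ⟨0, fun N _ => by rw [mul_zero]; exact zero_mem _⟩
  obtain ⟨e, g, rfl, hg, -⟩ := exists_eq_uniformizer_zpow_mul a hf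
  refine ⟨(-e).toNat, fun N hN => ?_⟩
  rw [← mul_assoc, ← zpow_natCast, ← zpow_add₀ (uniformizer_ne_zero a)]
  exact mul_mem (uniformizer_zpow_mem a (by lia)) hg

theorem uniformizer_zero : uniformizer (0 : k) = RatFunc.X := by simp

theorem regularAt_inv (h : val0 f ≠ 0) : RegularAt 0 f⁻¹ := by
  refine (div_uniformizer_mem_or_inv_mem 0 f).resolve_left fun hdiv => h ?_
  rw [uniformizer_zero] at hdiv
  have := val0_mul (regularAt_X 0) hdiv
  rwa [mul_div_cancel₀ _ RatFunc.X_ne_zero, val0_X, zero_mul] at this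

theorem regularAt_div_X (hf : RegularAt 0 f) (h : val0 f = 0) : RegularAt 0 (f / RatFunc.X) := by
  rcases eq_or_ne f 0 with rfl | hf0
  · simpa using RegularAt.zero (0 : k)
  rw [← uniformizer_zero]
  refine (div_uniformizer_mem_or_inv_mem 0 f).resolve_right fun hinv => one_ne_zero (α := k) ?_
  rw [← val0_one, ← mul_inv_cancel₀ hf0, val0_mul hf hinv, h, zero_mul]

end RegularAt

theorem swap_C (c : k) : swap k (RatFunc.C c) = RatFunc.C c := (swap k).commutes c

theorem swap_algebraMap (p : Polynomial k) :
    swap k (algebraMap _ _ p) = Polynomial.aeval (RatFunc.X : RatFunc k)⁻¹ p := by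
  rw [← RatFunc.aeval_X_left_eq_algebraMap, ← Polynomial.aeval_algHom_apply, swap_X]

/-! ### The semilocal ring of the line over the node -/

/-- The semilocal ring of `ℙ¹` at `{0, ∞}`, i.e. the stalk of `π_* 𝒪` at the node. -/
noncomputable def overNode (k : Type u) [Field k] : Subalgebra k (RatFunc k) :=
  regularRing 0 ⊓ (regularRing 0).comap (swap k)

/-- The value at `0` of a function regular at `0` and `∞`. -/
noncomputable def evalZero : overNode k →ₐ[k] k where
  toFun f := val0 f.1
  map_one' := val0_one
  map_mul' f g := val0_mul f.2.1 g.2.1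
  map_zero' := val0_zero
  map_add' f g := val0_add f.2.1 g.2.1
  commutes' := val0_C

/-- The value at `∞` of a function regular at `0` and `∞`. -/
noncomputable def evalInfty : overNode k →ₐ[k] k where
  toFun f := val0 (swap k f.1)
  map_one' := (congrArg val0 (map_one (swap k))).trans val0_one
  map_mul' f g := (congrArg val0 (map_mul (swap k) f.1 g.1)).trans (val0_mul f.2.2 g.2.2)
  map_zero' := (congrArg val0 (map_zero (swap k))).trans val0_zero
  map_add' f g := (congrArg val0 (map_add (swap k) f.1 g.1)).trans (val0_add f.2.2 g.2.2)
  commutes' c := (congrArg val0 (swap_C c)).trans (val0_C c)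

theorem inv_mem_overNode {f : overNode k} (h₀ : evalZero f ≠ 0) (h₁ : evalInfty f ≠ 0) :
    (f : RatFunc k)⁻¹ ∈ overNode k :=
  ⟨regularAt_inv h₀, show RegularAt 0 (swap k _) by rw [map_inv₀]; exact regularAt_inv h₁⟩

theorem X_add_one_ne_zero : (RatFunc.X + 1 : RatFunc k) ≠ 0 := by
  simpa [uniformizer] using uniformizer_ne_zero (-1 : k)

theorem swap_X_add_one : swap k (RatFunc.X + 1) = (RatFunc.X + 1) * RatFunc.X⁻¹ := by
  rw [map_add, map_one, swap_X, add_mul, mul_inv_cancel₀ RatFunc.X_ne_zero, one_mul, add_comm]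

theorem regularAt_inv_X_add_one : RegularAt (0 : k) (RatFunc.X + 1)⁻¹ :=
  regularAt_inv (by rw [val0_add (regularAt_X 0) (.one 0), val0_X, val0_one]; simp)

theorem val0_inv_X_add_one : val0 (RatFunc.X + 1 : RatFunc k)⁻¹ = 1 := by
  have hX := val0_add (regularAt_X (0 : k)) (.one 0)
  have hmul := val0_mul ((regularAt_X (0 : k)).add (.one 0)) regularAt_inv_X_add_one
  rwa [mul_inv_cancel₀ X_add_one_ne_zero, hX, val0_X, val0_one, zero_add, one_mul, eq_comm] at hmul

theorem swap_inv_X_add_one :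
    swap k (RatFunc.X + 1)⁻¹ = RatFunc.X * (RatFunc.X + 1)⁻¹ := by
  rw [map_inv₀, swap_X_add_one, mul_inv, inv_inv, mul_comm]

/-- The function `1 / (1 + t)`, which separates the two points over the node. -/
noncomputable def separator (k : Type u) [Field k] : overNode k :=
  ⟨(RatFunc.X + 1)⁻¹, regularAt_inv_X_add_one, show RegularAt 0 (swap k _) by
    rw [swap_inv_X_add_one]; exact (regularAt_X 0).mul regularAt_inv_X_add_one⟩

@[simp] theorem evalZero_separator : evalZero (separator k) = 1 := val0_inv_X_add_one

@[simp] theorem evalInfty_separator : evalInfty (separator k) = 0 := by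
  change val0 (swap k (RatFunc.X + 1)⁻¹) = 0
  rw [swap_inv_X_add_one, val0_mul (regularAt_X 0) regularAt_inv_X_add_one, val0_X, zero_mul]

theorem exists_evalZero_eq_and_evalInfty_eq (a b : k) :
    ∃ f : overNode k, evalZero f = a ∧ evalInfty f = b :=
  ⟨algebraMap k _ b + algebraMap k _ (a - b) * separator k, by simp, by simp⟩

/-- The function `t / (1 + t) ^ 2`, with simple zeros at `0` and `∞`. It generates the conductor of
the node. -/
noncomputable def conductorGen (k : Type u) [Field k] : overNode k :=
  separator k * (1 - separator k)

theorem coe_conductorGen :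
    (conductorGen k : RatFunc k) = RatFunc.X * ((RatFunc.X + 1)⁻¹ * (RatFunc.X + 1)⁻¹) := by
  change (RatFunc.X + 1)⁻¹ * (1 - (RatFunc.X + 1)⁻¹) = _
  have := X_add_one_ne_zero (k := k)
  field_simp
  ring

theorem coe_conductorGen_ne_zero : (conductorGen k : RatFunc k) ≠ 0 := by
  rw [coe_conductorGen]
  have := inv_ne_zero (X_add_one_ne_zero (k := k))
  exact mul_ne_zero RatFunc.X_ne_zero (mul_ne_zero this this)

theorem swap_conductorGen : swap k (conductorGen k) = conductorGen k := by
  have := RatFunc.X_ne_zero (K := k)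
  rw [coe_conductorGen, map_mul, map_mul, swap_inv_X_add_one, swap_X]
  field_simp

@[simp] theorem evalZero_conductorGen : evalZero (conductorGen k) = 0 := by simp [conductorGen]

@[simp] theorem evalInfty_conductorGen : evalInfty (conductorGen k) = 0 := by simp [conductorGen]

theorem div_conductorGen_mem {f : overNode k} (h₀ : evalZero f = 0) (h₁ : evalInfty f = 0) :
    (f : RatFunc k) / conductorGen k ∈ overNode k := by
  have hdiv {g : RatFunc k} (hg : RegularAt 0 g) (hv : val0 g = 0) :
      RegularAt 0 (g / (conductorGen k : RatFunc k)) := by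
    rw [coe_conductorGen, ← div_div, div_eq_mul_inv, mul_inv, inv_inv]
    have := (regularAt_X (0 : k)).add (.one 0)
    exact (regularAt_div_X hg hv).mul (this.mul this)
  refine ⟨hdiv f.2.1 h₀, show RegularAt 0 (swap k _) from ?_⟩
  rw [map_div₀, swap_conductorGen]
  exact hdiv f.2.2 h₁

theorem exists_conductorGen_pow_mul_mem (f : RatFunc k) :
    ∃ N : ℕ, (conductorGen k : RatFunc k) ^ N * f ∈ overNode k := by
  have hpow (g : RatFunc k) :
      ∃ N₀ : ℕ, ∀ N ≥ N₀, RegularAt 0 ((conductorGen k : RatFunc k) ^ N * g) := by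
    obtain ⟨N₀, hN₀⟩ := exists_uniformizer_pow_mul_mem 0 g
    simp only [uniformizer_zero] at hN₀
    refine ⟨N₀, fun N hN => ?_⟩
    rw [coe_conductorGen, mul_pow, mul_right_comm]
    exact mul_mem (hN₀ N hN) (pow_mem (S := regularRing 0)
      (mul_mem regularAt_inv_X_add_one regularAt_inv_X_add_one) N)
  obtain ⟨N₀, hN₀⟩ := hpow f
  obtain ⟨N₁, hN₁⟩ := hpow (swap k f)
  refine ⟨max N₀ N₁, hN₀ _ (le_max_left ..), show RegularAt 0 (swap k _) from ?_⟩
  rw [map_mul, map_pow, swap_conductorGen]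
  exact hN₁ _ (le_max_right ..)

/-! ### The local rings of the nodal curve -/

section Noetherian

variable {R : Type*} [CommRing R]

theorem isNoetherianRing_of_dvd_pow (m : Ideal R) (hfg : m.FG) (hunit : ∀ f ∉ m, IsUnit f)
    (hdvd : ∀ f ≠ 0, ∀ g ∈ m, ∃ N, f ∣ g ^ N) : IsNoetherianRing R := by
  refine IsNoetherianRing.of_prime_ne_bot fun P hP hP₀ => ?_
  obtain ⟨f, hfP, hf⟩ := Submodule.exists_mem_ne_zero_of_ne_bot hP₀
  suffices P = m by rwa [this]
  refine le_antisymm (fun g hg => ?_) fun g hg => ?_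
  · by_contra hgm
    exact hP.ne_top (Ideal.eq_top_of_isUnit_mem _ hg (hunit g hgm))
  · obtain ⟨N, hN⟩ := hdvd f hf g hg
    exact hP.mem_of_pow_mem N (Ideal.mem_of_dvd _ hN hfP)

end Noetherian

theorem isUnit_of_inv_mem {K : Type*} [Field K] {R : Subring K} {f : R} (hf : f ≠ 0)
    (hinv : (f : K)⁻¹ ∈ R) : IsUnit f :=
  .of_mul_eq_one ⟨_, hinv⟩ (Subtype.ext (mul_inv_cancel₀ (Subtype.coe_ne_coe.2 hf)))

theorem dvd_of_mul_inv_mem {K : Type*} [Field K] {R : Subring K} {f g : R} (hf : f ≠ 0)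
    (h : (g : K) * (f : K)⁻¹ ∈ R) : f ∣ g :=
  ⟨⟨_, h⟩, Subtype.ext <| by
    rw [R.coe_mul, mul_left_comm, mul_inv_cancel₀ (Subtype.coe_ne_coe.2 hf), mul_one]⟩

section Points

variable {p : P1 k}

theorem proj_eq_smooth_iff {a : kˣ} : proj p = .smooth a ↔ p = .finite (a : k) := by
  rcases p with _ | b | _
  · simp [proj]
  · rcases eq_or_ne b 0 with rfl | hb
    · simpa [proj] using a.ne_zero.symm
    · simp [proj, hb, Units.ext_iff]
  · simp [proj]

theorem proj_eq_node_iff : proj p = .node ↔ p = .finite (0 : k) ∨ p = .infty := by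
  rcases p with _ | b | _ <;> simp [proj]

theorem proj_eq_generic_iff : proj p = .generic ↔ p = .generic := by
  rcases p with _ | b | _
  · simp [proj]
  · rcases eq_or_ne b 0 with rfl | hb <;> simp [proj, *]
  · simp [proj]

end Points

theorem mem_localRing_generic (f : RatFunc k) : f ∈ localRing (.generic : Point k) :=
  ⟨fun p hp => by rw [proj_eq_generic_iff.1 hp]; trivial, nofun⟩

theorem mem_localRing_smooth {a : kˣ} {f : RatFunc k} :
    f ∈ localRing (.smooth a) ↔ f ∈ regularRing (a : k) :=
  ⟨fun h => h.1 _ (proj_eq_smooth_iff.2 rfl), fun h =>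
    ⟨fun p hp => by rw [proj_eq_smooth_iff.1 hp]; exact h, nofun⟩⟩

theorem mem_localRing_node {f : RatFunc k} :
    f ∈ localRing (.node : Point k) ↔
      ∃ h : f ∈ overNode k, evalZero ⟨f, h⟩ = evalInfty ⟨f, h⟩ := by
  have hneg (g : RatFunc k) : RatFunc.X ^ (-(0 : ℤ)) * g = g := by simp
  refine ⟨fun h => ⟨⟨h.1 _ proj_zero, ?_⟩, ?_⟩, fun ⟨⟨h₀, h₁⟩, h⟩ => ⟨fun p hp => ?_, fun _ => ?_⟩⟩
  · have := h.1 .infty rfl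
    rwa [IsSectionAt, hneg] at this
  · have := h.2 rfl
    rwa [valInfty, hneg] at this
  · rcases proj_eq_node_iff.1 hp with rfl | rfl
    · exact h₀
    · rw [IsSectionAt, hneg]
      exact h₁
  · rw [valInfty, hneg]
    exact h

theorem coe_mem_localRing_node {f : overNode k} :
    (f : RatFunc k) ∈ localRing (.node : Point k) ↔ evalZero f = evalInfty f :=
  mem_localRing_node.trans (exists_prop_of_true f.2)

theorem finite_setOf_notMem_localRing (f : RatFunc k) :
    {x : Point k | f ∉ localRing x}.Finite := by
  refine ((((finite_setOf_not_regularAt f).preimage (f := fun a : kˣ => (a : k))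
    Units.val_injective.injOn).image .smooth).insert .node).subset fun x hx => ?_
  cases x with
  | generic => exact absurd (mem_localRing_generic f) hx
  | node => exact .inl rfl
  | smooth a => exact .inr ⟨a, fun h => hx (mem_localRing_smooth.2 h), rfl⟩

theorem isNoetherianRing_localRing_generic : IsNoetherianRing (localRing (.generic : Point k)) :=
  isNoetherianRing_of_dvd_pow ⊥ Submodule.fg_bot
    (fun _ hf => isUnit_of_inv_mem hf (mem_localRing_generic _))
    fun _ _ g hg => ⟨1, by simp [(Submodule.mem_bot _).1 hg]⟩

theorem isNoetherianRing_localRing_smooth (a : kˣ) :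
    IsNoetherianRing (localRing (.smooth a : Point k)) := by
  let z : localRing (.smooth a : Point k) :=
    ⟨uniformizer (a : k), mem_localRing_smooth.2 (uniformizer_mem _)⟩
  refine isNoetherianRing_of_dvd_pow (Ideal.span {z}) (Submodule.fg_span_singleton z)
    (fun f hf => ?_) fun f hf g hg => ?_
  · have hdiv : (f : RatFunc k) / uniformizer (a : k) ∉ regularRing (a : k) := fun h =>
      hf (Ideal.mem_span_singleton.2 ⟨⟨_, mem_localRing_smooth.2 h⟩,
        Subtype.ext (mul_div_cancel₀ f.1 (uniformizer_ne_zero _)).symm⟩)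
    exact isUnit_of_inv_mem (fun h => hf (h ▸ zero_mem _)) (mem_localRing_smooth.2
      ((div_uniformizer_mem_or_inv_mem _ _).resolve_left hdiv))
  · obtain ⟨c, rfl⟩ := Ideal.mem_span_singleton.1 hg
    obtain ⟨N, hN⟩ := exists_uniformizer_pow_mul_mem (a : k) (f : RatFunc k)⁻¹
    rw [exists_congr fun N => by rw [mul_pow]]
    exact ⟨N, dvd_mul_of_dvd_left
      (dvd_of_mul_inv_mem hf (mem_localRing_smooth.2 (hN N le_rfl))) _⟩

/-- The value at the node of a function regular there. -/
noncomputable def evalNode : localRing (.node : Point k) →+* k :=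
  (evalZero (k := k)).toRingHom.comp
    (Subring.inclusion fun _ hf => (mem_localRing_node.1 hf).1 :
      localRing (.node : Point k) →+* (overNode k).toSubring)

theorem evalNode_eq_zero_iff {f : overNode k} (hf : (f : RatFunc k) ∈ localRing (.node : Point k)) :
    evalNode (k := k) ⟨f, hf⟩ = 0 ↔ evalZero f = 0 ∧ evalInfty f = 0 := by
  rw [← coe_mem_localRing_node.1 hf, and_self]
  rfl

theorem exists_eq_conductorGen_mul {g : localRing (.node : Point k)} (hg : evalNode g = 0) :
    ∃ h : overNode k, (g : RatFunc k) = conductorGen k * h := by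
  obtain ⟨g, hgm⟩ := g
  lift g to overNode k using (mem_localRing_node.1 hgm).1
  obtain ⟨h₀, h₁⟩ := (evalNode_eq_zero_iff hgm).1 hg
  exact ⟨⟨_, div_conductorGen_mem h₀ h₁⟩, (mul_div_cancel₀ _ coe_conductorGen_ne_zero).symm⟩

theorem conductorGen_mul_mem_localRing (f : overNode k) :
    (conductorGen k * f : RatFunc k) ∈ localRing (.node : Point k) :=
  (coe_mem_localRing_node (f := conductorGen k * f)).2 (by simp)

theorem exists_eq_add_mul_separator (f : overNode k) :
    ∃ α β : localRing (.node : Point k), (f : RatFunc k) = α + β * separator k := by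
  let β := evalZero f - evalInfty f
  refine ⟨⟨_, (coe_mem_localRing_node (f := f - algebraMap k _ β * separator k)).2 ?_⟩,
    ⟨_, C_mem_localRing β _⟩, (sub_add_cancel _ _).symm⟩
  simp [β]

theorem ker_evalNode :
    RingHom.ker (evalNode (k := k)) =
      Ideal.span {⟨_, conductorGen_mul_mem_localRing 1⟩,
        ⟨_, conductorGen_mul_mem_localRing (separator k)⟩} := by
  refine le_antisymm (fun f hf => ?_) (Ideal.span_le.2 ?_)
  · obtain ⟨h, hfh⟩ := exists_eq_conductorGen_mul (RingHom.mem_ker.1 hf)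
    obtain ⟨α, β, hαβ⟩ := exists_eq_add_mul_separator h
    refine Ideal.mem_span_pair.2 ⟨α, β, Subtype.ext ?_⟩
    rw [hfh, hαβ]
    push_cast
    ring
  · have hker (g : overNode k) :
        ⟨_, conductorGen_mul_mem_localRing g⟩ ∈ RingHom.ker (evalNode (k := k)) :=
      (evalNode_eq_zero_iff (f := conductorGen k * g) _).2 (by simp)
    rintro _ (rfl | rfl) <;> exact hker _

theorem isUnit_of_evalNode_ne_zero {f : localRing (.node : Point k)} (hf : evalNode f ≠ 0) :
    IsUnit f := by
  obtain ⟨h, he⟩ := mem_localRing_node.1 f.2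
  have h₀ : evalZero ⟨f.1, h⟩ ≠ 0 := hf
  have h₁ : evalInfty ⟨f.1, h⟩ ≠ 0 := he ▸ h₀
  have hinv := inv_mem_overNode h₀ h₁
  have hne : f ≠ 0 := fun h => hf (h ▸ map_zero evalNode)
  have hmul : (⟨f.1, h⟩ : overNode k) * ⟨_, hinv⟩ = 1 :=
    Subtype.ext (mul_inv_cancel₀ (Subtype.coe_ne_coe.2 hne))
  refine isUnit_of_inv_mem hne
    ((coe_mem_localRing_node (f := ⟨_, hinv⟩)).2 ?_)
  refine mul_left_cancel₀ h₀ ?_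
  conv_rhs => rw [he]
  rw [← map_mul, ← map_mul, hmul, map_one, map_one]

theorem exists_dvd_pow_of_evalNode_eq_zero {f g : localRing (.node : Point k)} (hf : f ≠ 0)
    (hg : evalNode g = 0) : ∃ N, f ∣ g ^ N := by
  obtain ⟨h, hgh⟩ := exists_eq_conductorGen_mul hg
  obtain ⟨N, hN⟩ := exists_conductorGen_pow_mul_mem (f : RatFunc k)⁻¹
  refine ⟨N + 1, dvd_of_mul_inv_mem hf ?_⟩
  convert conductorGen_mul_mem_localRing (⟨_, hN⟩ * h ^ (N + 1)) using 1
  push_cast [hgh]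
  ring

theorem isNoetherianRing_localRing_node : IsNoetherianRing (localRing (.node : Point k)) :=
  isNoetherianRing_of_dvd_pow (RingHom.ker evalNode)
    (ker_evalNode (k := k) ▸ Submodule.fg_span (Set.toFinite _))
    (fun _ hf => isUnit_of_evalNode_ne_zero hf)
    fun _ hf _ hg => exists_dvd_pow_of_evalNode_eq_zero hf hg

instance isNoetherianRing_localRing (x : Point k) : IsNoetherianRing (localRing x) := by
  cases x with
  | generic => exact isNoetherianRing_localRing_generic
  | node => exact isNoetherianRing_localRing_node
  | smooth a => exact isNoetherianRing_localRing_smooth a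

theorem exists_denominator_mem_localRing (x : Point k) (c : RatFunc k) :
    ∃ f ≠ 0, f ∈ localRing x ∧ f * c ∈ localRing x := by
  cases x with
  | generic => exact ⟨1, one_ne_zero, one_mem _, mem_localRing_generic _⟩
  | smooth a =>
    obtain ⟨N, hN⟩ := exists_uniformizer_pow_mul_mem (a : k) c
    exact ⟨_, pow_ne_zero N (uniformizer_ne_zero _),
      mem_localRing_smooth.2 (pow_mem (uniformizer_mem _) N), mem_localRing_smooth.2 (hN N le_rfl)⟩
  | node =>
    obtain ⟨N, hN⟩ := exists_conductorGen_pow_mul_mem c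
    refine ⟨_, pow_ne_zero (N + 1) coe_conductorGen_ne_zero, ?_, ?_⟩
    · exact (coe_mem_localRing_node (f := conductorGen k ^ (N + 1))).2 (by simp)
    · rw [pow_succ', mul_assoc]
      exact conductorGen_mul_mem_localRing ⟨_, hN⟩

theorem exists_common_denominator_mem_localRing {ι : Type*} [Finite ι] (x : Point k)
    (c : ι → RatFunc k) : ∃ f ≠ 0, ∀ i, f * c i ∈ localRing x := by
  classical
  have := Fintype.ofFinite ι
  choose f hf₀ hf hfc using fun i => exists_denominator_mem_localRing x (c i)
  refine ⟨∏ i, f i, Finset.prod_ne_zero_iff.2 fun i _ => hf₀ i, fun i => ?_⟩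
  rw [← Finset.prod_erase_mul _ _ (Finset.mem_univ i), mul_assoc]
  exact mul_mem (prod_mem fun j _ => hf j) (hfc i)

end NodalCurve

theorem StalkwiseSheaf.pred_apply_eq {X : TopCat.{u}} [PreirreducibleSpace X] {R : Type u}
    {S : X → Set R} {U : Opens X} {f : U → R} (hf : (pred S).pred f) (x y : U) : f x = f y :=
  have := Subtype.preconnectedSpace ((PreirreducibleSpace.isPreirreducible_univ.open_subset
    U.isOpen (Set.subset_univ _)).isPreconnected)
  hf.1.apply_eq_of_preconnectedSpace x y

theorem StalkwiseSheaf.pred_const {X : TopCat.{u}} {R : Type u} {S : X → Set R} {U : Opens X}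
    {r : R} (hr : ∀ x ∈ U, r ∈ S x) : (pred S).pred (fun _ : U => r) :=
  ⟨IsLocallyConstant.const r, fun x => hr x.1 x.2⟩

namespace NodalCurve

open Filter Topology

variable {k : Type u} [Field k]

/-! ### Neighborhoods on the nodal curve -/

theorem generic_mem_of_mem {U : Opens (nodalCurve k)} {x : Point k} (hx : x ∈ U) :
    (Point.generic : Point k) ∈ U :=
  (U.isOpen ⟨x, hx⟩).1

instance : PreirreducibleSpace (TopCat.of (Point k)) where
  isPreirreducible_univ := fun _ _ hU hV ⟨_, _, hx⟩ ⟨_, _, hy⟩ =>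
    ⟨.generic, trivial, (hU ⟨_, hx⟩).1, (hV ⟨_, hy⟩).1⟩

variable {Q : Point k → Prop} {x : Point k}

theorem eventually_nhds_point_iff :
    (∀ᶠ y in 𝓝 x, Q y) ↔ {y | ¬ Q y}.Finite ∧ Q .generic ∧ Q x := by
  refine ⟨fun h => ?_, fun ⟨hfin, hη, hx⟩ => mem_nhds_iff.2 ⟨{y | Q y}, fun _ => id,
    fun _ => ⟨hη, hfin⟩, hx⟩⟩
  obtain ⟨W, hWQ, hW, hxW⟩ := mem_nhds_iff.1 h
  exact ⟨(hW ⟨x, hxW⟩).2.subset (Set.compl_subset_compl.2 hWQ), hWQ (hW ⟨x, hxW⟩).1, hWQ hxW⟩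

theorem eventually_nhds_of_generic (h : ∀ᶠ y in 𝓝 .generic, Q y) (hx : Q x) : ∀ᶠ y in 𝓝 x, Q y :=
  have ⟨hfin, hη, _⟩ := eventually_nhds_point_iff.1 h
  eventually_nhds_point_iff.2 ⟨hfin, hη, hx⟩

theorem eventually_ne_node : ∀ᶠ y : Point k in 𝓝 .generic, y ≠ .node :=
  eventually_nhds_point_iff.2 ⟨(Set.finite_singleton .node).subset fun _ => not_not.1, by simp⟩

theorem exists_opens_of_eventually {U : Opens (nodalCurve k)} (hx : x ∈ U)
    (h : ∀ᶠ y in 𝓝 x, Q y) :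
    ∃ W : Opens (nodalCurve k), W ≤ U ∧ x ∈ W ∧ ∀ y ∈ W, Q y := by
  obtain ⟨W, hWQ, hW, hxW⟩ := mem_nhds_iff.1 h
  exact ⟨U ⊓ ⟨W, hW⟩, inf_le_left, ⟨hx, hxW⟩, fun y hy => hWQ hy.2⟩

theorem eventually_mem_localRing {f : RatFunc k} (hf : f ∈ localRing x) :
    ∀ᶠ y in 𝓝 x, f ∈ localRing y :=
  eventually_nhds_point_iff.2 ⟨finite_setOf_notMem_localRing f, mem_localRing_generic f, hf⟩

/-! ### Families of lattices -/

section Lattice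

open Submodule

variable {V : Type*} [AddCommGroup V] [Module (RatFunc k) V] {ι κ : Type*} [Finite ι] [Finite κ]

theorem eventually_mem_span {g : ι → V} {v : V} (hv : v ∈ span (localRing x) (Set.range g)) :
    ∀ᶠ y in 𝓝 x, v ∈ span (localRing y) (Set.range g) := by
  have := Fintype.ofFinite ι
  obtain ⟨b, rfl⟩ := (mem_span_range_iff_exists_fun _).1 hv
  filter_upwards [eventually_all.2 fun i => eventually_mem_localRing (b i).2] with y hy
  exact sum_mem fun i _ => smul_mem _ (⟨b i, hy i⟩ : localRing y) (subset_span ⟨i, rfl⟩)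

theorem eventually_span_eq {g : ι → V} {v : κ → V}
    (h : span (localRing x) (Set.range g) = span (localRing x) (Set.range v)) :
    ∀ᶠ y in 𝓝 x, span (localRing y) (Set.range g) = span (localRing y) (Set.range v) := by
  have hg := eventually_all.2 fun i => eventually_mem_span (g := v) (v := g i) (x := x)
    (h ▸ subset_span ⟨i, rfl⟩)
  have hv := eventually_all.2 fun j => eventually_mem_span (g := g) (v := v j) (x := x)
    (h ▸ subset_span ⟨j, rfl⟩)
  filter_upwards [hg, hv] with y hgy hvy
  exact le_antisymm (span_le.2 (Set.range_subset_iff.2 hgy))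
    (span_le.2 (Set.range_subset_iff.2 hvy))

theorem inv_smul_mem_of_generic {T : Submodule (localRing (.generic : Point k)) V}
    {f : RatFunc k} (hf : f ≠ 0) {v : V} (hv : f • v ∈ T) : v ∈ T := by
  have := T.smul_mem (⟨f⁻¹, mem_localRing_generic _⟩ : localRing .generic) hv
  rwa [Subring.smul_def, smul_smul, inv_mul_cancel₀ hf, one_smul] at this

theorem exists_eventually_eq_span (L : ∀ y : Point k, Submodule (localRing y) V)
    (hdenom : ∀ y v, ∃ f : RatFunc k, f ≠ 0 ∧ f • v ∈ L y) {v : ι → V}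
    (hv : ∀ᶠ y in 𝓝 .generic, L y = span (localRing y) (Set.range v)) (hfg : (L x).FG) :
    ∃ (N : ℕ) (r : Fin N → V), ∀ᶠ y in 𝓝 x, L y = span (localRing y) (Set.range r) := by
  obtain ⟨N, r, hr⟩ := fg_iff_exists_fin_generating_family.1 hfg
  have hr_generic : span (localRing (.generic : Point k)) (Set.range r) = ⊤ := by
    refine eq_top_iff.2 fun v _ => ?_
    obtain ⟨f, hf, hfv⟩ := hdenom x v
    rw [← hr] at hfv
    exact inv_smul_mem_of_generic hf ((eventually_nhds_point_iff.1 (eventually_mem_span hfv)).2.1)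
  have hL_generic : L .generic = ⊤ := eq_top_iff.2 fun v _ => by
    obtain ⟨f, hf, hfv⟩ := hdenom .generic v
    exact inv_smul_mem_of_generic hf hfv
  have hvr := eventually_span_eq (hv.self_of_nhds.symm.trans (hL_generic.trans hr_generic.symm))
  refine ⟨N, r, eventually_nhds_of_generic ?_ hr.symm⟩
  filter_upwards [hv, hvr] with y hvy hvry
  exact hvy.trans hvry

end Lattice

/-! ### Stalks of the order -/

theorem regularAt_X_add_one_zpow_and_val0 (e : ℤ) :
    RegularAt (0 : k) ((RatFunc.X + 1) ^ e) ∧ val0 (k := k) ((RatFunc.X + 1) ^ e) = 1 := by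
  have hX : RegularAt (0 : k) (RatFunc.X + 1) := (regularAt_X 0).add (.one 0)
  induction e with
  | zero => exact zpow_zero (RatFunc.X + 1 : RatFunc k) ▸ ⟨.one 0, val0_one⟩
  | succ e ih =>
    rw [zpow_add_one₀ X_add_one_ne_zero, val0_mul ih.1 hX, ih.2, val0_add (regularAt_X 0) (.one 0),
      val0_X, val0_one, zero_add, one_mul]
    exact ⟨ih.1.mul hX, rfl⟩
  | pred e ih =>
    rw [zpow_sub_one₀ X_add_one_ne_zero, val0_mul ih.1 regularAt_inv_X_add_one, ih.2,
      val0_inv_X_add_one, one_mul]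
    exact ⟨ih.1.mul regularAt_inv_X_add_one, rfl⟩

theorem regularAt_X_add_one_zpow_mul_iff (e : ℤ) {g : RatFunc k} :
    RegularAt 0 ((RatFunc.X + 1) ^ e * g) ↔ RegularAt 0 g := by
  refine ⟨fun h => ?_, (regularAt_X_add_one_zpow_and_val0 e).1.mul⟩
  have := (regularAt_X_add_one_zpow_and_val0 (-e)).1.mul h
  rwa [← mul_assoc, ← zpow_add₀ X_add_one_ne_zero, neg_add_cancel, zpow_zero, one_mul] at this

theorem val0_X_add_one_zpow_mul (e : ℤ) {g : RatFunc k} (hg : RegularAt 0 g) :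
    val0 ((RatFunc.X + 1) ^ e * g) = val0 g := by
  obtain ⟨hreg, hval⟩ := regularAt_X_add_one_zpow_and_val0 (k := k) e
  rw [val0_mul hreg hg, hval, one_mul]

theorem swap_X_zpow_neg_mul_X_add_one_zpow_mul (e : ℤ) (g : RatFunc k) :
    swap k (RatFunc.X ^ (-e) * ((RatFunc.X + 1) ^ e * g)) = (RatFunc.X + 1) ^ e * swap k g := by
  have hX := zpow_ne_zero e (RatFunc.X_ne_zero (K := k))
  rw [map_mul, map_mul, map_zpow₀, map_zpow₀, swap_X, swap_X_add_one, mul_zpow, inv_zpow, inv_zpow,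
    zpow_neg, inv_inv]
  field_simp

section

variable {n : ℕ}

/-- The matrix of functions of a section of `ℰnd(𝒱)`, `𝒱 = ⨁ 𝒪(d i)`, given by its matrix in the
trivialization of `𝒱` by the powers of `x₀ + x₁`. -/
noncomputable def twist (d : Fin n → ℤ) :
    Matrix (Fin n) (Fin n) (RatFunc k) ≃ₐ[RatFunc k] Matrix (Fin n) (Fin n) (RatFunc k) where
  toFun G := .of fun i j => (RatFunc.X + 1) ^ (d i - d j) * G i j
  invFun M := .of fun i j => (RatFunc.X + 1) ^ (d j - d i) * M i j
  left_inv G := Matrix.ext fun i j => by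
    simp [← mul_assoc, ← zpow_add₀ (X_add_one_ne_zero (k := k))]
  right_inv M := Matrix.ext fun i j => by
    simp [← mul_assoc, ← zpow_add₀ (X_add_one_ne_zero (k := k))]
  map_mul' G H := Matrix.ext fun i j => by
    simp only [Matrix.mul_apply, Matrix.of_apply, Finset.mul_sum]
    refine Finset.sum_congr rfl fun l _ => ?_
    rw [mul_mul_mul_comm, ← zpow_add₀ X_add_one_ne_zero, sub_add_sub_cancel]
  map_add' G H := Matrix.ext fun i j => mul_add _ _ _
  commutes' f := Matrix.ext fun i j => by
    rcases eq_or_ne i j with rfl | h <;> simp [Matrix.algebraMap_matrix_apply, *]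

theorem twist_apply (d : Fin n → ℤ) (G : Matrix (Fin n) (Fin n) (RatFunc k)) (i j : Fin n) :
    twist d G i j = (RatFunc.X + 1) ^ (d i - d j) * G i j := rfl

theorem trace_twist (d : Fin n → ℤ) (G : Matrix (Fin n) (Fin n) (RatFunc k)) :
    (twist d G).trace = G.trace := by
  simp [Matrix.trace, twist_apply]

/-- The matrix of functions of a section of `ℰnd(𝒱)`, `𝒱 = ⨁ 𝒪(d i)`, near the preimage of the
node. -/
noncomputable def overNodeTwist (d : Fin n → ℤ) :
    Matrix (Fin n) (Fin n) (overNode k) →ₐ[k] Matrix (Fin n) (Fin n) (RatFunc k) :=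
  ((twist d).toAlgHom.restrictScalars k).comp (overNode k).val.mapMatrix

theorem overNodeTwist_apply (d : Fin n → ℤ) (G : Matrix (Fin n) (Fin n) (overNode k))
    (i j : Fin n) :
    overNodeTwist d G i j = (RatFunc.X + 1 : RatFunc k) ^ (d i - d j) * (G i j : RatFunc k) := rfl

theorem overNodeTwist_smul (d : Fin n → ℤ) (f : overNode k)
    (G : Matrix (Fin n) (Fin n) (overNode k)) :
    overNodeTwist d (f • G) = (f : RatFunc k) • overNodeTwist d G :=
  Matrix.ext fun _ _ => mul_left_comm _ _ _

/-- The pair of values at `0` and `∞` of a matrix of functions. -/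
noncomputable def fiberValues :
    Matrix (Fin n) (Fin n) (overNode k) →ₐ[k]
      Matrix (Fin n) (Fin n) k × Matrix (Fin n) (Fin n) k :=
  evalZero.mapMatrix.prod evalInfty.mapMatrix

variable {d : Fin n → ℤ} {M : Matrix (Fin n) (Fin n) (RatFunc k)}

theorem isSectionAt_zero_twist_apply {G : Matrix (Fin n) (Fin n) (RatFunc k)} {i j : Fin n} :
    IsSectionAt (d i - d j) (.finite 0) (twist d G i j) ↔ RegularAt 0 (G i j) :=
  regularAt_X_add_one_zpow_mul_iff _

theorem isSectionAt_infty_twist_apply {G : Matrix (Fin n) (Fin n) (RatFunc k)} {i j : Fin n} :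
    IsSectionAt (d i - d j) .infty (twist d G i j) ↔ RegularAt 0 (swap k (G i j)) := by
  rw [IsSectionAt, twist_apply, swap_X_zpow_neg_mul_X_add_one_zpow_mul]
  exact regularAt_X_add_one_zpow_mul_iff _

theorem isEndSectionAt_zero_and_infty_iff :
    IsEndSectionAt d (.finite 0) M ∧ IsEndSectionAt d .infty M ↔ ∃ G, overNodeTwist d G = M := by
  obtain ⟨G, rfl⟩ := (twist d).surjective M
  simp only [IsEndSectionAt, isSectionAt_zero_twist_apply, isSectionAt_infty_twist_apply]
  refine ⟨fun ⟨h₀, h₁⟩ => ⟨.of fun i j => ⟨G i j, h₀ i j, h₁ i j⟩, rfl⟩, fun ⟨H, hH⟩ => ?_⟩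
  obtain rfl := (twist d).injective hH
  exact ⟨fun i j => (H i j).2.1, fun i j => (H i j).2.2⟩

theorem values_overNodeTwist (G : Matrix (Fin n) (Fin n) (overNode k)) :
    (matVal0 (overNodeTwist d G), matValInfty d (overNodeTwist d G)) = fiberValues G := by
  refine Prod.ext (Matrix.ext fun i j => val0_X_add_one_zpow_mul _ (G i j).2.1)
    (Matrix.ext fun i j => ?_)
  simp only [matValInfty, valInfty, Matrix.of_apply, overNodeTwist_apply,
    swap_X_zpow_neg_mul_X_add_one_zpow_mul]
  exact val0_X_add_one_zpow_mul _ (G i j).2.2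

variable {I : Subalgebra k (Matrix (Fin n) (Fin n) k × Matrix (Fin n) (Fin n) k)} {x : Point k}

theorem mem_orderStalk_node :
    M ∈ orderStalk d I .node ↔ M ∈ (I.comap fiberValues).map (overNodeTwist d) := by
  constructor
  · intro h
    obtain ⟨G, rfl⟩ := isEndSectionAt_zero_and_infty_iff.1 ⟨h.1 _ proj_zero, h.1 .infty rfl⟩
    have hval := h.2 rfl
    rw [values_overNodeTwist] at hval
    exact ⟨G, hval, rfl⟩
  · rintro ⟨G, hG, rfl⟩
    have hsec := isEndSectionAt_zero_and_infty_iff (d := d).2 ⟨G, rfl⟩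
    refine ⟨fun p hp => ?_, fun _ => ?_⟩
    · rcases proj_eq_node_iff.1 hp with rfl | rfl
      exacts [hsec.1, hsec.2]
    · exact Set.mem_of_eq_of_mem (values_overNodeTwist G) hG

theorem mem_orderStalk_of_fiberValues_eq_zero {G : Matrix (Fin n) (Fin n) (overNode k)}
    (hG : fiberValues G = 0) : overNodeTwist d G ∈ orderStalk d I .node :=
  mem_orderStalk_node.2 ⟨G, show fiberValues G ∈ I from hG ▸ I.zero_mem, rfl⟩

theorem conductorGen_smul_mem_orderStalk (G : Matrix (Fin n) (Fin n) (overNode k)) :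
    (conductorGen k : RatFunc k) • overNodeTwist d G ∈ orderStalk d I .node := by
  rw [← overNodeTwist_smul]
  refine mem_orderStalk_of_fiberValues_eq_zero (Prod.ext ?_ ?_) <;>
    exact Matrix.ext fun i j => by simp [fiberValues]

theorem mem_orderStalk_of_ne_node (hx : x ≠ .node) :
    M ∈ orderStalk d I x ↔ ∀ i j, M i j ∈ localRing x := by
  cases x with
  | node => exact absurd rfl hx
  | generic =>
    refine ⟨fun _ _ _ => mem_localRing_generic _, fun _ => ⟨fun p hp => ?_, nofun⟩⟩
    rw [proj_eq_generic_iff.1 hp]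
    exact fun _ _ => trivial
  | smooth a =>
    simp only [mem_localRing_smooth]
    refine ⟨fun h => h.1 _ (proj_eq_smooth_iff.2 rfl), fun h => ⟨fun p hp => ?_, nofun⟩⟩
    rw [proj_eq_smooth_iff.1 hp]
    exact h

theorem mem_orderStalk_generic (M : Matrix (Fin n) (Fin n) (RatFunc k)) :
    M ∈ orderStalk d I .generic :=
  (mem_orderStalk_of_ne_node (by simp)).2 fun _ _ => mem_localRing_generic _

theorem eventually_mem_orderStalk (hM : M ∈ orderStalk d I x) :
    ∀ᶠ y in 𝓝 x, M ∈ orderStalk d I y := by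
  refine eventually_nhds_of_generic ?_ hM
  filter_upwards [eventually_ne_node, eventually_all.2 fun i => eventually_all.2 fun j =>
    eventually_mem_localRing (mem_localRing_generic (M i j))] with y hy hMy
  exact (mem_orderStalk_of_ne_node hy).2 hMy

/-- The stalk of the order as a module over the local ring. -/
def orderSubmodule (d : Fin n → ℤ)
    (I : Subalgebra k (Matrix (Fin n) (Fin n) k × Matrix (Fin n) (Fin n) k)) (x : Point k) :
    Submodule (localRing x) (Matrix (Fin n) (Fin n) (RatFunc k)) where
  carrier := orderStalk d I x
  zero_mem' := zero_mem _
  add_mem' := add_mem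
  smul_mem' f M hM := by
    rw [Subring.smul_def, Matrix.smul_eq_diagonal_mul]
    exact mul_mem (scalar_mem_orderStalk d I x f.2) hM

theorem orderSubmodule_eq_span (hx : x ≠ .node) :
    orderSubmodule d I x =
      Submodule.span (localRing x)
        (Set.range fun p : Fin n × Fin n => Matrix.single p.1 p.2 1) := by
  refine le_antisymm (fun M hM => ?_) (Submodule.span_le.2 ?_)
  · rw [Matrix.matrix_eq_sum_single M]
    refine sum_mem fun i _ => sum_mem fun j _ => ?_
    have := Submodule.smul_mem _ (⟨M i j, (mem_orderStalk_of_ne_node hx).1 hM i j⟩ : localRing x)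
      (Submodule.subset_span (Set.mem_range_self
        (f := fun p : Fin n × Fin n => Matrix.single p.1 p.2 (1 : RatFunc k)) (i, j)))
    rwa [Subring.smul_def, Matrix.smul_single, smul_eq_mul, mul_one] at this
  · rintro _ ⟨p, rfl⟩
    refine (mem_orderStalk_of_ne_node hx).2 fun i j => ?_
    simp only [Matrix.single_apply]
    split_ifs
    exacts [one_mem _, zero_mem _]

theorem orderSubmodule_node_le_span :
    orderSubmodule d I .node ≤ Submodule.span (localRing (.node : Point k))
      (Set.range (fun p : Fin n × Fin n => twist d (Matrix.single p.1 p.2 1)) ∪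
        Set.range fun p : Fin n × Fin n =>
          twist d (Matrix.single p.1 p.2 (separator k : RatFunc k))) := by
  intro M hM
  obtain ⟨G, -, rfl⟩ := mem_orderStalk_node.1 hM
  change twist d (G.map Subtype.val) ∈ _
  rw [Matrix.matrix_eq_sum_single (G.map Subtype.val), map_sum]
  refine sum_mem fun i _ => ?_
  rw [map_sum]
  refine sum_mem fun j _ => ?_
  obtain ⟨α, β, hαβ⟩ := exists_eq_add_mul_separator (G i j)
  have hsingle : twist d (Matrix.single i j (G i j : RatFunc k)) =
      α • twist d (Matrix.single i j 1) +
        β • twist d (Matrix.single i j (separator k : RatFunc k)) := by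
    simp only [Subring.smul_def, ← map_smul, ← map_add, Matrix.smul_single, ← Matrix.single_add,
      smul_eq_mul, mul_one, hαβ]
  rw [Matrix.map_apply, hsingle]
  exact add_mem (Submodule.smul_mem _ _ (Submodule.subset_span (.inl ⟨(i, j), rfl⟩)))
    (Submodule.smul_mem _ _ (Submodule.subset_span (.inr ⟨(i, j), rfl⟩)))

theorem orderSubmodule_fg (x : Point k) : (orderSubmodule d I x).FG := by
  by_cases hx : x = .node
  · subst hx
    exact .of_le (Submodule.fg_span (Set.toFinite _)) orderSubmodule_node_le_span
  · exact orderSubmodule_eq_span (d := d) (I := I) hx ▸ Submodule.fg_span (Set.toFinite _)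

theorem exists_conductorGen_pow_smul_eq_overNodeTwist (M : Matrix (Fin n) (Fin n) (RatFunc k)) :
    ∃ (N : ℕ) (G : Matrix (Fin n) (Fin n) (overNode k)),
      (conductorGen k : RatFunc k) ^ N • M = overNodeTwist d G := by
  obtain ⟨H, rfl⟩ := (twist d).surjective M
  choose N hN using fun p : Fin n × Fin n => exists_conductorGen_pow_mul_mem (H p.1 p.2)
  have hsum (i j : Fin n) :
      (conductorGen k : RatFunc k) ^ (∑ p, N p) * H i j ∈ overNode k := by
    rw [← Finset.sum_erase_add _ _ (Finset.mem_univ (i, j)), pow_add, mul_assoc]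
    exact mul_mem (pow_mem (conductorGen k).2 _) (hN (i, j))
  exact ⟨∑ p, N p, .of fun i j => ⟨_, hsum i j⟩, (map_smul (twist d) _ H).symm⟩

theorem exists_smul_mem_orderSubmodule (x : Point k) (M : Matrix (Fin n) (Fin n) (RatFunc k)) :
    ∃ f : RatFunc k, f ≠ 0 ∧ f • M ∈ orderSubmodule d I x := by
  by_cases hx : x = .node
  · subst hx
    obtain ⟨N, G, hG⟩ := exists_conductorGen_pow_smul_eq_overNodeTwist (d := d) M
    refine ⟨_, pow_ne_zero (N + 1) coe_conductorGen_ne_zero, ?_⟩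
    rw [pow_succ', mul_smul, hG]
    exact conductorGen_smul_mem_orderStalk G
  · obtain ⟨f, hf, hfM⟩ :=
      exists_common_denominator_mem_localRing x fun p : Fin n × Fin n => M p.1 p.2
    exact ⟨f, hf, (mem_orderStalk_of_ne_node hx).2 fun i j => hfM (i, j)⟩

theorem exists_eventually_orderSubmodule_eq_span (x : Point k) :
    ∃ (N : ℕ) (r : Fin N → Matrix (Fin n) (Fin n) (RatFunc k)), ∀ᶠ y in 𝓝 x,
      orderSubmodule d I y = Submodule.span (localRing y) (Set.range r) :=
  exists_eventually_eq_span (orderSubmodule d I) exists_smul_mem_orderSubmodule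
    (eventually_ne_node.mono fun _ => orderSubmodule_eq_span) (orderSubmodule_fg x)

end

open SphericalOrder StalkwiseSheaf

/-! ### Sections of the structure sheaf and of the order -/

section Evaluation

variable {U V : Opens (nodalCurve k)} {x y : Point k}

/-- The germ at `x ∈ U` of a function, as a rational function. -/
noncomputable def fnEval (hx : x ∈ U) : Fn (nodalCurve k) U →+* RatFunc k :=
  (Pi.evalRingHom (fun _ : U => RatFunc k) ⟨x, hx⟩).comp
    (ringSections (X := TopCat.of (Point k)) localRing U).subtype

/-- The function on `U` given by a rational function. -/
noncomputable def constFn (f : RatFunc k) (hf : ∀ x ∈ U, f ∈ localRing x) : Fn (nodalCurve k) U :=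
  (⟨fun _ => f, pred_const hf⟩ : ringSections (X := TopCat.of (Point k)) localRing U)

theorem fnEval_constFn (hx : x ∈ U) {f : RatFunc k} (hf : ∀ x ∈ U, f ∈ localRing x) :
    fnEval hx (constFn f hf) = f := rfl

theorem fn_ext {f g : Fn (nodalCurve k) U} (h : ∀ x (hx : x ∈ U), fnEval hx f = fnEval hx g) :
    f = g :=
  Subtype.ext (funext fun x => h x.1 x.2)

theorem fnEval_eq (hx : x ∈ U) (hy : y ∈ U) (f : Fn (nodalCurve k) U) :
    fnEval hx f = fnEval hy f :=
  pred_apply_eq (X := TopCat.of (Point k)) (U := U) (f := f.1)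
    (S := fun x => (localRing x : Set (RatFunc k))) f.2 ⟨x, hx⟩ ⟨y, hy⟩

theorem fnEval_mem (hx : x ∈ U) (hy : y ∈ U) (f : Fn (nodalCurve k) U) :
    fnEval hx f ∈ localRing y :=
  fnEval_eq hx hy f ▸ f.2.2 ⟨y, hy⟩

theorem fnEval_injective (hx : x ∈ U) : Function.Injective (fnEval hx) := fun f g h =>
  fn_ext fun _ hy => (fnEval_eq hy hx f).trans (h.trans (fnEval_eq hx hy g))

variable {n : ℕ} {d : Fin n → ℤ}
  {I : Subalgebra k (Matrix (Fin n) (Fin n) k × Matrix (Fin n) (Fin n) k)}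

/-- The germ at `x ∈ U` of a section of the order, as a matrix of rational functions. -/
noncomputable def secEval (hx : x ∈ U) :
    (orderSheaf d I).Sections U →+* Matrix (Fin n) (Fin n) (RatFunc k) :=
  (Pi.evalRingHom (fun _ : U => Matrix (Fin n) (Fin n) (RatFunc k)) ⟨x, hx⟩).comp
    (ringSections (X := TopCat.of (Point k)) (orderStalk d I) U).subtype

/-- The section over `U` given by a matrix of rational functions. -/
noncomputable def constSec (M : Matrix (Fin n) (Fin n) (RatFunc k))
    (hM : ∀ x ∈ U, M ∈ orderStalk d I x) : (orderSheaf d I).Sections U :=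
  (⟨fun _ => M, pred_const hM⟩ : ringSections (X := TopCat.of (Point k)) (orderStalk d I) U)

theorem secEval_constSec (hx : x ∈ U) {M : Matrix (Fin n) (Fin n) (RatFunc k)}
    (hM : ∀ x ∈ U, M ∈ orderStalk d I x) : secEval hx (constSec M hM) = M := rfl

theorem secEval_res (h : V ≤ U) (hx : x ∈ V) (s : (orderSheaf d I).Sections U) :
    secEval hx ((orderSheaf d I).res h s) = secEval (h hx) s := rfl

theorem secEval_unitMap (hx : x ∈ U) (f : Fn (nodalCurve k) U) :
    secEval hx ((orderSheaf d I).unitMap U f) = Matrix.scalar (Fin n) (fnEval hx f) := rfl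

theorem sections_ext {s t : (orderSheaf d I).Sections U}
    (h : ∀ x (hx : x ∈ U), secEval hx s = secEval hx t) : s = t :=
  Subtype.ext (funext fun x => h x.1 x.2)

theorem secEval_eq (hx : x ∈ U) (hy : y ∈ U) (s : (orderSheaf d I).Sections U) :
    secEval hx s = secEval hy s :=
  pred_apply_eq (X := TopCat.of (Point k)) (U := U) (f := s.1)
    (S := fun x => (orderStalk d I x : Set (Matrix (Fin n) (Fin n) (RatFunc k)))) s.2
    ⟨x, hx⟩ ⟨y, hy⟩

theorem secEval_mem (hx : x ∈ U) (hy : y ∈ U) (s : (orderSheaf d I).Sections U) :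
    secEval hx s ∈ orderStalk d I y :=
  secEval_eq hx hy s ▸ s.2.2 ⟨y, hy⟩

theorem secEval_injective (hx : x ∈ U) : Function.Injective (secEval (d := d) (I := I) hx) :=
  fun s t h => sections_ext fun _ hy => (secEval_eq hy hx s).trans (h.trans (secEval_eq hx hy t))

/-- The germ at `x ∈ U` of a section of the underlying module of the order. -/
noncomputable def modEval (hx : x ∈ U) :
    Sec (orderSheaf d I).toModules U →ₛₗ[fnEval hx] Matrix (Fin n) (Fin n) (RatFunc k) where
  toFun s := secEval (d := d) (I := I) hx s
  map_add' _ _ := rfl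
  map_smul' f _ := (Matrix.smul_eq_diagonal_mul _ (fnEval hx f)).symm

theorem modEval_toSec (hx : x ∈ U) (s : (orderSheaf d I).Sections U) :
    modEval hx ((orderSheaf d I).toSec s) = secEval hx s := rfl

theorem modEval_res (h : V ≤ U) (hx : x ∈ V) (s : Sec (orderSheaf d I).toModules U) :
    modEval hx (Sec.res h s) = modEval (h hx) s := rfl

theorem modEval_eq (hx : x ∈ U) (hy : y ∈ U) (s : Sec (orderSheaf d I).toModules U) :
    modEval hx s = modEval hy s :=
  secEval_eq (d := d) (I := I) hx hy s

theorem modEval_mem (hx : x ∈ U) (s : Sec (orderSheaf d I).toModules U) :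
    modEval hx s ∈ orderSubmodule d I x :=
  secEval_mem (d := d) (I := I) hx hx s

theorem modEval_injective (hx : x ∈ U) : Function.Injective (modEval (d := d) (I := I) hx) :=
  secEval_injective hx

theorem isTorsionFree_order : IsTorsionFree (orderSheaf d I).toModules := by
  intro U f s h
  by_cases hU : ∃ x : Point k, x ∈ U
  · obtain ⟨x, hx⟩ := hU
    have heval := congrArg (modEval hx) h
    rw [map_smulₛₗ, map_zero, smul_eq_zero] at heval
    exact heval.imp ((map_eq_zero_iff _ (fnEval_injective hx)).1 ·)
      ((map_eq_zero_iff _ (modEval_injective hx)).1 ·)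
  · exact .inl (fn_ext fun x hx => absurd ⟨x, hx⟩ hU)

end Evaluation

/-! ### Coherence -/

section Coherence

variable {U : Opens (nodalCurve k)} {x : Point k}

theorem exists_eq_sum_fnEval_smul {V : Type*} [AddCommGroup V] [Module (RatFunc k) V]
    {ι : Type*} [Fintype ι] {g : ι → V} {v : V} (hx : x ∈ U)
    (hv : v ∈ Submodule.span (localRing x) (Set.range g)) :
    ∃ (W : Opens (nodalCurve k)) (_ : W ≤ U) (hxW : x ∈ W) (b : ι → Fn (nodalCurve k) W),
      ∑ i, fnEval hxW (b i) • g i = v := by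
  obtain ⟨b, rfl⟩ := (Submodule.mem_span_range_iff_exists_fun _).1 hv
  obtain ⟨W, hWU, hxW, hW⟩ := exists_opens_of_eventually hx
    (eventually_all.2 fun i => eventually_mem_localRing (b i).2)
  exact ⟨W, hWU, hxW, fun i => constFn (b i) fun y hy => hW y hy i, rfl⟩

variable {n : ℕ} {d : Fin n → ℤ}
  {I : Subalgebra k (Matrix (Fin n) (Fin n) k × Matrix (Fin n) (Fin n) k)}

theorem isFiniteType_order : IsFiniteType (orderSheaf d I).toModules := by
  intro (y : Point k)
  obtain ⟨N, r, hr⟩ := exists_eventually_orderSubmodule_eq_span (d := d) (I := I) y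
  obtain ⟨U, -, hyU, hU⟩ := exists_opens_of_eventually (U := ⊤) trivial hr
  have hrU (l : Fin N) (x : Point k) (hx : x ∈ U) : r l ∈ orderSubmodule d I x :=
    hU x hx ▸ Submodule.subset_span ⟨l, rfl⟩
  refine ⟨U, N, fun l => (orderSheaf d I).toSec (constSec (r l) (hrU l)), hyU, ?_⟩
  intro V hV s (z : Point k) hz
  obtain ⟨W, hWV, hzW, b, hb⟩ := exists_eq_sum_fnEval_smul hz (hU z (hV hz) ▸ modEval_mem hz s)
  refine ⟨W, hWV, hzW, (Submodule.mem_span_range_iff_exists_fun _).2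
    ⟨b, modEval_injective hzW ?_⟩⟩
  rw [map_sum, modEval_res, ← hb]
  exact Finset.sum_congr rfl fun l _ => map_smulₛₗ ..

/-- The vectors of a subspace whose coordinates are all regular at `x`. -/
def regularVectors {ι : Type*} (K : Submodule (RatFunc k) (ι → RatFunc k)) (x : Point k) :
    Submodule (localRing x) K where
  carrier := {c | ∀ i, c.1 i ∈ localRing x}
  zero_mem' _ := zero_mem _
  add_mem' h h' i := add_mem (h i) (h' i)
  smul_mem' f _ h i := mul_mem f.2 (h i)

theorem exists_eventually_regularVectors_eq_span {ι : Type*} [Finite ι]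
    (K : Submodule (RatFunc k) (ι → RatFunc k)) (x : Point k) :
    ∃ (N : ℕ) (r : Fin N → K), ∀ᶠ y in 𝓝 x,
      regularVectors K y = Submodule.span (localRing y) (Set.range r) := by
  classical
  have := Fintype.ofFinite ι
  obtain ⟨q, hq⟩ := K.subtype.exists_leftInverse_of_injective (Submodule.ker_subtype _)
  have hle (y : Point k) : regularVectors K y ≤
      Submodule.span (localRing y) (Set.range fun i => q (Pi.single i 1)) := by
    intro c hc
    have hqc : ∑ i, c.1 i • q (Pi.single i 1) = c := by
      simp only [← map_smul, ← map_sum, ← pi_eq_sum_univ' c.1]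
      exact LinearMap.congr_fun hq c
    rw [← hqc]
    exact sum_mem fun i _ => Submodule.smul_mem _ (⟨c.1 i, hc i⟩ : localRing y)
      (Submodule.subset_span ⟨i, rfl⟩)
  refine exists_eventually_eq_span (v := fun i => q (Pi.single i 1)) (regularVectors K)
    (fun y c => ?_) ?_ (.of_le (Submodule.fg_span (Set.finite_range _)) (hle x))
  · obtain ⟨f, hf, hfc⟩ := exists_common_denominator_mem_localRing y c.1
    exact ⟨f, hf, hfc⟩
  · filter_upwards [eventually_all.2 fun i => eventually_all.2 fun j =>
      eventually_mem_localRing (mem_localRing_generic ((q (Pi.single i 1)).1 j))] with y hy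
    exact (hle y).antisymm (Submodule.span_le.2 (Set.range_subset_iff.2 hy))

theorem exists_generatesRelations {N : ℕ} (s : Fin N → Sec (orderSheaf d I).toModules U)
    (hx : x ∈ U) :
    ∃ (V : Opens (nodalCurve k)) (hV : V ≤ U) (m : ℕ) (r : Fin m → Fin N → Fn (nodalCurve k) V),
      x ∈ V ∧ GeneratesRelations (orderSheaf d I).toModules (fun i => Sec.res hV (s i)) r := by
  let φ := Fintype.linearCombination (RatFunc k) fun i => modEval hx (s i)
  have modEval_sum {V : Opens (nodalCurve k)} (hV : V ≤ U) {z : Point k} (hz : z ∈ V)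
      (c : Fin N → Fn (nodalCurve k) V) :
      modEval hz (∑ i, c i • Sec.res hV (s i)) = φ fun i => fnEval hz (c i) := by
    rw [map_sum]
    refine Finset.sum_congr rfl fun i _ => ?_
    rw [map_smulₛₗ, modEval_res, modEval_eq (hV hz) hx]
  obtain ⟨m, r, hr⟩ := exists_eventually_regularVectors_eq_span (LinearMap.ker φ) x
  obtain ⟨V, hVU, hxV, hV⟩ := exists_opens_of_eventually hx hr
  have hrV (j : Fin m) (y : Point k) (hy : y ∈ V) : r j ∈ regularVectors (LinearMap.ker φ) y :=
    hV y hy ▸ Submodule.subset_span ⟨j, rfl⟩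
  refine ⟨V, hVU, m, fun j i => constFn ((r j).1 i) fun y hy => hrV j y hy i, hxV,
    fun j => modEval_injective hxV ?_, fun W hW c hc (z : Point k) hz => ?_⟩
  · rw [modEval_sum, map_zero]
    exact (r j).2
  have hc_ker : (fun i => fnEval hz (c i)) ∈ LinearMap.ker φ := by
    rw [LinearMap.mem_ker, ← modEval_sum (hW.trans hVU) hz]
    exact (congrArg (modEval hz) hc).trans (map_zero _)
  have hc_regular : (⟨_, hc_ker⟩ : LinearMap.ker φ) ∈ regularVectors (LinearMap.ker φ) z :=
    fun i => fnEval_mem hz hz (c i)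
  have hc_span := hV z (hW hz) ▸ hc_regular
  obtain ⟨W', hW', hzW', b, hb⟩ := exists_eq_sum_fnEval_smul hz hc_span
  refine ⟨W', hW', hzW', (Submodule.mem_span_range_iff_exists_fun _).2
    ⟨b, funext fun i => fnEval_injective hzW' ?_⟩⟩
  have hbi := congrFun (congrArg Subtype.val hb) i
  simp only [Submodule.coe_sum, Finset.sum_apply] at hbi
  rw [Finset.sum_apply, map_sum]
  exact hbi

theorem isCoherent_order : IsCoherent (orderSheaf d I).toModules :=
  ⟨isFiniteType_order, fun _ _ s _ hx => exists_generatesRelations s hx⟩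

end Coherence

end NodalCurve

theorem exists_stalk_iso {C : Type*} [Category.{u} C] [Limits.HasColimits C] {FC : C → C → Type*}
    {CC : C → Type u} [∀ A B, FunLike (FC A B) (CC A) (CC B)] [ConcreteCategory.{u} C FC]
    [Limits.PreservesFilteredColimits (forget C)] [(forget C).ReflectsIsomorphisms]
    {X : TopCat.{u}} (F : X.Presheaf C) (x : X) {A : C}
    (φ : ∀ U : Opens X, x ∈ U → (F.obj (op U) ⟶ A))
    (hres : ∀ (U V : Opens X) (i : V ⟶ U) (hV : x ∈ V), F.map i.op ≫ φ V hV = φ U (i.le hV))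
    (hinj : ∀ U hU, Function.Injective (φ U hU))
    (hsurj : ∀ a : ToType A, ∃ U hU s, φ U hU s = a) :
    ∃ ψ : F.stalk x ≅ A, ∀ U hU, F.germ U x hU ≫ ψ.hom = φ U hU := by
  let ψ : F.stalk x ⟶ A := Limits.colimit.desc ((OpenNhds.inclusion x).op ⋙ F) ⟨A,
    { app := fun U => φ U.unop.1 U.unop.2
      naturality := fun U V i =>
        (hres _ _ ((OpenNhds.inclusion x).map i.unop) V.unop.2).trans (Category.comp_id _).symm }⟩
  have hψ (U : Opens X) (hU : x ∈ U) : F.germ U x hU ≫ ψ = φ U hU :=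
    Limits.colimit.ι_desc (F := (OpenNhds.inclusion x).op ⋙ F) _ _
  have hψ_apply (U : Opens X) (hU : x ∈ U) (s) : ψ (F.germ U x hU s) = φ U hU s := by
    rw [← hψ, ConcreteCategory.comp_apply]
  have hψ_bijective : Function.Bijective ψ := by
    refine ⟨fun a b hab => ?_, fun a => ?_⟩
    · obtain ⟨U, hU, s, rfl⟩ := F.exists_germ_eq a
      obtain ⟨V, hV, t, rfl⟩ := F.exists_germ_eq b
      have hUV : x ∈ U ⊓ V := ⟨hU, hV⟩
      rw [← F.germ_res_apply (Opens.infLELeft U V) x hUV,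
        ← F.germ_res_apply (Opens.infLERight U V) x hUV] at hab ⊢
      exact congrArg _ (hinj _ hUV ((hψ_apply _ hUV _).symm.trans (hab.trans (hψ_apply _ hUV _))))
    · obtain ⟨U, hU, s, rfl⟩ := hsurj a
      exact ⟨_, hψ_apply U hU s⟩
  have := (ConcreteCategory.isIso_iff_bijective ψ).2 hψ_bijective
  exact ⟨asIso ψ, hψ⟩

namespace NodalCurve

open SphericalOrder StalkwiseSheaf

variable {k : Type u} [Field k] {n : ℕ} {d : Fin n → ℤ}
  {I : Subalgebra k (Matrix (Fin n) (Fin n) k × Matrix (Fin n) (Fin n) k)}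

/-! ### The generic stalk and the center -/

section Generic

theorem isGenericPoint_generic : IsGenericPoint (Point.generic : nodalCurve k) Set.univ :=
  Set.eq_univ_of_forall fun _ => mem_closure_iff.2 fun W hW hx =>
    ⟨_, generic_mem_of_mem (U := ⟨W, hW⟩) hx, rfl⟩

theorem exists_stalk_generic_equiv :
    ∃ e : (nodalCurve k).presheaf.stalk (Point.generic : nodalCurve k) ≃+* RatFunc k,
      ∀ (U : Opens (nodalCurve k)) (hU : (Point.generic : Point k) ∈ U) (f : Fn (nodalCurve k) U),
        e (((nodalCurve k).presheaf.germ U (Point.generic : nodalCurve k) hU).hom f) =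
          fnEval hU f := by
  have hsurj (f : RatFunc k) :
      ∃ (U : Opens (nodalCurve k)) (hU : (Point.generic : Point k) ∈ U) (g : Fn (nodalCurve k) U),
        fnEval hU g = f := by
    obtain ⟨U, -, hU, hf⟩ := exists_opens_of_eventually (U := ⊤) trivial
      (eventually_mem_localRing (mem_localRing_generic f))
    exact ⟨U, hU, constFn f hf, fnEval_constFn hU hf⟩
  obtain ⟨ψ, hψ⟩ := exists_stalk_iso (nodalCurve k).presheaf (Point.generic : Point k)
    (A := CommRingCat.of (RatFunc k)) (fun U hU => CommRingCat.ofHom (fnEval hU))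
    (fun _ _ _ _ => rfl) (fun _ hU => fnEval_injective hU) hsurj
  exact ⟨ψ.commRingCatIsoToRingEquiv, fun U hU f => congrArg (fun g => g.hom f) (hψ U hU)⟩

theorem exists_secEval_eq {U : Opens (nodalCurve k)} (hU : (.generic : Point k) ∈ U)
    (M : Matrix (Fin n) (Fin n) (RatFunc k)) :
    ∃ (V : Opens (nodalCurve k)) (_ : V ≤ U) (hV : (.generic : Point k) ∈ V)
      (s : (orderSheaf d I).Sections V), secEval hV s = M := by
  obtain ⟨V, hVU, hgV, hV⟩ := exists_opens_of_eventually hU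
    (eventually_mem_orderStalk (d := d) (I := I) (mem_orderStalk_generic M))
  exact ⟨V, hVU, hgV, constSec M hV, secEval_constSec hgV hV⟩

theorem exists_order_stalk_generic_equiv :
    ∃ e : (TopCat.Presheaf.stalk (orderSheaf d I).sheaf.obj (Point.generic : nodalCurve k) :
        RingCat.{u}) ≃+* Matrix (Fin n) (Fin n) (RatFunc k),
      ∀ (U : Opens (nodalCurve k)) (hU : (Point.generic : Point k) ∈ U)
        (s : (orderSheaf d I).Sections U),
        e ((TopCat.Presheaf.germ (orderSheaf d I).sheaf.obj U
          (Point.generic : nodalCurve k) hU).hom s) = secEval hU s := by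
  have hsurj (M : Matrix (Fin n) (Fin n) (RatFunc k)) :
      ∃ (U : Opens (nodalCurve k)) (hU : (Point.generic : Point k) ∈ U)
        (s : (orderSheaf d I).Sections U), secEval hU s = M := by
    obtain ⟨U, -, hU, s, hs⟩ := exists_secEval_eq (d := d) (I := I) (U := ⊤) trivial M
    exact ⟨U, hU, s, hs⟩
  obtain ⟨ψ, hψ⟩ := exists_stalk_iso (orderSheaf d I).sheaf.obj (Point.generic : Point k)
    (A := RingCat.of (Matrix (Fin n) (Fin n) (RatFunc k)))
    (fun U hU => RingCat.ofHom (secEval hU))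
    (fun _ _ _ _ => rfl) (fun _ hU => secEval_injective hU) hsurj
  exact ⟨ψ.ringCatIsoToRingEquiv, fun U hU s => congrArg (fun g => g.hom s) (hψ U hU)⟩

theorem isOrder_order [NeZero n] : IsOrder (orderSheaf d I) where
  coherent := isCoherent_order
  torsionFree := isTorsionFree_order
  generic := by
    obtain ⟨e, he⟩ := exists_stalk_generic_equiv (k := k)
    obtain ⟨e', he'⟩ := exists_order_stalk_generic_equiv (d := d) (I := I)
    refine ⟨(.generic : Point k), isGenericPoint_generic, e.toMulEquiv.isField (Field.toIsField _),
      n, e'.trans e.symm.mapMatrix, Nat.pos_of_neZero n, fun U hU f => ?_⟩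
    refine (congrArg e.symm.mapMatrix (he' U hU ((orderSheaf d I).unitMap U f))).trans ?_
    rw [secEval_unitMap, ← he U hU f, Matrix.scalar_apply, Matrix.scalar_apply,
      RingEquiv.mapMatrix_apply, Matrix.diagonal_map (map_zero _)]
    simp only [RingEquiv.symm_apply_apply]

end Generic

section Center

theorem exists_scalar_eq_secEval {U : Opens (nodalCurve k)} (hU : (.generic : Point k) ∈ U)
    {z : (orderSheaf d I).Sections U}
    (hz : ∀ (V : Opens (nodalCurve k)) (hV : V ≤ U) (a : (orderSheaf d I).Sections V),
      (orderSheaf d I).res hV z * a = a * (orderSheaf d I).res hV z) :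
    ∃ f : RatFunc k, Matrix.scalar (Fin n) f = secEval hU z := by
  refine Matrix.mem_range_scalar_of_commute_single fun i j _ => ?_
  obtain ⟨W, hWU, hgW, s, hs⟩ :=
    exists_secEval_eq (d := d) (I := I) hU (Matrix.single i j (1 : RatFunc k))
  have hcomm := congrArg (secEval hgW) (hz W hWU s)
  rw [map_mul, map_mul, hs] at hcomm
  exact hcomm.symm

variable [NeZero n]

theorem mem_localRing_of_scalar_mem_orderStalk
    (hI : ∀ a b : k, (algebraMap k (Matrix (Fin n) (Fin n) k) a,
      algebraMap k (Matrix (Fin n) (Fin n) k) b) ∈ I → a = b)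
    {x : Point k} {f : RatFunc k} (h : Matrix.scalar (Fin n) f ∈ orderStalk d I x) :
    f ∈ localRing x := by
  by_cases hx : x = .node
  · subst hx
    obtain ⟨G, hG, hGf⟩ := mem_orderStalk_node.1 h
    have hG_apply (i j : Fin n) : (G i j : RatFunc k) = Matrix.scalar (Fin n) f i j :=
      congrFun₂ ((twist d).injective (hGf.trans ((twist d).commutes f).symm)) i j
    have hG00 : (G 0 0 : RatFunc k) = f := by rw [hG_apply]; simp
    have hG_scalar : G = Matrix.scalar (Fin n) (G 0 0) := by
      refine Matrix.ext fun i j => Subtype.ext ?_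
      rcases eq_or_ne i j with rfl | hij <;> simp [*]
    have hval : fiberValues G =
        (algebraMap k _ (evalZero (G 0 0)), algebraMap k _ (evalInfty (G 0 0))) := by
      rw [hG_scalar]
      exact Prod.ext (Matrix.diagonal_map (map_zero evalZero))
        (Matrix.diagonal_map (map_zero evalInfty))
    rw [← hG00]
    exact coe_mem_localRing_node.2 (hI _ _ (hval ▸ hG))
  · have := (mem_orderStalk_of_ne_node hx).1 h 0 0
    rwa [Matrix.scalar_apply, Matrix.diagonal_apply_eq] at this

theorem centerIsStructureSheaf_order
    (hI : ∀ a b : k, (algebraMap k (Matrix (Fin n) (Fin n) k) a,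
      algebraMap k (Matrix (Fin n) (Fin n) k) b) ∈ I → a = b) :
    CenterIsStructureSheaf (orderSheaf d I) := by
  refine fun U => ⟨fun f g h => fn_ext fun x hx => Matrix.scalar_inj.1 (congrArg (secEval hx) h),
    Set.Subset.antisymm ?_ fun z hz => ?_⟩
  · rintro _ ⟨f, rfl⟩ V hV a
    exact (orderSheaf d I).central V (Fn.res hV f) a
  · by_cases hU : ∃ x : Point k, x ∈ U
    · obtain ⟨x, hx⟩ := hU
      have hg : (.generic : Point k) ∈ U := generic_mem_of_mem hx
      obtain ⟨f, hf⟩ := exists_scalar_eq_secEval hg hz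
      refine ⟨constFn f fun y hy => mem_localRing_of_scalar_mem_orderStalk hI
        (hf ▸ secEval_mem hg hy z), secEval_injective hg ?_⟩
      rw [secEval_unitMap, fnEval_constFn, hf]
    · exact ⟨0, sections_ext fun x hx => absurd ⟨x, hx⟩ hU⟩

end Center

/-! ### The dualizing sheaf -/

section Dualizing

-- `dt / t` generates the dualizing sheaf.
theorem isDualizingAt_mul_inv_X_iff {x : Point k} {f : RatFunc k} :
    IsDualizingAt x (f * RatFunc.X⁻¹) ↔ f ∈ localRing x := by
  have hX := RatFunc.X_ne_zero (K := k)
  cases x with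
  | generic => exact ⟨fun _ => mem_localRing_generic f, fun _ => trivial⟩
  | smooth a =>
    rw [mem_localRing_smooth]
    refine ⟨fun h => ?_, fun h => RegularAt.mul h ?_⟩
    · have hmul := RegularAt.mul h (regularAt_X (a : k))
      rwa [inv_mul_cancel_right₀ hX] at hmul
    · simpa using regularAt_algebraMap_div (a := (a : k)) 1 (q := Polynomial.X) (by simp)
  | node =>
    have hzero : RatFunc.X * (f * RatFunc.X⁻¹) = f := by field_simp
    have hinfty : RatFunc.X * coeffInfty (f * RatFunc.X⁻¹) = -swap k f := by
      rw [coeffInfty, map_mul, map_inv₀, swap_X, inv_inv]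
      field_simp
    rw [IsDualizingAt, hzero, hinfty, mem_localRing_node]
    refine ⟨fun ⟨h₀, h₁, h⟩ => ?_, fun ⟨⟨h₀, h₁⟩, h⟩ =>
      ⟨h₀, RegularAt.neg h₁, ?_⟩⟩
    · have h₁' : RegularAt 0 (swap k f) := neg_neg (swap k f) ▸ h₁.neg
      rw [val0_neg h₁'] at h
      exact ⟨⟨h₀, h₁'⟩, add_neg_eq_zero.1 h⟩
    · refine (congrArg _ (val0_neg h₁)).trans ?_
      exact add_neg_eq_zero.2 h

variable {U V : Opens (nodalCurve k)} {x y : Point k}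

/-- The germ at `x ∈ U` of a section of the dualizing sheaf, as a rational differential divided by
`dt`. -/
noncomputable def dualEval (hx : x ∈ U) : Sec (dualizingSheaf k) U →ₛₗ[fnEval hx] RatFunc k where
  toFun s := (Subtype.val (p := (· ∈ addSections (X := TopCat.of (Point k)) dualizingStalk U)) s)
    ⟨x, hx⟩
  map_add' _ _ := rfl
  map_smul' _ _ := rfl

theorem dual_ext {s t : Sec (dualizingSheaf k) U}
    (h : ∀ x (hx : x ∈ U), dualEval hx s = dualEval hx t) : s = t :=
  Subtype.ext (p := (· ∈ addSections (X := TopCat.of (Point k)) dualizingStalk U))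
    (funext fun x => h x.1 x.2)

theorem dualEval_eq (hx : x ∈ U) (hy : y ∈ U) (s : Sec (dualizingSheaf k) U) :
    dualEval hx s = dualEval hy s :=
  pred_apply_eq (X := TopCat.of (Point k)) (U := U)
    (S := fun x => (dualizingStalk x : Set (RatFunc k)))
    (Subtype.property (p := (· ∈ addSections (X := TopCat.of (Point k)) dualizingStalk U)) s)
    ⟨x, hx⟩ ⟨y, hy⟩

theorem isDualizingAt_dualEval (hx : x ∈ U) (s : Sec (dualizingSheaf k) U) :
    IsDualizingAt x (dualEval hx s) :=
  (Subtype.property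
    (p := (· ∈ addSections (X := TopCat.of (Point k)) dualizingStalk U)) s).2 ⟨x, hx⟩

end Dualizing

/-! ### The trace form -/

section Trace

theorem trace_overNodeTwist (G : Matrix (Fin n) (Fin n) (overNode k)) :
    (overNodeTwist d G).trace = (G.trace : overNode k) :=
  (trace_twist d _).trans (AddMonoidHom.map_trace (overNode k).val.toAddMonoidHom G).symm

theorem trace_overNodeTwist_mem_localRing_iff {G : Matrix (Fin n) (Fin n) (overNode k)} :
    (overNodeTwist d G).trace ∈ localRing (.node : Point k) ↔
      (fiberValues G).1.trace = (fiberValues G).2.trace := by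
  rw [trace_overNodeTwist, coe_mem_localRing_node]
  have h (φ : overNode k →ₐ[k] k) : φ G.trace = (φ.mapMatrix G).trace :=
    AddMonoidHom.map_trace φ.toAddMonoidHom G
  rw [h, h]
  rfl

theorem fiberValues_surjective :
    Function.Surjective (fiberValues : Matrix (Fin n) (Fin n) (overNode k) →ₐ[k] _) := by
  rintro ⟨a, b⟩
  choose G hG₀ hG₁ using fun i j => exists_evalZero_eq_and_evalInfty_eq (a i j) (b i j)
  exact ⟨.of G, Prod.ext (Matrix.ext hG₀) (Matrix.ext hG₁)⟩

theorem mem_overNode_of_forall_mul_mem {f : RatFunc k}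
    (h : ∀ g : overNode k, (conductorGen k * g : overNode k) * f ∈ localRing (.node : Point k)) :
    f ∈ overNode k := by
  have hf : (conductorGen k : RatFunc k) * f ∈ localRing (.node : Point k) := by simpa using h 1
  obtain ⟨hu, hu_eq⟩ := mem_localRing_node.1 hf
  set u : overNode k := ⟨_, hu⟩
  have hu_sep : ((u * separator k : overNode k) : RatFunc k) ∈ localRing (.node : Point k) := by
    simpa [u, mul_right_comm] using h (separator k)
  have hu₀ : evalZero u = 0 := by simpa using coe_mem_localRing_node.1 hu_sep
  have hu_div := div_conductorGen_mem hu₀ (hu_eq ▸ hu₀)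
  rwa [mul_div_cancel_left₀ _ (coe_conductorGen_ne_zero (k := k))] at hu_div

theorem trace_mem_localRing (hI : ∀ p ∈ I, p.1.trace = p.2.trace) {x : Point k}
    {M : Matrix (Fin n) (Fin n) (RatFunc k)} (hM : M ∈ orderStalk d I x) :
    M.trace ∈ localRing x := by
  by_cases hx : x = .node
  · subst hx
    obtain ⟨G, hG, rfl⟩ := mem_orderStalk_node.1 hM
    exact trace_overNodeTwist_mem_localRing_iff.2 (hI _ hG)
  · exact sum_mem fun i _ => (mem_orderStalk_of_ne_node hx).1 hM i i

theorem exists_overNodeTwist_eq_of_trace_mul_mem {Y : Matrix (Fin n) (Fin n) (RatFunc k)}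
    (hY : ∀ M ∈ orderStalk d I .node, (M * Y).trace ∈ localRing (.node : Point k)) :
    ∃ H, overNodeTwist d H = Y := by
  obtain ⟨H, rfl⟩ := (twist d).surjective Y
  have hH (j i : Fin n) : H j i ∈ overNode k := by
    refine mem_overNode_of_forall_mul_mem fun g => ?_
    have htrace := hY _ (conductorGen_smul_mem_orderStalk (I := I) (Matrix.single i j g))
    have hsingle : overNodeTwist d (Matrix.single i j g) =
        twist d (Matrix.single i j (g : RatFunc k)) :=
      congrArg (twist d) (Matrix.map_single i j g (overNode k).val)
    rwa [hsingle, smul_mul_assoc, ← map_mul, Matrix.trace_smul, trace_twist,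
      Matrix.trace_single_mul, smul_eq_mul, smul_eq_mul, ← mul_assoc] at htrace
  exact ⟨.of fun j i => ⟨H j i, hH j i⟩, rfl⟩

theorem mem_orderStalk_of_trace_mul_mem
    (hI : ∀ q : Matrix (Fin n) (Fin n) k × Matrix (Fin n) (Fin n) k,
      (∀ p ∈ I, (p.1 * q.1).trace = (p.2 * q.2).trace) → q ∈ I)
    {x : Point k} {Y : Matrix (Fin n) (Fin n) (RatFunc k)}
    (hY : ∀ M ∈ orderStalk d I x, (M * Y).trace ∈ localRing x) : Y ∈ orderStalk d I x := by
  by_cases hx : x = .node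
  · subst hx
    obtain ⟨H, rfl⟩ := exists_overNodeTwist_eq_of_trace_mul_mem hY
    refine mem_orderStalk_node.2 ⟨H, hI _ fun p hp => ?_, rfl⟩
    obtain ⟨G, rfl⟩ := fiberValues_surjective p
    have htrace := hY _ (mem_orderStalk_node.2 ⟨G, hp, rfl⟩)
    change (overNodeTwist d G * overNodeTwist d H).trace ∈ _ at htrace
    rw [← map_mul, trace_overNodeTwist_mem_localRing_iff, map_mul] at htrace
    exact htrace
  · refine (mem_orderStalk_of_ne_node hx).2 fun j i => ?_
    have hsingle : Matrix.single i j (1 : RatFunc k) ∈ orderStalk d I x := by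
      refine (mem_orderStalk_of_ne_node hx).2 fun i' j' => ?_
      rw [Matrix.single_apply]
      split
      exacts [one_mem _, zero_mem _]
    have htrace := hY _ hsingle
    rwa [Matrix.trace_single_mul, one_smul] at htrace

/-- The morphism `a ↦ tr(a) dt / t` from the order to the dualizing sheaf. -/
noncomputable def traceHom (hI : ∀ p ∈ I, p.1.trace = p.2.trace) :
    SheafOfModules.Hom (orderSheaf d I).toModules (dualizingSheaf k) where
  val := PresheafOfModules.homMk
    { app := fun U => AddCommGrpCat.ofHom
        { toFun := fun s => (⟨fun x => (s.1 x).trace * RatFunc.X⁻¹,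
            s.2.1.comp fun M => M.trace * RatFunc.X⁻¹,
            fun x => isDualizingAt_mul_inv_X_iff.2 (trace_mem_localRing hI (s.2.2 x))⟩ :
            addSections (X := TopCat.of (Point k)) dualizingStalk U.unop)
          map_zero' := Subtype.ext (funext fun x => by
            change (0 : Matrix (Fin n) (Fin n) (RatFunc k)).trace * RatFunc.X⁻¹ = 0
            rw [Matrix.trace_zero, zero_mul])
          map_add' := fun s t => Subtype.ext (funext fun x => by
            change (s.1 x + t.1 x).trace * RatFunc.X⁻¹ = _
            rw [Matrix.trace_add, add_mul]; rfl) }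
      naturality := fun _ _ _ => rfl }
    (fun U f s => Subtype.ext (funext fun x => by
      change (Matrix.scalar (Fin n) (f.1 x) * s.1 x).trace * RatFunc.X⁻¹ =
        f.1 x * ((s.1 x).trace * RatFunc.X⁻¹)
      rw [Matrix.scalar_apply, ← Matrix.smul_eq_diagonal_mul, Matrix.trace_smul, smul_eq_mul,
        mul_assoc]))

theorem dualEval_traceHom (hI : ∀ p ∈ I, p.1.trace = p.2.trace) {U : Opens (nodalCurve k)}
    {x : Point k} (hx : x ∈ U) (s : Sec (orderSheaf d I).toModules U) :
    dualEval hx (Sec.map (traceHom hI) U s) = (modEval hx s).trace * RatFunc.X⁻¹ := rfl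

theorem dualEval_traceHom_mul (hI : ∀ p ∈ I, p.1.trace = p.2.trace) {U : Opens (nodalCurve k)}
    {x : Point k} (hx : x ∈ U) (s t : (orderSheaf d I).Sections U) :
    dualEval hx (Sec.map (traceHom hI) U ((orderSheaf d I).toSec (s * t))) =
      (secEval hx s * secEval hx t).trace * RatFunc.X⁻¹ := rfl

end Trace

end NodalCurve

theorem exists_eq_trace_mul {R : Type*} [CommRing R] {n : Type*} [Fintype n]
    (Λ : Matrix n n R →ₗ[R] R) : ∃ Y : Matrix n n R, ∀ M, Λ M = (M * Y).trace := by
  classical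
  let Y : Matrix n n R := .of fun j i => Λ (Matrix.single i j 1)
  have hΛ : Λ = (Matrix.traceLinearMap n R R).comp (LinearMap.mulRight R Y) :=
    Matrix.ext_linearMap _ fun i j => LinearMap.ext_ring <| by
      simp [Y, Matrix.trace_single_mul]
  exact ⟨Y, fun M => congrArg (· M) hΛ⟩

namespace NodalCurve

open SphericalOrder StalkwiseSheaf

variable {k : Type u} [Field k] {n : ℕ} {d : Fin n → ℤ}
  {I : Subalgebra k (Matrix (Fin n) (Fin n) k × Matrix (Fin n) (Fin n) k)}

/-! ### Duality -/

section Duality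

variable {U V W : Opens (nodalCurve k)}

theorem dualEval_app_eq_of_modEval_eq
    (φ : LocalHom (orderSheaf d I).toModules (dualizingSheaf k) U) (hV : V ≤ U) (hW : W ≤ U)
    {x y : Point k} (hx : x ∈ V) (hy : y ∈ W) {s : Sec (orderSheaf d I).toModules V}
    {t : Sec (orderSheaf d I).toModules W} (h : modEval hx s = modEval hy t) :
    dualEval hx (φ.app V hV s) = dualEval hy (φ.app W hW t) := by
  have hg : (.generic : Point k) ∈ V ⊓ W := ⟨generic_mem_of_mem hx, generic_mem_of_mem hy⟩
  have hres : Sec.res (inf_le_left : V ⊓ W ≤ V) s = Sec.res (inf_le_right : V ⊓ W ≤ W) t :=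
    modEval_injective hg <| (modEval_eq hg.1 hx s).trans (h.trans (modEval_eq hy hg.2 t))
  have happ := (φ.naturality V _ hV inf_le_left s).symm.trans
    ((congrArg (φ.app (V ⊓ W) _) hres).trans (φ.naturality W _ hW inf_le_right t))
  exact (dualEval_eq hx hg.1 _).trans
    ((congrArg (dualEval hg) happ).trans (dualEval_eq hg.2 hy _))

theorem exists_linearMap_dualEval_app
    (φ : LocalHom (orderSheaf d I).toModules (dualizingSheaf k) U)
    (hU : (.generic : Point k) ∈ U) :
    ∃ Λ : Matrix (Fin n) (Fin n) (RatFunc k) →ₗ[RatFunc k] RatFunc k,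
      ∀ (V : Opens (nodalCurve k)) (hV : V ≤ U) (x : Point k) (hx : x ∈ V)
        (s : Sec (orderSheaf d I).toModules V),
        dualEval hx (φ.app V hV s) = Λ (modEval hx s) := by
  choose W hWU hgW r hr using exists_secEval_eq (d := d) (I := I) hU
  let Λ M := dualEval (hgW M) (φ.app (W M) (hWU M) ((orderSheaf d I).toSec (r M)))
  have hΛ (V : Opens (nodalCurve k)) (hV : V ≤ U) (x : Point k) (hx : x ∈ V)
      (s : Sec (orderSheaf d I).toModules V) :
      dualEval hx (φ.app V hV s) = Λ (modEval hx s) :=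
    dualEval_app_eq_of_modEval_eq φ hV (hWU _) hx (hgW _) (hr _).symm
  refine ⟨⟨⟨Λ, fun M N => ?_⟩, fun f M => ?_⟩, hΛ⟩
  · have hg : (.generic : Point k) ∈ W M ⊓ W N := ⟨hgW M, hgW N⟩
    have hadd := hΛ _ (inf_le_left.trans (hWU M)) _ hg
      (Sec.res inf_le_left ((orderSheaf d I).toSec (r M)) +
        Sec.res inf_le_right ((orderSheaf d I).toSec (r N)))
    rw [map_add, map_add, map_add, hΛ, hΛ, modEval_res, modEval_res, modEval_toSec, modEval_toSec,
      hr, hr] at hadd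
    exact hadd.symm
  · obtain ⟨V, hVW, hgV, hV⟩ := exists_opens_of_eventually (hgW M)
      (eventually_mem_localRing (mem_localRing_generic f))
    have hsmul := hΛ V (hVW.trans (hWU M)) _ hgV
      (constFn f hV • Sec.res hVW ((orderSheaf d I).toSec (r M)))
    rw [map_smul, map_smulₛₗ, map_smulₛₗ, hΛ, modEval_res, modEval_toSec, hr,
      fnEval_constFn] at hsmul
    exact hsmul.symm

theorem exists_dualEval_app_eq_trace_mul
    (φ : LocalHom (orderSheaf d I).toModules (dualizingSheaf k) U)
    (hU : (.generic : Point k) ∈ U) :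
    ∃ Y : Matrix (Fin n) (Fin n) (RatFunc k),
      ∀ (V : Opens (nodalCurve k)) (hV : V ≤ U) (x : Point k) (hx : x ∈ V)
        (s : Sec (orderSheaf d I).toModules V),
        dualEval hx (φ.app V hV s) = (modEval hx s * Y).trace * RatFunc.X⁻¹ := by
  obtain ⟨Λ, hΛ⟩ := exists_linearMap_dualEval_app φ hU
  obtain ⟨Y, hY⟩ := exists_eq_trace_mul ((RatFunc.X : RatFunc k) • Λ)
  refine ⟨Y, fun V hV x hx s => ?_⟩
  rw [hΛ, ← hY, LinearMap.smul_apply, smul_eq_mul, mul_comm RatFunc.X,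
    mul_inv_cancel_right₀ RatFunc.X_ne_zero]

theorem eq_of_traceHom_mul_eq (hI : ∀ p ∈ I, p.1.trace = p.2.trace)
    {y z : (orderSheaf d I).Sections U}
    (h : ∀ (V : Opens (nodalCurve k)) (hV : V ≤ U) (s : (orderSheaf d I).Sections V),
      Sec.map (traceHom hI) V ((orderSheaf d I).toSec (s * (orderSheaf d I).res hV y)) =
        Sec.map (traceHom hI) V ((orderSheaf d I).toSec (s * (orderSheaf d I).res hV z))) :
    y = z := by
  refine sections_ext fun (x : Point k) hx => Matrix.ext_iff_trace_mul_left.2 fun M => ?_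
  obtain ⟨V, hVU, hgV, s, rfl⟩ := exists_secEval_eq (d := d) (I := I) (generic_mem_of_mem hx) M
  have htrace := congrArg (dualEval hgV) (h V hVU s)
  rw [dualEval_traceHom_mul, dualEval_traceHom_mul, secEval_res, secEval_res,
    secEval_eq (hVU hgV) hx, secEval_eq (hVU hgV) hx] at htrace
  exact mul_right_cancel₀ (inv_ne_zero RatFunc.X_ne_zero) htrace

theorem nuIsIso_traceHom (hI : ∀ p ∈ I, p.1.trace = p.2.trace)
    (hI' : ∀ q : Matrix (Fin n) (Fin n) k × Matrix (Fin n) (Fin n) k,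
      (∀ p ∈ I, (p.1 * q.1).trace = (p.2 * q.2).trace) → q ∈ I) :
    NuIsIso (orderSheaf d I) (traceHom hI) := by
  intro U φ
  refine existsUnique_of_exists_of_unique ?_ fun y z hy hz => eq_of_traceHom_mul_eq hI
    fun V hV s => (hy V hV s).symm.trans (hz V hV s)
  by_cases hU : ∃ x : Point k, x ∈ U
  · obtain ⟨x, hx⟩ := hU
    obtain ⟨Y, hY⟩ := exists_dualEval_app_eq_trace_mul φ (generic_mem_of_mem hx)
    have hY_mem (y : Point k) (hy : y ∈ U) : Y ∈ orderStalk d I y := by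
      refine mem_orderStalk_of_trace_mul_mem hI' fun M hM => ?_
      obtain ⟨V, hVU, hyV, hV⟩ := exists_opens_of_eventually hy (eventually_mem_orderStalk hM)
      have heval := hY V hVU y hyV ((orderSheaf d I).toSec (constSec M hV))
      exact isDualizingAt_mul_inv_X_iff.1 (heval ▸ isDualizingAt_dualEval hyV _)
    refine ⟨constSec Y hY_mem, fun V hV s => dual_ext fun (y : Point k) hy => ?_⟩
    rw [hY, dualEval_traceHom_mul, secEval_res]
    rfl
  · exact ⟨0, fun V hV s => dual_ext fun y hy => absurd ⟨y, hV hy⟩ hU⟩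

end Duality

/-! ### Global sections -/

section ProjectiveLine

theorem val0_algebraMap (p : Polynomial k) :
    val0 (algebraMap (Polynomial k) (RatFunc k) p) = p.coeff 0 := by
  rw [val0, RatFunc.eval_algebraMap, Algebra.algebraMap_self, RingHom.id_apply,
    Polynomial.eval₂_at_zero, RingHom.id_apply]

theorem X_pow_mul_swap_algebraMap (p : Polynomial k) :
    RatFunc.X ^ p.natDegree * swap k (algebraMap _ _ p) = algebraMap _ _ p.reverse := by
  have hX := RatFunc.X_ne_zero (K := k)
  let _ : Invertible (RatFunc.X⁻¹ : RatFunc k) := invertibleOfNonzero (inv_ne_zero hX)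
  have hrev := Polynomial.eval₂_reverse_mul_pow (algebraMap k (RatFunc k)) RatFunc.X⁻¹ p
  rw [swap_algebraMap, Polynomial.aeval_def, ← hrev, mul_left_comm, ← mul_pow,
    mul_inv_cancel₀ hX, one_pow, mul_one, invOf_eq_inv, inv_inv, ← Polynomial.aeval_def,
    RatFunc.aeval_X_left_eq_algebraMap]

theorem natDegree_le_of_isSectionAt_infty {e : ℤ} {p : Polynomial k} (hp : p ≠ 0)
    (h : IsSectionAt e .infty (algebraMap _ (RatFunc k) p)) : p.natDegree ≤ e := by
  by_contra! hlt
  have hX := RatFunc.X_ne_zero (K := k)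
  obtain ⟨N, hN⟩ := Int.eq_ofNat_of_zero_le (show 0 ≤ (p.natDegree : ℤ) - e - 1 by lia)
  let g := swap k (RatFunc.X ^ (-e) * algebraMap _ _ p)
  have hg : RegularAt 0 g := h
  have hrev : RatFunc.X * (RatFunc.X ^ N * g) = algebraMap _ _ p.reverse := by
    simp only [g]
    rw [← X_pow_mul_swap_algebraMap, map_mul, map_zpow₀, swap_X, inv_zpow', neg_neg, ← mul_assoc,
      ← mul_assoc, ← pow_succ', ← zpow_natCast, ← zpow_natCast, ← zpow_add₀ hX]
    congr 2
    push_cast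
    lia
  have hval := congrArg val0 hrev
  have hpow : RegularAt 0 (RatFunc.X ^ N : RatFunc k) :=
    pow_mem (show RatFunc.X ∈ regularRing (0 : k) from regularAt_X 0) N
  rw [val0_mul (regularAt_X 0) (hpow.mul hg), val0_X, zero_mul,
    val0_algebraMap, Polynomial.coeff_zero_reverse] at hval
  exact hp (Polynomial.leadingCoeff_eq_zero.1 hval.symm)

variable [IsAlgClosed k] {f : RatFunc k}

theorem exists_eq_algebraMap_of_forall_regularAt (hf : ∀ a, RegularAt a f) :
    ∃ p : Polynomial k, f = algebraMap _ _ p := by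
  have hdenom : f.denom = 1 :=
    Polynomial.eq_one_of_monic_natDegree_zero f.monic_denom <| by
      by_contra h
      obtain ⟨a, ha⟩ := IsAlgClosed.exists_root f.denom
        fun h' => h (Polynomial.natDegree_eq_of_degree_eq_some h')
      exact hf a ha
  refine ⟨f.num, ?_⟩
  conv_lhs => rw [← f.num_div_denom, hdenom, map_one, div_one]

theorem exists_polynomial_of_isSectionAt {e : ℤ} (hf : ∀ p, IsSectionAt e p f) :
    ∃ p : Polynomial k, f = algebraMap _ _ p ∧ (p ≠ 0 → p.natDegree ≤ e) := by
  obtain ⟨p, rfl⟩ := exists_eq_algebraMap_of_forall_regularAt fun a => hf (.finite a)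
  exact ⟨p, rfl, fun hp => natDegree_le_of_isSectionAt_infty hp (hf .infty)⟩

theorem eq_zero_of_isSectionAt_of_neg {e : ℤ} (he : e < 0) (hf : ∀ p, IsSectionAt e p f) :
    f = 0 := by
  obtain ⟨p, rfl, hp⟩ := exists_polynomial_of_isSectionAt hf
  by_cases h : p = 0
  · rw [h, map_zero]
  · exact absurd ((hp h).trans_lt he) (Int.natCast_nonneg _).not_gt

theorem exists_eq_C_of_isSectionAt_zero (hf : ∀ p, IsSectionAt 0 p f) :
    ∃ c, f = RatFunc.C c := by
  obtain ⟨p, rfl, hp⟩ := exists_polynomial_of_isSectionAt hf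
  by_cases h : p = 0
  · exact ⟨0, by rw [h, map_zero, map_zero]⟩
  · obtain ⟨c, rfl⟩ := Polynomial.natDegree_eq_zero.1 (Nat.le_zero.1 (Int.ofNat_le.1 (hp h)))
    exact ⟨c, RatFunc.algebraMap_C c⟩

theorem eq_zero_of_isSectionAt_one (hf : ∀ p, IsSectionAt 1 p f) (h₀ : val0 f = 0)
    (h₁ : valInfty 1 f = 0) : f = 0 := by
  obtain ⟨p, rfl, hp⟩ := exists_polynomial_of_isSectionAt hf
  have hdeg : p.natDegree ≤ 1 := by
    by_cases h : p = 0
    · simp [h]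
    · exact Int.ofNat_le.1 (hp h)
  obtain ⟨a, b, rfl⟩ := Polynomial.exists_eq_X_add_C_of_natDegree_le_one hdeg
  have hswap : swap k (RatFunc.X ^ (-1 : ℤ) *
        algebraMap _ _ (Polynomial.C a * Polynomial.X + Polynomial.C b)) =
      algebraMap _ _ (Polynomial.C b * Polynomial.X + Polynomial.C a) := by
    simp only [map_mul, map_add, RatFunc.algebraMap_C, RatFunc.algebraMap_X, zpow_neg_one, map_inv₀,
      swap_X, swap_C, inv_inv]
    field_simp [RatFunc.X_ne_zero (K := k)]
    ring
  rw [valInfty, hswap, val0_algebraMap] at h₁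
  rw [val0_algebraMap] at h₀
  have ha : a = 0 := by simpa using h₁
  have hb : b = 0 := by simpa using h₀
  simp [ha, hb]

end ProjectiveLine

theorem isSectionAt_of_forall_mem {M : Matrix (Fin n) (Fin n) (RatFunc k)}
    (hM : ∀ x, M ∈ orderStalk d I x) (i j : Fin n) (p : P1 k) :
    IsSectionAt (d i - d j) p (M i j) :=
  (hM (proj p)).1 p rfl i j

section Entries

variable [IsAlgClosed k] {M : Matrix (Fin n) (Fin n) (RatFunc k)} {i j : Fin n}

theorem apply_eq_C_of_degree_eq (hM : ∀ x, M ∈ orderStalk d I x) (h : d i = d j) :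
    M i j = RatFunc.C (matVal0 M i j) ∧ matValInfty d M i j = matVal0 M i j := by
  have hsec := isSectionAt_of_forall_mem hM i j
  simp only [matVal0, matValInfty, Matrix.of_apply]
  rw [h, sub_self] at hsec ⊢
  obtain ⟨c, hc⟩ := exists_eq_C_of_isSectionAt_zero hsec
  rw [hc, val0_C, valInfty_C]
  exact ⟨rfl, rfl⟩

theorem apply_eq_zero_of_degree_lt (hM : ∀ x, M ∈ orderStalk d I x) (h : d i < d j) :
    M i j = 0 :=
  eq_zero_of_isSectionAt_of_neg (sub_neg.2 h) (isSectionAt_of_forall_mem hM i j)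

theorem apply_eq_zero_of_degree_eq_add_one (hM : ∀ x, M ∈ orderStalk d I x) (h : d i = d j + 1)
    (h₀ : matVal0 M i j = 0) (h₁ : matValInfty d M i j = 0) : M i j = 0 := by
  have hsub : d i - d j = 1 := sub_eq_iff_eq_add'.2 h
  exact eq_zero_of_isSectionAt_one (hsub ▸ isSectionAt_of_forall_mem hM i j) h₀ (hsub ▸ h₁)

end Entries

theorem generic_mem_top : (.generic : Point k) ∈ (⊤ : Opens (nodalCurve k)) := trivial

theorem scalars_bijective [IsAlgClosed k] : Function.Bijective (scalars k) := by
  refine ⟨fun b c h => RatFunc.C_injective (congrArg (fnEval generic_mem_top) h), fun f => ?_⟩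
  obtain ⟨c, hc⟩ := exists_eq_C_of_isSectionAt_zero (f := fnEval generic_mem_top f) fun p =>
    (fnEval_mem generic_mem_top (y := proj p) trivial f).1 p rfl
  exact ⟨c, fnEval_injective generic_mem_top hc.symm⟩

theorem h0_order [NeZero n] (hM : ∀ M : Matrix (Fin n) (Fin n) (RatFunc k),
    (∀ x, M ∈ orderStalk d I x) → ∃ c, M = Matrix.scalar (Fin n) (RatFunc.C c)) :
    (orderSheaf d I).h0 (scalars k) = 1 := by
  let _ : Module k ((orderSheaf d I).Sections ⊤) :=
    Module.compHom _ (((orderSheaf d I).unitMap ⊤).comp (scalars k))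
  refine finrank_eq_one (1 : (orderSheaf d I).Sections ⊤) (fun h => ?_) fun s => ?_
  · have heval := congrArg (secEval generic_mem_top) h
    rw [map_one, map_zero] at heval
    exact one_ne_zero heval
  · obtain ⟨c, hc⟩ := hM (secEval generic_mem_top s) fun x => secEval_mem generic_mem_top trivial s
    refine ⟨c, secEval_injective generic_mem_top ?_⟩
    change secEval generic_mem_top ((orderSheaf d I).unitMap ⊤ (scalars k c) * 1) = _
    rw [mul_one, secEval_unitMap, hc]
    rfl

/-! ### Symmetric spherical orders -/

theorem exists_map_traceHom_ne_zero [NeZero n] (hI : ∀ p ∈ I, p.1.trace = p.2.trace) :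
    ∃ (U : Opens (nodalCurve k)) (s : Sec (orderSheaf d I).toModules U),
      Sec.map (traceHom hI) U s ≠ 0 := by
  obtain ⟨U, -, hU, s, hs⟩ := exists_secEval_eq (d := d) (I := I) generic_mem_top
    (Matrix.single 0 0 1)
  refine ⟨U, (orderSheaf d I).toSec s, fun h => ?_⟩
  have heval := congrArg (dualEval hU) h
  rw [dualEval_traceHom, modEval_toSec, hs, Matrix.trace_single_eq_same, one_mul, map_zero] at heval
  exact inv_ne_zero RatFunc.X_ne_zero heval

theorem map_traceHom_mul_comm (hI : ∀ p ∈ I, p.1.trace = p.2.trace) {U : Opens (nodalCurve k)}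
    (s t : (orderSheaf d I).Sections U) :
    Sec.map (traceHom hI) U ((orderSheaf d I).toSec (s * t)) =
      Sec.map (traceHom hI) U ((orderSheaf d I).toSec (t * s)) :=
  dual_ext fun (x : Point k) hx => by
    rw [dualEval_traceHom_mul, dualEval_traceHom_mul, Matrix.trace_mul_comm]

theorem exists_map_eq_smul_map_traceHom (hI : ∀ p ∈ I, p.1.trace = p.2.trace)
    (hI' : ∀ q : Matrix (Fin n) (Fin n) k × Matrix (Fin n) (Fin n) k,
      (∀ p ∈ I, (p.1 * q.1).trace = (p.2 * q.2).trace) → q ∈ I)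
    (hM : ∀ M : Matrix (Fin n) (Fin n) (RatFunc k),
      (∀ x, M ∈ orderStalk d I x) → ∃ c, M = Matrix.scalar (Fin n) (RatFunc.C c))
    (τ : SheafOfModules.Hom (orderSheaf d I).toModules (dualizingSheaf k)) :
    ∃ c : k, ∀ (U : Opens (nodalCurve k)) (s : Sec (orderSheaf d I).toModules U),
      Sec.map τ U s = Fn.res (le_top : U ≤ ⊤) (scalars k c) • Sec.map (traceHom hI) U s := by
  let φ : LocalHom (orderSheaf d I).toModules (dualizingSheaf k) ⊤ :=
    { app := fun V _ => Sec.map τ V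
      naturality := fun V W _ hW x => PresheafOfModules.naturality_apply τ.val (homOfLE hW).op x }
  obtain ⟨y, hy, -⟩ := nuIsIso_traceHom hI hI' ⊤ φ
  obtain ⟨c, hc⟩ := hM (secEval generic_mem_top y) fun x => secEval_mem generic_mem_top trivial y
  refine ⟨c, fun U (s : (orderSheaf d I).Sections U) => dual_ext fun (x : Point k) hx => ?_⟩
  have hφ := congrArg (dualEval hx) (hy U le_top s)
  rw [dualEval_traceHom_mul, secEval_res, secEval_eq _ generic_mem_top, hc, Matrix.scalar_apply,
    ← Matrix.smul_eq_mul_diagonal, Matrix.trace_smul, smul_eq_mul, mul_assoc] at hφ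
  refine hφ.trans (Eq.symm ?_)
  exact map_smulₛₗ (dualEval hx) (Fn.res le_top (scalars k c)) (Sec.map (traceHom hI) U s)

theorem isSymmetricSphericalOrder_order [IsAlgClosed k] [NeZero n]
    (hI : ∀ p ∈ I, p.1.trace = p.2.trace)
    (hI' : ∀ q : Matrix (Fin n) (Fin n) k × Matrix (Fin n) (Fin n) k,
      (∀ p ∈ I, (p.1 * q.1).trace = (p.2 * q.2).trace) → q ∈ I)
    (hM : ∀ M : Matrix (Fin n) (Fin n) (RatFunc k),
      (∀ x, M ∈ orderStalk d I x) → ∃ c, M = Matrix.scalar (Fin n) (RatFunc.C c)) :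
    IsSymmetricSphericalOrder (scalars k) (dualizingSheaf k) (orderSheaf d I) where
  isOrder := isOrder_order
  constants := scalars_bijective
  spherical := ⟨traceHom hI, exists_map_traceHom_ne_zero hI,
    exists_map_eq_smul_map_traceHom hI hI' hM, nuIsIso_traceHom hI hI',
    fun _ => map_traceHom_mul_comm hI⟩

end NodalCurve

/-! ### Belavin–Drinfeld combinatorics -/

theorem not_rel_of_isCycleOn {α β : Type*} [Finite α] [Preorder β] {σ : Equiv.Perm α}
    (hσ : σ.IsCycleOn Set.univ) {ρ : α → β} {P : α → α → Prop}
    (hlt : ∀ a b, P a b → ρ a < ρ b) (hstep : ∀ a b, P a b → P (σ a) (σ b)) (a b : α) :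
    ¬ P a b := by
  intro hab
  have hpow (r : ℕ) : P ((σ ^ r) a) ((σ ^ r) b) := by
    induction r with
    | zero => exact hab
    | succ r ih =>
      rw [pow_succ', Equiv.Perm.mul_apply, Equiv.Perm.mul_apply]
      exact hstep _ _ ih
  obtain ⟨s, rfl⟩ := hσ.exists_pow_eq' (Set.toFinite _) (Set.mem_univ a) (Set.mem_univ b)
  have hmono : StrictMono fun l : ℕ => ρ ((σ ^ (s * l)) a) := by
    refine strictMono_nat_of_lt_succ fun l => ?_
    rw [Nat.mul_succ, pow_add, Equiv.Perm.mul_apply]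
    exact hlt _ _ (hpow (s * l))
  exact not_injective_infinite_finite (fun l : ℕ => (σ ^ (s * l)) a) fun l l' h =>
    hmono.injective (congrArg ρ h)

namespace AssociativeBDData

open NodalCurve

section Degrees

variable {n : ℕ} (m : Fin n) {i j : Fin n}

theorem degrees_le_of_lt (h : i < j) : degrees m i ≤ degrees m j := by
  simp only [degrees, Fin.lt_def] at *
  split_ifs <;> lia

theorem degrees_le_of_rank_lt (h : rank m i < rank m j) : degrees m j ≤ degrees m i := by
  simp only [degrees, rank, Fin.lt_def] at *
  split_ifs at * <;> lia

theorem rank_lt_iff_of_degrees_eq (h : degrees m i = degrees m j) :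
    rank m i < rank m j ↔ i < j := by
  simp only [degrees, rank, Fin.lt_def] at *
  split_ifs at * <;> lia

theorem lt_and_rank_lt_of_degrees_lt (h : degrees m j < degrees m i) :
    j < i ∧ rank m i < rank m j := by
  simp only [degrees, rank, Fin.lt_def] at *
  split_ifs at * <;> lia

theorem degrees_eq_add_one (h : degrees m j < degrees m i) : degrees m i = degrees m j + 1 := by
  simp only [degrees] at *
  split_ifs at * <;> lia

theorem not_block_of_rank_lt {Γ : Set (Fin n × Fin n)} (hΓ : Γ ⊆ {p | p.2 = finRotate n p.1})
    {m : Fin n} (hm : ((finRotate n).symm m, m) ∉ Γ) (h : rank m i < rank m j)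
    (h' : (i, j) ∉ extend Γ) : ¬ Block Γ i j := by
  rintro (rfl | hij | hji)
  exacts [h.false, h' hij, (rank_lt hΓ hm hji).not_gt h]

end Degrees

variable {n : ℕ} [NeZero n] (D : AssociativeBDData n) {k : Type u} [Field k]
  (h₁ : ((finRotate n).symm 0, 0) ∉ D.Γ₁) (m : Fin n) (h₂ : ((finRotate n).symm m, m) ∉ D.Γ₂)
  {i j : Fin n}

section Lagrangian

theorem lt_of_mem_Pi₁ (h₁ : ((finRotate n).symm 0, 0) ∉ D.Γ₁) (h : (i, j) ∈ D.Pi₁) : i < j :=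
  (rank_zero_lt i j).1 (rank_lt D.proper₁.1 h₁ h)

theorem not_block_Γ₁ (h₁ : ((finRotate n).symm 0, 0) ∉ D.Γ₁) (h : i < j) (h' : (i, j) ∉ D.Pi₁) :
    ¬ Block D.Γ₁ i j :=
  not_block_of_rank_lt D.proper₁.1 h₁ ((rank_zero_lt i j).2 h) h'

theorem mem_isotropicSubalgebra_iff {p : Matrix (Fin n) (Fin n) k × Matrix (Fin n) (Fin n) k} :
    p ∈ D.isotropicSubalgebra k h₁ m h₂ ↔
      (∀ i j, j < i → (j, i) ∉ D.Pi₁ → p.1 i j = 0) ∧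
      (∀ i j, rank m i < rank m j → (i, j) ∉ D.Pi₂ → p.2 i j = 0) ∧
      ∀ i j, Block D.Γ₁ i j → p.1 i j = p.2 (D.σ i) (D.σ j) := by
  simp only [← mem_cyclicOrder_iff, ← leviMatch_iff]
  rfl

theorem single_zero_mem_isotropicSubalgebra (hij : i < j) (hn : (i, j) ∉ D.Pi₁) :
    (Matrix.single i j (1 : k), 0) ∈ D.isotropicSubalgebra k h₁ m h₂ := by
  refine (D.mem_isotropicSubalgebra_iff h₁ m h₂).2
    ⟨fun i' j' h _ => Matrix.single_apply_of_ne _ _ _ _ _ ?_, fun _ _ _ _ => rfl,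
      fun i' j' hb => Matrix.single_apply_of_ne _ _ _ _ _ ?_⟩
  · rintro ⟨rfl, rfl⟩
    exact h.not_gt hij
  · rintro ⟨rfl, rfl⟩
    exact D.not_block_Γ₁ h₁ hij hn hb

theorem zero_single_mem_isotropicSubalgebra (hij : rank m i < rank m j) (hn : (i, j) ∉ D.Pi₂) :
    (0, Matrix.single j i (1 : k)) ∈ D.isotropicSubalgebra k h₁ m h₂ := by
  refine (D.mem_isotropicSubalgebra_iff h₁ m h₂).2
    ⟨fun _ _ _ _ => rfl, fun i' j' h _ => Matrix.single_apply_of_ne _ _ _ _ _ ?_,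
      fun i' j' hb => (Matrix.single_apply_of_ne _ _ _ _ _ ?_).symm⟩
  · rintro ⟨rfl, rfl⟩
    exact h.not_gt hij
  · rintro ⟨rfl, rfl⟩
    exact not_block_of_rank_lt D.proper₂.1 h₂ hij hn ((D.block_iff _ _).2 hb).symm

theorem single_single_mem_isotropicSubalgebra (hij : Block D.Γ₁ i j) :
    (Matrix.single i j (1 : k), Matrix.single (D.σ i) (D.σ j) 1) ∈
      D.isotropicSubalgebra k h₁ m h₂ := by
  refine (D.mem_isotropicSubalgebra_iff h₁ m h₂).2
    ⟨fun i' j' h hn => Matrix.single_apply_of_ne _ _ _ _ _ ?_,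
      fun i' j' h hn => Matrix.single_apply_of_ne _ _ _ _ _ ?_,
      fun i' j' _ => by simp only [Matrix.single_apply, D.σ.injective.eq_iff]⟩
  · rintro ⟨rfl, rfl⟩
    exact D.not_block_Γ₁ h₁ h hn hij.symm
  · rintro ⟨rfl, rfl⟩
    exact not_block_of_rank_lt D.proper₂.1 h₂ h hn ((D.block_iff _ _).2 hij)

theorem eq_of_algebraMap_mem {a b : k} (h : (algebraMap k (Matrix (Fin n) (Fin n) k) a,
    algebraMap k (Matrix (Fin n) (Fin n) k) b) ∈ D.isotropicSubalgebra k h₁ m h₂) : a = b := by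
  simpa [Matrix.algebraMap_matrix_apply] using
    ((D.mem_isotropicSubalgebra_iff h₁ m h₂).1 h).2.2 0 0 (.inl rfl)

theorem trace_eq_of_mem {p : Matrix (Fin n) (Fin n) k × Matrix (Fin n) (Fin n) k}
    (hp : p ∈ D.isotropicSubalgebra k h₁ m h₂) : p.1.trace = p.2.trace := by
  obtain ⟨-, -, hσ⟩ := (D.mem_isotropicSubalgebra_iff h₁ m h₂).1 hp
  rw [Matrix.trace, Matrix.trace, ← Equiv.sum_comp D.σ p.2.diag]
  exact Finset.sum_congr rfl fun i _ => hσ i i (.inl rfl)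

theorem mem_of_forall_trace_mul_eq {q : Matrix (Fin n) (Fin n) k × Matrix (Fin n) (Fin n) k}
    (hq : ∀ p ∈ D.isotropicSubalgebra k h₁ m h₂, (p.1 * q.1).trace = (p.2 * q.2).trace) :
    q ∈ D.isotropicSubalgebra k h₁ m h₂ := by
  refine (D.mem_isotropicSubalgebra_iff h₁ m h₂).2
    ⟨fun i j hji hn => ?_, fun i j hij hn => ?_, fun i j hb => ?_⟩
  · simpa [Matrix.trace_single_mul] using
      hq _ (D.single_zero_mem_isotropicSubalgebra h₁ m h₂ hji hn)
  · simpa [Matrix.trace_single_mul] using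
      (hq _ (D.zero_single_mem_isotropicSubalgebra h₁ m h₂ hij hn)).symm
  · simpa [Matrix.trace_single_mul] using
      hq _ (D.single_single_mem_isotropicSubalgebra h₁ m h₂ hb.symm)

end Lagrangian

section GlobalSections

variable [IsAlgClosed k] {M : Matrix (Fin n) (Fin n) (RatFunc k)}

theorem matVal0_apply_eq_zero_of_lt
    (hM : ∀ x, M ∈ orderStalk (degrees m) (D.isotropicSubalgebra k h₁ m h₂) x) (hji : j < i) :
    matVal0 M i j = 0 := by
  obtain ⟨hA, -, hL⟩ := (D.mem_isotropicSubalgebra_iff h₁ m h₂).1 ((hM .node).2 rfl)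
  dsimp only at hA hL
  have hstep (j i : Fin n) (h : j < i ∧ matVal0 M i j ≠ 0) :
      D.σ j < D.σ i ∧ matVal0 M (D.σ i) (D.σ j) ≠ 0 := by
    have hmem : (j, i) ∈ D.Pi₁ := not_not.1 fun hn => h.2 (hA i j h.1 hn)
    have hrank := rank_lt D.proper₂.1 h₂ ((D.mem_Pi_iff j i).2 hmem)
    have hB : matValInfty (degrees m) M (D.σ i) (D.σ j) ≠ 0 := hL i j (.inr (.inr hmem)) ▸ h.2
    have hdeg : degrees m (D.σ i) = degrees m (D.σ j) := by
      refine (degrees_le_of_rank_lt m hrank).eq_of_not_lt fun hlt => hB ?_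
      simp [matValInfty, apply_eq_zero_of_degree_lt hM hlt, valInfty_zero]
    exact ⟨(rank_lt_iff_of_degrees_eq m hdeg.symm).1 hrank,
      (apply_eq_C_of_degree_eq hM hdeg).2 ▸ hB⟩
  by_contra hne
  exact not_rel_of_isCycleOn (ρ := id) D.cyclic (fun _ _ h => h.1) hstep j i ⟨hji, hne⟩

theorem matValInfty_apply_eq_zero_of_rank_lt
    (hM : ∀ x, M ∈ orderStalk (degrees m) (D.isotropicSubalgebra k h₁ m h₂) x)
    (hij : rank m i < rank m j) : matValInfty (degrees m) M i j = 0 := by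
  obtain ⟨-, hB, hL⟩ := (D.mem_isotropicSubalgebra_iff h₁ m h₂).1 ((hM .node).2 rfl)
  dsimp only at hB hL
  have hstep (i j : Fin n) (h : rank m i < rank m j ∧ matValInfty (degrees m) M i j ≠ 0) :
      rank m (D.σ⁻¹ i) < rank m (D.σ⁻¹ j) ∧
        matValInfty (degrees m) M (D.σ⁻¹ i) (D.σ⁻¹ j) ≠ 0 := by
    obtain ⟨i, rfl⟩ := D.σ.surjective i
    obtain ⟨j, rfl⟩ := D.σ.surjective j
    have hinv (i : Fin n) : D.σ⁻¹ (D.σ i) = i := D.σ.symm_apply_apply i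
    rw [hinv, hinv]
    have hmem : (i, j) ∈ D.Pi₁ :=
      (D.mem_Pi_iff i j).1 (not_not.1 fun hn => h.2 (hB _ _ h.1 hn))
    have hlt := D.lt_of_mem_Pi₁ h₁ hmem
    have hA : matVal0 M i j ≠ 0 := (hL i j (.inr (.inl hmem))).symm ▸ h.2
    have hdeg : degrees m i = degrees m j := by
      refine (degrees_le_of_lt m hlt).eq_of_not_lt fun hdlt => hA ?_
      simp [matVal0, apply_eq_zero_of_degree_lt hM hdlt, val0_zero]
    exact ⟨(rank_lt_iff_of_degrees_eq m hdeg).2 hlt,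
      (apply_eq_C_of_degree_eq hM hdeg).2.symm ▸ hA⟩
  by_contra hne
  exact not_rel_of_isCycleOn (ρ := rank m) D.cyclic.inv (fun _ _ h => h.1) hstep i j ⟨hij, hne⟩

theorem apply_eq_zero_of_ne
    (hM : ∀ x, M ∈ orderStalk (degrees m) (D.isotropicSubalgebra k h₁ m h₂) x) (hij : i ≠ j) :
    M i j = 0 := by
  rcases lt_trichotomy (degrees m i) (degrees m j) with hlt | heq | hgt
  · exact apply_eq_zero_of_degree_lt hM hlt
  · obtain ⟨hC, hval⟩ := apply_eq_C_of_degree_eq hM heq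
    suffices matVal0 M i j = 0 by rw [hC, this, map_zero]
    rcases hij.lt_or_gt with hlt | hgt
    · exact hval ▸ D.matValInfty_apply_eq_zero_of_rank_lt h₁ m h₂ hM
        ((rank_lt_iff_of_degrees_eq m heq).2 hlt)
    · exact D.matVal0_apply_eq_zero_of_lt h₁ m h₂ hM hgt
  · obtain ⟨hlt, hrank⟩ := lt_and_rank_lt_of_degrees_lt m hgt
    exact apply_eq_zero_of_degree_eq_add_one hM (degrees_eq_add_one m hgt)
      (D.matVal0_apply_eq_zero_of_lt h₁ m h₂ hM hlt)
      (D.matValInfty_apply_eq_zero_of_rank_lt h₁ m h₂ hM hrank)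

theorem matVal0_apply_self_eq
    (hM : ∀ x, M ∈ orderStalk (degrees m) (D.isotropicSubalgebra k h₁ m h₂) x) (i : Fin n) :
    matVal0 M i i = matVal0 M 0 0 := by
  obtain ⟨-, -, hL⟩ := (D.mem_isotropicSubalgebra_iff h₁ m h₂).1 ((hM .node).2 rfl)
  dsimp only at hL
  obtain ⟨s, rfl⟩ := D.cyclic.exists_pow_eq' (Set.toFinite _) (Set.mem_univ 0) (Set.mem_univ i)
  induction s with
  | zero => rfl
  | succ s ih =>
    rw [pow_succ', Equiv.Perm.mul_apply, ← (apply_eq_C_of_degree_eq hM rfl).2,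
      ← hL _ _ (.inl rfl), ih]

theorem exists_eq_scalar_of_forall_mem
    (hM : ∀ x, M ∈ orderStalk (degrees m) (D.isotropicSubalgebra k h₁ m h₂) x) :
    ∃ c, M = Matrix.scalar (Fin n) (RatFunc.C c) := by
  refine ⟨matVal0 M 0 0, Matrix.ext fun i j => ?_⟩
  rw [Matrix.scalar_apply]
  by_cases hij : i = j
  · subst hij
    rw [Matrix.diagonal_apply_eq, (apply_eq_C_of_degree_eq hM rfl).1,
      D.matVal0_apply_self_eq h₁ m h₂ hM]
  · rw [Matrix.diagonal_apply_ne _ hij, D.apply_eq_zero_of_ne h₁ m h₂ hM hij]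

end GlobalSections

end AssociativeBDData

theorem lemma1p7_general {k : Type u} [Field k] [IsAlgClosed k] {n : ℕ} [NeZero n]
    (D : AssociativeBDData n) (h₁ : ((finRotate n).symm 0, 0) ∉ D.Γ₁)
    (m : Fin n) (h₂ : ((finRotate n).symm m, m) ∉ D.Γ₂) :
    (D.order k h₁ m h₂).h0 (NodalCurve.scalars k) = 1 ∧
    SphericalOrder.IsSymmetricSphericalOrder (NodalCurve.scalars k) (NodalCurve.dualizingSheaf k)
      (D.order k h₁ m h₂) ∧
    SphericalOrder.CenterIsStructureSheaf (D.order k h₁ m h₂) := by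
  have hscalar := fun M => D.exists_eq_scalar_of_forall_mem (k := k) (M := M) h₁ m h₂
  exact ⟨NodalCurve.h0_order hscalar,
    NodalCurve.isSymmetricSphericalOrder_order (fun _ => D.trace_eq_of_mem h₁ m h₂)
      (fun _ => D.mem_of_forall_trace_mul_eq h₁ m h₂) hscalar,
    NodalCurve.centerIsStructureSheaf_order fun _ _ => D.eq_of_algebraMap_mem h₁ m h₂⟩

theorem lemma1p7 {k : Type u} [Field k] [IsAlgClosed k] [CharZero k] {n : ℕ} [NeZero n]
    (D : AssociativeBDData n) (h₁ : ((finRotate n).symm 0, 0) ∉ D.Γ₁)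
    (m : Fin n) (h₂ : ((finRotate n).symm m, m) ∉ D.Γ₂) :
    (D.order k h₁ m h₂).h0 (NodalCurve.scalars k) = 1 ∧
    SphericalOrder.IsSymmetricSphericalOrder (NodalCurve.scalars k) (NodalCurve.dualizingSheaf k)
      (D.order k h₁ m h₂) ∧
    SphericalOrder.CenterIsStructureSheaf (D.order k h₁ m h₂) :=
  lemma1p7_general D h₁ m h₂
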